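/- Let $d\ge 2$ be an integer, $1<p<\infty$ and $0<\delta\le 1$. There is a constant $N>0$, depending only on $d$, $p$ and $\delta$, such that the following holds. Let $\varepsilon_0>0$, $R_0>0$, $0<R<\delta R_0/8$, write points of $\mathbb{R}^d$ as $y=(y',y^d)$ with $y'\in\mathbb{R}^{d-1}$, and put $B'_r=\{y'\in\mathbb{R}^{d-1}:|y'|<r\}$. Let $\Omega\subset\mathbb{R}^d$ be a domain which near a boundary point $x_0=(0,\psi(0))$ lies below the graph of a function $\psi$, that is, $$\{y\in\Omega: |y-x_0|<R_0,\ |y'|<\delta R_0\}=\{y: |y-x_0|<R_0,\ |y'|<\delta R_0,\ y^d<\psi(y')\},$$ where $\psi(0)=\frac{3}{\delta}R$, and where $\psi$ is Lipschitz on $B'_{\delta R_0}$ with constant $2/\delta$ and satisfies $|D\psi(y')-D\psi(z')|<3\varepsilon_0$ for almost every $y',z'\in B'_{\delta R_0}$. Let $$\Omega_R=\{y: |y'|<R,\ 0<y^d<\psi(y')\},\qquad \Gamma_r=\{y: |y'|<r,\ y^d=\psi(y')\}.$$ Then for every $g\in W^{1-1/p}_p(\Gamma_{3R})$ (in particular,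 for the restriction to $\Gamma_{3R}$ of any $g\in W^{1-1/p}_p(\partial\Omega)$) there is $v\in W^2_p(\Omega_R)$ such that $$\frac{\partial v}{\partial y^d}=g\quad\text{on }\Gamma_R$$ in the sense of traces of functions in $W^1_p(\Omega_R)$, and $$\|v\|_{W^2_p(\Omega_R)}\le N\left(\|g\|_{W^{1-1/p}_p(\Gamma_{3R})}+R^{-1+1/p}\|g\|_{L_p(\Gamma_{3R})}\right).$$ Here $L_p(\Gamma_r)$ is taken with respect to surface measure, $W^1_p(\Gamma_r)$ is defined through weak derivatives in the graph parameter $y'\in B'_r$, and for $0<s<1$ the space $W^s_p(\Gamma_r)$ is the real interpolation space $(L_p(\Gamma_r),W^1_p(\Gamma_r))_{s,p}$ with the norm $$\Big(\int_0^\infty \big(t^{-s}K(t,g)\big)^p\,\frac{dt}{t}\Big)^{1/p},\qquad K(t,g)=\inf_{g=g_0+g_1}\big(\|g_0\|_{L_p(\Gamma_r)}+t\|g_1\|_{W^1_p(\Gamma_r)}\big).$$ -/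

import Mathlib

open MeasureTheory Set Filter Topology
open scoped ENNReal NNReal ContDiff

noncomputable section

/-- `ℝ^{d-1}` with its Euclidean structure: the space of the tangential variables `y'`. -/
abbrev Tan (d : ℕ) : Type := EuclideanSpace ℝ (Fin (d - 1))

/-- `ℝ^d`, whose points are written `y = (y', y^d)` as pairs. The product measure is Lebesgue
measure. Only the topology, the linear structure and Lebesgue measure of this product are used;
the Euclidean distance of `ℝ^d` is written out explicitly where it is needed. -/
abbrev Pt (d : ℕ) : Type := Tan d × ℝ

/-- The coordinate vectors of `ℝ^{d-1}`. -/
def tanDir (d : ℕ) (i : Fin (d - 1)) : Tan d := EuclideanSpace.single i 1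

/-- The coordinate vectors of `ℝ^d`: `some i` is the `i`-th tangential direction, and `none` is
the `y^d`-direction. -/
def ptDir (d : ℕ) : Option (Fin (d - 1)) → Pt d
  | some i => (tanDir d i, 0)
  | none => (0, 1)

section Sobolev

variable {E : Type*} [NormedAddCommGroup E] [NormedSpace ℝ E] [MeasureSpace E]

/-- `w` is the weak derivative of `u` in the direction `a` in the open set `U`. -/
def HasWeakDeriv (U : Set E) (a : E) (u w : E → ℝ) : Prop :=
  LocallyIntegrableOn u U volume ∧ LocallyIntegrableOn w U volume ∧
    ∀ φ : E → ℝ, ContDiff ℝ ∞ φ → HasCompactSupport φ → tsupport φ ⊆ U →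
      ∫ x in U, u x * fderiv ℝ φ x a = - ∫ x in U, w x * φ x

variable {ι : Type*} [Fintype ι]

/-- The norm `‖u‖_{L_p} + ∑ᵢ ‖D_i u‖_{L_p}` of `W^1_p(U)`, with `D_i` the weak derivative in `U` in
the direction `e i`, and with `L_p`-norms taken with respect to the measure `μ`. Weak derivatives
are unique a.e., so that the infimum is over at most one gradient (up to null sets of `U`); it is
`∞` if there is none. -/
def sobolevNorm1 (U : Set E) (μ : Measure E) (e : ι → E) (p : ℝ) (u : E → ℝ) : ℝ≥0∞ :=
  ⨅ (D : ι → E → ℝ) (_ : ∀ i, HasWeakDeriv U (e i) u (D i)),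
    eLpNorm u (ENNReal.ofReal p) μ + ∑ i, eLpNorm (D i) (ENNReal.ofReal p) μ

/-- The norm `‖u‖_{L_p} + ∑ᵢ ‖D_i u‖_{L_p} + ∑ᵢⱼ ‖D_{ij} u‖_{L_p}` of `W^2_p(U)`; it is `∞` if some
weak derivative of order at most two does not exist. -/
def sobolevNorm2 (U : Set E) (μ : Measure E) (e : ι → E) (p : ℝ) (u : E → ℝ) : ℝ≥0∞ :=
  ⨅ (D : ι → E → ℝ) (H : ι → ι → E → ℝ) (_ : ∀ i, HasWeakDeriv U (e i) u (D i))
    (_ : ∀ i j, HasWeakDeriv U (e j) (D i) (H i j)),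
    eLpNorm u (ENNReal.ofReal p) μ + ∑ i, eLpNorm (D i) (ENNReal.ofReal p) μ
      + ∑ i, ∑ j, eLpNorm (H i j) (ENNReal.ofReal p) μ

/-- Peetre's functional
`K(t, u) = inf { ‖u₀‖_{L_p} + t ‖u₁‖_{W^1_p} : u = u₀ + u₁ }` of the couple `(L_p, W^1_p)`. -/
def peetreK (U : Set E) (μ : Measure E) (e : ι → E) (p : ℝ) (t : ℝ) (u : E → ℝ) : ℝ≥0∞ :=
  ⨅ u₁ : E → ℝ, eLpNorm (u - u₁) (ENNReal.ofReal p) μ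
    + ENNReal.ofReal t * sobolevNorm1 U μ e p u₁

/-- The norm `(∫_0^∞ (t^{-s} K(t, u))^p dt / t)^{1/p}` of the real interpolation space
`W^s_p = (L_p, W^1_p)_{s,p}`, for `0 < s < 1`. -/
def fracSobolevNorm (U : Set E) (μ : Measure E) (e : ι → E) (s p : ℝ) (u : E → ℝ) : ℝ≥0∞ :=
  (∫⁻ t in Ioi (0 : ℝ),
    (ENNReal.ofReal (t ^ (-s)) * peetreK U μ e p t u) ^ p * ENNReal.ofReal t⁻¹) ^ (1 / p)

end Sobolev

/-- The cylindrical neighborhood `Ω_r = {(y', y^d) : |y'| < r, 0 < y^d < ψ(y')}`. -/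
def cylNhd {d : ℕ} (ψ : Tan d → ℝ) (r : ℝ) : Set (Pt d) :=
  {y | ‖y.1‖ < r ∧ 0 < y.2 ∧ y.2 < ψ y.1}

/-- The surface measure `√(1 + |Dψ|²) dy'` of the boundary piece
`Γ_r = {(y', y^d) : |y'| < r, y^d = ψ(y')}`, carried back to the parameter ball
`|y'| < r` by the graph map `y' ↦ (y', ψ(y'))`. -/
def surfMeasure {d : ℕ} (ψ : Tan d → ℝ) (r : ℝ) : Measure (Tan d) :=
  (volume.restrict (Metric.ball 0 r)).withDensity
    fun y' => ENNReal.ofReal (Real.sqrt (1 + ‖fderiv ℝ ψ y'‖ ^ 2))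

/-- A function on the boundary, expressed in the graph parameter `y'`. -/
def onGraph {d : ℕ} (ψ : Tan d → ℝ) (g : Pt d → ℝ) : Tan d → ℝ := fun y' => g (y', ψ y')

/-- The norm of `L_p(Γ_r)`. -/
def bdryLpNorm {d : ℕ} (ψ : Tan d → ℝ) (r p : ℝ) (g : Pt d → ℝ) : ℝ≥0∞ :=
  eLpNorm (onGraph ψ g) (ENNReal.ofReal p) (surfMeasure ψ r)

/-- The norm of `W^s_p(Γ_r) = (L_p(Γ_r), W^1_p(Γ_r))_{s,p}`, where `L_p(Γ_r)` carries the surface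
measure and `W^1_p(Γ_r)` consists of the functions with weak derivatives in the graph
parameter. -/
def bdryFracNorm {d : ℕ} (ψ : Tan d → ℝ) (r s p : ℝ) (g : Pt d → ℝ) : ℝ≥0∞ :=
  fracSobolevNorm (Metric.ball 0 r) (surfMeasure ψ r) (tanDir d) s p (onGraph ψ g)

/-- `g ∈ W^s_p(Γ_r)`. -/
def MemBdryFrac {d : ℕ} (ψ : Tan d → ℝ) (r s p : ℝ) (g : Pt d → ℝ) : Prop :=
  MemLp (onGraph ψ g) (ENNReal.ofReal p) (surfMeasure ψ r) ∧ bdryFracNorm ψ r s p g < ⊤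

/-- The norm of `W^1_p(Ω_r)`. -/
def cylNorm1 {d : ℕ} (ψ : Tan d → ℝ) (r p : ℝ) (u : Pt d → ℝ) : ℝ≥0∞ :=
  sobolevNorm1 (cylNhd ψ r) (volume.restrict (cylNhd ψ r)) (ptDir d) p u

/-- The norm of `W^2_p(Ω_r)`. -/
def cylNorm2 {d : ℕ} (ψ : Tan d → ℝ) (r p : ℝ) (u : Pt d → ℝ) : ℝ≥0∞ :=
  sobolevNorm2 (cylNhd ψ r) (volume.restrict (cylNhd ψ r)) (ptDir d) p u

/-- `u ∈ W^1_p(Ω_r)` has the trace `g` on `Γ_r`: the trace operator is the continuous extension, from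
`W^1_p(Ω_r)` to `L_p(Γ_r)`, of the restriction of functions that are continuous up to the
boundary. -/
def HasTraceOn {d : ℕ} (ψ : Tan d → ℝ) (r p : ℝ) (u g : Pt d → ℝ) : Prop :=
  cylNorm1 ψ r p u < ⊤ ∧
    ∃ U : ℕ → Pt d → ℝ,
      (∀ k, ContinuousOn (U k) (closure (cylNhd ψ r)) ∧ cylNorm1 ψ r p (U k) < ⊤) ∧
      Tendsto (fun k => cylNorm1 ψ r p (U k - u)) atTop (𝓝 0) ∧
      Tendsto (fun k => bdryLpNorm ψ r p (U k - g)) atTop (𝓝 0)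

/-- The domain `Ω`, in the coordinates `y = (y', y^d)`, lies below the graph of `ψ` near its
boundary point `x₀ = (0, ψ(0)) = (0, 3R/δ)`, within the distance `R₀` of `x₀` and over the ball
`|y'| < δ R₀`. In this ball, `ψ` has the Lipschitz constant `2/δ`, and its gradient has an
oscillation of less than `3 ε₀`. -/
structure IsGraphNear {d : ℕ} (Ω : Set (Pt d)) (δ ε₀ R₀ R : ℝ) (ψ : Tan d → ℝ) : Prop where
  isOpen : IsOpen Ω
  isConnected : IsConnected Ω
  graph : ∀ y : Pt d, ‖y.1‖ ^ 2 + (y.2 - ψ 0) ^ 2 < R₀ ^ 2 → ‖y.1‖ < δ * R₀ →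
    (y ∈ Ω ↔ y.2 < ψ y.1)
  center : ψ 0 = 3 / δ * R
  lipschitz : LipschitzOnWith (Real.toNNReal (2 / δ)) ψ (Metric.ball 0 (δ * R₀))
  oscillation : ∀ᵐ y' ∂(volume.restrict (Metric.ball (0 : Tan d) (δ * R₀))),
    ∀ᵐ z' ∂(volume.restrict (Metric.ball (0 : Tan d) (δ * R₀))),
      ‖fderiv ℝ ψ y' - fderiv ℝ ψ z'‖ < 3 * ε₀

end

/-!
The function `v` is built scale by scale. Let `n = d - 1`, let `f` be `g` in the graph parameter,
extended by zero off the ball of radius `3R`, and let `ρ = min R 1` and `ρ_k = ρ 2^{-k}`. For a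
mollifier `η`, the function `f` is the sum of the smooth functions
`h_0 = η_ρ ⋆ f` and `h_{k+1} = η_{ρ_{k+1}} ⋆ f - η_{ρ_k} ⋆ f`. If `ψ_k` is a mollification of `ψ` at
a scale comparable to `ρ_k`, and `Φ` is a compactly supported function with `Φ(t) = -t` near `0`,
then
`v = ∑ₖ ρ_k h_k(y') Φ((ψ_k(y') - y^d) / ρ_k)`.
The `k`-th term (`layerTerm`) lives within the distance `2ρ_k` of the graph, so that the sum is
locally finite below the graph and `v` is smooth there. In the normal derivative, the `k`-th term is
`h_k(y')` on the graph itself, and hence the partial sums of `w = ∂v/∂y^d` restrict to the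
mollifications `η_{ρ_k} ⋆ f`, which converge to `g` in `L_p`. Although `ψ` is merely Lipschitz, its
mollification satisfies `|Dψ_k| ≤ C` and `|D²ψ_k| ≤ C / ρ_k`, and this is all that second
derivatives of `v` need (`abs_layerTerm_le`): all derivatives of order at most two of the `k`-th
term are bounded by `C ρ_k⁻¹ H_k(y')` in its layer, where `H_k = |h_k| + ρ_k |Dh_k| + ρ_k² |D²h_k|`.

Two estimates conclude the proof. Hardy's inequality in the direction normal to the graph
(`lintegral_tsum_dyadic_rpow_le`, `lintegral_tsum_layerInd_rpow_le`) bounds the `L_p`-norm of a sum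
over layers by `(∑ₖ ρ_k^{1-p} ‖H_k‖_p^p)^{1/p}`. And `‖H_{k+1}‖_p ≤ C K(ρ_k, f)` with Peetre's
functional `K` (`IsKernel.exists_scaledSize_le_peetreK`), so that the sum is a discretization of the
interpolation norm of exponent `1 - 1/p` (`tsum_dyadic_peetreK_le`). The estimate by `K` uses a
mollifier for which `η_{1/2} - η` is the divergence of a compactly supported smooth field
(`exists_mollifier`): in the part of `f` that has weak derivatives, the derivative moves from the
kernel onto the function, which gains a factor `ρ_k`; in the other part Young's inequality is enough.
The first term `h_0` contributes `ρ^{-1+1/p} ‖g‖_p`, and for `R > 1` this is `‖g‖_p`, which the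
interpolation norm controls because the norm of `W^1_p` is inhomogeneous
(`eLpNorm_le_fracSobolevNorm`).
-/

/-! ### A mollifier whose dyadic differences are divergences -/

/-- A smooth function on `ℝ^{d-1}` that vanishes off the closed unit ball. -/
structure IsKernel {d : ℕ} (κ : Tan d → ℝ) : Prop where
  contDiff : ContDiff ℝ ∞ κ
  eq_zero : ∀ x, 1 < ‖x‖ → κ x = 0

/-- The radial profile `s ↦ s^{-n/2} τ(s)`, as a function of `s = ‖x‖²`, where `τ` is a smooth
transition from `0` for `s ≤ 1/4` to `1` for `s ≥ 1/2`. -/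
noncomputable def radialProfile (n : ℕ) (s : ℝ) : ℝ :=
  s ^ (-(n : ℝ) / 2) * Real.smoothTransition (4 * s - 1)

theorem radialProfile_of_le {n : ℕ} {s : ℝ} (hs : s ≤ 1 / 4) : radialProfile n s = 0 := by
  rw [radialProfile, Real.smoothTransition.zero_of_nonpos (by linarith), mul_zero]

theorem radialProfile_of_ge {n : ℕ} {s : ℝ} (hs : 1 / 2 ≤ s) :
    radialProfile n s = s ^ (-(n : ℝ) / 2) := by
  rw [radialProfile, Real.smoothTransition.one_of_one_le (by linarith), mul_one]

theorem contDiff_radialProfile (n : ℕ) : ContDiff ℝ ∞ (radialProfile n) := by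
  rw [contDiff_iff_contDiffAt]
  intro s
  rcases lt_or_ge s (1 / 4) with hs | hs
  · refine (contDiffAt_const (c := (0 : ℝ))).congr_of_eventuallyEq ?_
    filter_upwards [Iio_mem_nhds hs] with t ht
    exact radialProfile_of_le (le_of_lt ht)
  · refine ContDiffAt.mul (Real.contDiffAt_rpow_const_of_ne (by linarith)) ?_
    exact (Real.smoothTransition.contDiff.comp
      ((contDiff_const.mul contDiff_id).sub contDiff_const)).contDiffAt

/-- The divergence `div (x q(‖x‖²)) = n q(s) + 2 s q'(s)`, `s = ‖x‖²`, of the radial field with the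
profile `q = radialProfile n`, as a function of `s`. -/
noncomputable def radialDiv (n : ℕ) (s : ℝ) : ℝ :=
  n * radialProfile n s + 2 * s * deriv (radialProfile n) s

theorem contDiff_radialDiv (n : ℕ) : ContDiff ℝ ∞ (radialDiv n) := by
  have h : ContDiff ℝ ∞ (deriv (radialProfile n)) :=
    (contDiff_infty_iff_deriv.1 (contDiff_radialProfile n)).2
  exact (contDiff_const.mul (contDiff_radialProfile n)).add
    ((contDiff_const.mul contDiff_id).mul h)

theorem radialDiv_eq {n : ℕ} {s : ℝ} (hs : 0 < s) :
    radialDiv n s = 2 * s * s ^ (-(n : ℝ) / 2)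
      * deriv (fun t => Real.smoothTransition (4 * t - 1)) s := by
  have h1 : HasDerivAt (fun t : ℝ => t ^ (-(n : ℝ) / 2))
      (-(n : ℝ) / 2 * s ^ (-(n : ℝ) / 2 - 1)) s :=
    Real.hasDerivAt_rpow_const (Or.inl hs.ne')
  have h2 : HasDerivAt (fun t => Real.smoothTransition (4 * t - 1))
      (deriv (fun t => Real.smoothTransition (4 * t - 1)) s) s := by
    have : ContDiff ℝ ∞ (fun t : ℝ => Real.smoothTransition (4 * t - 1)) :=
      Real.smoothTransition.contDiff.comp
        ((contDiff_const.mul contDiff_id).sub contDiff_const)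
    exact (this.differentiable (by simp) s).hasDerivAt
  have h3 : deriv (radialProfile n) s = _ := (h1.mul h2).deriv
  rw [radialDiv, h3, radialProfile]
  have h4 : s ^ (-(n : ℝ) / 2) = s ^ (-(n : ℝ) / 2 - 1) * s := by
    rw [Real.rpow_sub_one hs.ne']; field_simp
  rw [h4]; ring

theorem radialDiv_nonneg (n : ℕ) {s : ℝ} (hs : 0 ≤ s) : 0 ≤ radialDiv n s := by
  rcases hs.eq_or_lt with rfl | hs
  · simp [radialDiv, radialProfile_of_le (n := n) (s := 0) (by norm_num)]
  rw [radialDiv_eq hs]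
  refine mul_nonneg (by positivity) ?_
  refine Monotone.deriv_nonneg fun a b hab => Real.smoothTransition.monotone ?_
  linarith

theorem radialDiv_of_gt {n : ℕ} {s : ℝ} (hs : 1 / 2 < s) : radialDiv n s = 0 := by
  rw [radialDiv_eq (by linarith)]
  have : (fun t : ℝ => Real.smoothTransition (4 * t - 1)) =ᶠ[𝓝 s] fun _ => (1 : ℝ) := by
    filter_upwards [Ioi_mem_nhds hs] with t ht
    exact Real.smoothTransition.one_of_one_le (by have : 1 / 2 < t := ht; linarith)
  rw [this.deriv_eq]; simp

theorem exists_radialDiv_pos (n : ℕ) : ∃ s, 0 < s ∧ 0 < radialDiv n s := by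
  have hd : Differentiable ℝ (fun t : ℝ => Real.smoothTransition (4 * t - 1)) := by
    have : ContDiff ℝ ∞ (fun t : ℝ => Real.smoothTransition (4 * t - 1)) :=
      Real.smoothTransition.contDiff.comp
        ((contDiff_const.mul contDiff_id).sub contDiff_const)
    exact this.differentiable (by simp)
  obtain ⟨c, hc, h⟩ := exists_deriv_eq_slope (fun t : ℝ => Real.smoothTransition (4 * t - 1))
    (show (1 / 4 : ℝ) < 1 / 2 by norm_num) hd.continuous.continuousOn hd.differentiableOn
  have hc0 : 0 < c := by have := hc.1; linarith
  refine ⟨c, hc0, ?_⟩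
  rw [radialDiv_eq hc0, h, Real.smoothTransition.one_of_one_le (by norm_num),
    Real.smoothTransition.zero_of_nonpos (by norm_num)]
  have := Real.rpow_pos_of_pos hc0 (-(n : ℝ) / 2)
  positivity

theorem contDiff_coord {d : ℕ} (i : Fin (d - 1)) : ContDiff ℝ ∞ (fun x : Tan d => x i) :=
  (EuclideanSpace.proj (𝕜 := ℝ) i).contDiff

/-- The `i`-th component of the radial field satisfies `∂ᵢ (xᵢ q(λ ‖x‖²)) = q + 2 λ xᵢ² q'`. -/
theorem fderiv_radialField {d : ℕ} (l : ℝ) {q : ℝ → ℝ} (hq : ContDiff ℝ ∞ q) (i : Fin (d - 1))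
    (x : Tan d) :
    fderiv ℝ (fun x : Tan d => x i * q (l * ‖x‖ ^ 2)) x (tanDir d i)
      = q (l * ‖x‖ ^ 2) + 2 * l * (x i) ^ 2 * deriv q (l * ‖x‖ ^ 2) := by
  have h1 : HasFDerivAt (fun x : Tan d => x i) (EuclideanSpace.proj (𝕜 := ℝ) i) x :=
    (EuclideanSpace.proj (𝕜 := ℝ) i).hasFDerivAt
  have h2 : HasFDerivAt (fun x : Tan d => l * ‖x‖ ^ 2) (l • (2 • innerSL ℝ x)) x :=
    (hasStrictFDerivAt_norm_sq x).hasFDerivAt.const_mul l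
  have h3 := ((hq.differentiable (by simp) (l * ‖x‖ ^ 2)).hasDerivAt).comp_hasFDerivAt x h2
  have h4 := (h1.mul h3).fderiv
  have h5 : (fun x : Tan d => x i * q (l * ‖x‖ ^ 2))
      = (fun x : Tan d => x i) * (q ∘ fun x : Tan d => l * ‖x‖ ^ 2) := rfl
  rw [h5, h4]
  simp [tanDir, EuclideanSpace.inner_single_right]
  ring

/-- There is a mollifier `η` for which the difference of two consecutive dyadic mollifiers is the
divergence of a compactly supported smooth field: `η` is a multiple of `div (x ζ(x))`, where `ζ`
equals `‖x‖^{-n}` off a ball, and then the field is `2^n x ζ(2x) - x ζ(x)`. -/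
theorem exists_mollifier {d : ℕ} (hd : 2 ≤ d) :
    ∃ (η : Tan d → ℝ) (F : Fin (d - 1) → Tan d → ℝ), IsKernel η ∧ ∫ x, η x = 1 ∧
      (∀ i, IsKernel (F i)) ∧
      ∀ x, 2 ^ (d - 1) * η ((2 : ℝ) • x) - η x = ∑ i, fderiv ℝ (F i) x (tanDir d i) := by
  set n := d - 1 with hn
  have hnorm : ContDiff ℝ ∞ (fun x : Tan d => ‖x‖ ^ 2) := contDiff_norm_sq ℝ
  set f : Tan d → ℝ := fun x => radialDiv n (‖x‖ ^ 2) with hf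
  have hfs : ContDiff ℝ ∞ f := (contDiff_radialDiv n).comp hnorm
  have hf0 : ∀ x, 1 < ‖x‖ → f x = 0 := fun x hx =>
    radialDiv_of_gt (by nlinarith)
  have hfc : HasCompactSupport f := HasCompactSupport.intro (isCompact_closedBall 0 1)
    fun x hx => hf0 x (by simpa using hx)
  -- the radial divergence is `2 s^{1 - n/2} τ'(s) ≥ 0`, so that it can be normalized
  have hpos : 0 < ∫ x, f x := by
    obtain ⟨s, hs, hs'⟩ := exists_radialDiv_pos n
    let i0 : Fin (d - 1) := ⟨0, by omega⟩
    refine hfs.continuous.integral_pos_of_hasCompactSupport_nonneg_nonzero hfc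
      (fun x => radialDiv_nonneg n (by positivity))
      (x := EuclideanSpace.single i0 (Real.sqrt s)) ?_
    simp only [hf, PiLp.norm_single, Real.norm_eq_abs, sq_abs, Real.sq_sqrt hs.le]
    exact hs'.ne'
  set c := ∫ x, f x with hc
  have hqs := contDiff_radialProfile n
  set G : Fin (d - 1) → Tan d → ℝ := fun i x =>
    x i * radialProfile n (4 * ‖x‖ ^ 2) with hG
  set G' : Fin (d - 1) → Tan d → ℝ := fun i x =>
    x i * radialProfile n (1 * ‖x‖ ^ 2) with hG'
  have hGs : ∀ i, ContDiff ℝ ∞ (G i) := fun i =>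
    (contDiff_coord i).mul (hqs.comp (contDiff_const.mul hnorm))
  have hGs' : ∀ i, ContDiff ℝ ∞ (G' i) := fun i =>
    (contDiff_coord i).mul (hqs.comp (contDiff_const.mul hnorm))
  refine ⟨fun x => c⁻¹ * f x, fun i x => c⁻¹ * (2 ^ n * G i x - G' i x), ⟨?_, ?_⟩, ?_,
    fun i => ⟨?_, ?_⟩, ?_⟩
  · exact contDiff_const.mul hfs
  · intro x hx; simp [hf0 x hx]
  · rw [integral_const_mul, inv_mul_cancel₀ hpos.ne']
  · exact contDiff_const.mul ((contDiff_const.mul (hGs i)).sub (hGs' i))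
  · intro x hx
    -- off the unit ball both terms are multiples of `x ‖x‖^{-n}`, and the factor `2^n` makes them equal
    have hx2 : 1 ≤ ‖x‖ ^ 2 := by nlinarith
    have h4 : (4 : ℝ) ^ (-(n : ℝ) / 2) = (2 ^ n)⁻¹ := by
      rw [show (4 : ℝ) = 2 ^ (2 : ℝ) by norm_num, ← Real.rpow_mul (by norm_num),
        show (2 : ℝ) * (-(n : ℝ) / 2) = -(n : ℝ) by ring, Real.rpow_neg (by norm_num),
        Real.rpow_natCast]
    simp only [hG, hG']
    rw [radialProfile_of_ge (by linarith), radialProfile_of_ge (by linarith),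
      Real.mul_rpow (by norm_num) (by positivity), h4, one_mul]
    field_simp
    ring
  · intro x
    have h1 : ∀ i, fderiv ℝ (fun x => c⁻¹ * (2 ^ n * G i x - G' i x)) x (tanDir d i)
        = c⁻¹ * (2 ^ n * fderiv ℝ (G i) x (tanDir d i) - fderiv ℝ (G' i) x (tanDir d i)) := by
      intro i
      have hA := ((hGs i).differentiable (by simp) x).hasFDerivAt
      have hB := ((hGs' i).differentiable (by simp) x).hasFDerivAt
      have := (((hA.const_mul (2 ^ n)).sub hB).const_mul c⁻¹).fderiv
      erw [this]
      simp
    simp only [h1]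
    rw [← Finset.mul_sum, Finset.sum_sub_distrib, ← Finset.mul_sum]
    have h2 : ∑ i, fderiv ℝ (G i) x (tanDir d i) = f ((2 : ℝ) • x) := by
      simp only [hG, fderiv_radialField 4 hqs, Finset.sum_add_distrib, hf, radialDiv, norm_smul]
      rw [← Finset.sum_mul, ← Finset.mul_sum, ← EuclideanSpace.real_norm_sq_eq]
      simp [hn]; ring_nf
    have h3 : ∑ i, fderiv ℝ (G' i) x (tanDir d i) = f x := by
      simp only [hG', fderiv_radialField 1 hqs, Finset.sum_add_distrib, hf, radialDiv]
      rw [← Finset.sum_mul, ← Finset.mul_sum, ← EuclideanSpace.real_norm_sq_eq]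
      simp [hn]
    rw [h2, h3]; ring

/-! ### Convolution with rescaled kernels -/

open scoped Convolution

namespace IsKernel

variable {d : ℕ} {κ : Tan d → ℝ}

theorem hasCompactSupport (h : IsKernel κ) : HasCompactSupport κ :=
  HasCompactSupport.intro (isCompact_closedBall 0 1) fun x hx => h.eq_zero x (by simpa using hx)

theorem fderiv_apply (h : IsKernel κ) (a : Tan d) : IsKernel fun z => fderiv ℝ κ z a where
  contDiff := (h.contDiff.fderiv_right (m := ∞) (by simp)).clm_apply contDiff_const
  eq_zero x hx := by
    have : κ =ᶠ[𝓝 x] fun _ => (0 : ℝ) := by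
      filter_upwards [(isOpen_lt continuous_const continuous_norm).mem_nhds hx] with y hy
      exact h.eq_zero y hy
    rw [this.fderiv_eq]; simp

theorem lintegral_lt_top (h : IsKernel κ) : ∫⁻ x, ‖κ x‖ₑ < ⊤ :=
  (h.contDiff.continuous.integrable_of_hasCompactSupport h.hasCompactSupport).2

theorem integrable (h : IsKernel κ) : Integrable κ :=
  h.contDiff.continuous.integrable_of_hasCompactSupport h.hasCompactSupport

end IsKernel

/-- The rescaled kernel `κ_r(x) = r^{-n} κ(x / r)`, `n = d - 1`. -/
noncomputable def scaleKer {d : ℕ} (r : ℝ) (κ : Tan d → ℝ) : Tan d → ℝ :=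
  fun x => (r ^ (d - 1))⁻¹ * κ (r⁻¹ • x)

/-- The convolution `κ_r ⋆ f` with the rescaled kernel. -/
noncomputable def mollify {d : ℕ} (r : ℝ) (κ f : Tan d → ℝ) : Tan d → ℝ :=
  scaleKer r κ ⋆[ContinuousLinearMap.lsmul ℝ ℝ, volume] f

section mollify

variable {d : ℕ} {κ f : Tan d → ℝ} {r : ℝ}

theorem IsKernel.contDiff_scaleKer (h : IsKernel κ) (r : ℝ) : ContDiff ℝ ∞ (scaleKer r κ) :=
  contDiff_const.mul (h.contDiff.comp (contDiff_const_smul _))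

theorem IsKernel.scaleKer_eq_zero (h : IsKernel κ) (hr : 0 < r) {x : Tan d} (hx : r < ‖x‖) :
    scaleKer r κ x = 0 := by
  rw [scaleKer, h.eq_zero, mul_zero]
  rw [norm_smul, norm_inv, Real.norm_eq_abs, abs_of_pos hr]
  rwa [← div_eq_inv_mul, one_lt_div hr]

theorem IsKernel.hasCompactSupport_scaleKer (h : IsKernel κ) (hr : 0 < r) :
    HasCompactSupport (scaleKer r κ) :=
  HasCompactSupport.intro (isCompact_closedBall 0 r) fun x hx =>
    h.scaleKer_eq_zero hr (by simpa using hx)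

theorem IsKernel.fderiv_scaleKer (h : IsKernel κ) (r : ℝ) (x a : Tan d) :
    fderiv ℝ (scaleKer r κ) x a = r⁻¹ * scaleKer r (fun z => fderiv ℝ κ z a) x := by
  have h1 : HasFDerivAt (fun x : Tan d => r⁻¹ • x) (r⁻¹ • ContinuousLinearMap.id ℝ (Tan d)) x :=
    (hasFDerivAt_id x).const_smul r⁻¹
  have h2 := (h.contDiff.differentiable (by simp) (r⁻¹ • x)).hasFDerivAt
  have h3 := ((h2.comp x h1).const_mul (r ^ (d - 1))⁻¹).fderiv
  have h4 : scaleKer r κ = fun y => (r ^ (d - 1))⁻¹ * (κ ∘ fun x => r⁻¹ • x) y := rfl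
  rw [h4, h3]
  simp [scaleKer]; ring

theorem mollify_def (r : ℝ) (κ f : Tan d → ℝ) (x : Tan d) :
    mollify r κ f x = ∫ y, scaleKer r κ (x - y) * f y := by
  rw [mollify, convolution_lsmul_swap]; rfl

/-- In this form the rescaling acts on the shift of `f` only. -/
theorem mollify_eq_integral (hr : 0 < r) (κ f : Tan d → ℝ) (x : Tan d) :
    mollify r κ f x = ∫ z, κ z * f (x - r • z) := by
  have h := Measure.integral_comp_inv_smul (volume : Measure (Tan d))
    (fun z => κ z * f (x - r • z)) r
  rw [finrank_euclideanSpace_fin, abs_of_pos (by positivity)] at h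
  have h' : ∫ z, κ z * f (x - r • z)
      = (r ^ (d - 1))⁻¹ * ∫ y, κ (r⁻¹ • y) * f (x - r • r⁻¹ • y) := by
    rw [h, smul_eq_mul, inv_mul_cancel_left₀ (by positivity)]
  rw [h', ← integral_const_mul, mollify, convolution_lsmul]
  refine integral_congr_ae (Eventually.of_forall fun y => ?_)
  simp only [scaleKer, smul_inv_smul₀ hr.ne', smul_eq_mul]
  ring

theorem mollify_congr_ae {f' : Tan d → ℝ} (h : f =ᵐ[volume] f') (r : ℝ) (κ : Tan d → ℝ) :
    mollify r κ f = mollify r κ f' :=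
  convolution_congr _ (by rfl) h

theorem IsKernel.contDiff_mollify (h : IsKernel κ) (hr : 0 < r)
    (hf : LocallyIntegrable f) : ContDiff ℝ ∞ (mollify r κ f) :=
  (h.hasCompactSupport_scaleKer hr).contDiff_convolution_left _ (h.contDiff_scaleKer r) hf

theorem IsKernel.convolutionExists (h : IsKernel κ) (hr : 0 < r) (hf : LocallyIntegrable f) :
    ConvolutionExists (scaleKer r κ) f (ContinuousLinearMap.lsmul ℝ ℝ) volume :=
  (h.hasCompactSupport_scaleKer hr).convolutionExists_left _ (h.contDiff_scaleKer r).continuous hf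

theorem IsKernel.fderiv_mollify (h : IsKernel κ) (hr : 0 < r) (hf : LocallyIntegrable f)
    (x a : Tan d) :
    fderiv ℝ (mollify r κ f) x a = r⁻¹ * mollify r (fun z => fderiv ℝ κ z a) f x := by
  have hc := h.hasCompactSupport_scaleKer hr
  have hs := h.contDiff_scaleKer r
  have h1 := hc.hasFDerivAt_convolution_left (ContinuousLinearMap.lsmul ℝ ℝ)
    (hs.of_le (by simp)) hf x
  have h0 : fderiv ℝ (mollify r κ f) x = _ := h1.fderiv
  rw [h0, convolution_def, ContinuousLinearMap.integral_apply, mollify, convolution_lsmul,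
    ← integral_const_mul]
  · refine integral_congr_ae (Eventually.of_forall fun y => ?_)
    simp only [ContinuousLinearMap.precompL_apply, ContinuousLinearMap.lsmul_apply,
      smul_eq_mul, h.fderiv_scaleKer]
    ring
  · have hcf : HasCompactSupport (fderiv ℝ (scaleKer r κ)) := hc.fderiv ℝ
    exact hcf.convolutionExists_left _ (hs.continuous_fderiv (by simp)) hf x

theorem IsKernel.mollify_add (h : IsKernel κ) (hr : 0 < r) {g : Tan d → ℝ}
    (hf : LocallyIntegrable f) (hg : LocallyIntegrable g) :
    mollify r κ (f + g) = mollify r κ f + mollify r κ g :=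
  ConvolutionExists.distrib_add (h.convolutionExists hr hf) (h.convolutionExists hr hg)

theorem mollify_sum {ι : Type*} [Fintype ι] {K : ι → Tan d → ℝ} (hK : ∀ i, IsKernel (K i))
    (hr : 0 < r) (hf : LocallyIntegrable f) (x : Tan d) :
    mollify r (fun z => ∑ i, K i z) f x = ∑ i, mollify r (K i) f x := by
  simp only [mollify, convolution_lsmul]
  rw [← integral_finsetSum]
  · simp only [scaleKer, Finset.mul_sum, Finset.sum_smul]
  · intro i _
    exact (hK i).convolutionExists hr hf x

/-- Two consecutive dyadic mollifications differ by a convolution at the coarser scale. -/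
theorem IsKernel.mollify_half_sub (h : IsKernel κ) (hr : 0 < r) (hf : LocallyIntegrable f)
    (x : Tan d) :
    mollify (r / 2) κ f x - mollify r κ f x
      = mollify r (fun z => 2 ^ (d - 1) * κ ((2 : ℝ) • z) - κ z) f x := by
  have e1 := h.convolutionExists (half_pos hr) hf x
  have e2 := h.convolutionExists hr hf x
  simp only [mollify, convolution_lsmul]
  refine (integral_sub e1 e2).symm.trans ?_
  refine integral_congr_ae (Eventually.of_forall fun y => ?_)
  simp only [ContinuousLinearMap.lsmul_apply, scaleKer, smul_smul, smul_eq_mul, div_pow, inv_div]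
  rw [show (2 : ℝ) * r⁻¹ = 2 / r by ring]
  ring

/-- Hölder's inequality with the weight `k`. -/
theorem lintegral_mul_rpow_le {α : Type*} [MeasurableSpace α] {μ : Measure α} {p : ℝ} (hp : 1 < p)
    {k u : α → ℝ≥0∞} (hk : AEMeasurable k μ) (hu : AEMeasurable u μ) :
    (∫⁻ z, k z * u z ∂μ) ^ p ≤ (∫⁻ z, k z ∂μ) ^ (p - 1) * ∫⁻ z, k z * u z ^ p ∂μ := by
  have hp0 : 0 < p := by linarith
  have hpq := Real.HolderConjugate.conjExponent hp
  set q := p.conjExponent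
  have hq0 : 0 < q := hpq.symm.pos
  have h := ENNReal.lintegral_mul_le_Lp_mul_Lq μ hpq (f := fun z => k z ^ (1 / p) * u z)
    (g := fun z => k z ^ (1 / q)) ((hk.pow_const _).mul hu) (hk.pow_const _)
  have e1 : ∀ z, k z ^ (1 / p) * u z * k z ^ (1 / q) = k z * u z := fun z => by
    rw [mul_right_comm, ← ENNReal.rpow_add_of_nonneg _ _ (by positivity) (by positivity)]
    have : 1 / p + 1 / q = 1 := by simpa using hpq.inv_add_inv_eq_one
    rw [this, ENNReal.rpow_one]
  simp only [Pi.mul_apply, e1] at h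
  have e2 : ∀ z, (k z ^ (1 / p) * u z) ^ p = k z * u z ^ p := fun z => by
    rw [ENNReal.mul_rpow_of_nonneg _ _ hp0.le, ← ENNReal.rpow_mul, one_div_mul_cancel hp0.ne',
      ENNReal.rpow_one]
  have e3 : ∀ z, (k z ^ (1 / q)) ^ q = k z := fun z => by
    rw [← ENNReal.rpow_mul, one_div_mul_cancel hq0.ne', ENNReal.rpow_one]
  simp only [e2, e3] at h
  refine (ENNReal.rpow_le_rpow h hp0.le).trans (le_of_eq ?_)
  rw [ENNReal.mul_rpow_of_nonneg _ _ hp0.le, ← ENNReal.rpow_mul, ← ENNReal.rpow_mul,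
    one_div_mul_cancel hp0.ne', ENNReal.rpow_one, mul_comm]
  congr 2
  have := hpq.sub_one_mul_conj
  field_simp
  linarith

/-- Young's inequality `‖κ_r ⋆ f‖_p ≤ ‖κ‖_1 ‖f‖_p`. -/
theorem IsKernel.eLpNorm_mollify_le (h : IsKernel κ) (hr : 0 < r) {p : ℝ} (hp : 1 < p)
    (hf : AEStronglyMeasurable f) :
    eLpNorm (mollify r κ f) (ENNReal.ofReal p) volume
      ≤ (∫⁻ z, ‖κ z‖ₑ) * eLpNorm f (ENNReal.ofReal p) volume := by
  wlog hfm : StronglyMeasurable f generalizing f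
  · rw [mollify_congr_ae hf.ae_eq_mk, eLpNorm_congr_ae hf.ae_eq_mk]
    exact this hf.stronglyMeasurable_mk.aestronglyMeasurable hf.stronglyMeasurable_mk
  have hp0 : 0 < p := by linarith
  have hκ : Measurable fun z => ‖κ z‖ₑ := h.contDiff.continuous.measurable.enorm
  have hpt : ENNReal.ofReal p ≠ ⊤ := ENNReal.ofReal_ne_top
  have hpz : ENNReal.ofReal p ≠ 0 := by simpa using hp0
  rw [eLpNorm_eq_lintegral_rpow_enorm_toReal hpz hpt, eLpNorm_eq_lintegral_rpow_enorm_toReal hpz hpt,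
    ENNReal.toReal_ofReal hp0.le]
  set A := ∫⁻ z, ‖κ z‖ₑ with hA
  have hpt : ∀ x, ‖mollify r κ f x‖ₑ ^ p ≤ A ^ (p - 1) * ∫⁻ z, ‖κ z‖ₑ * ‖f (x - r • z)‖ₑ ^ p := by
    intro x
    have hm : Measurable fun z => ‖f (x - r • z)‖ₑ :=
      (hfm.measurable.comp (measurable_const.sub (measurable_const_smul r))).enorm
    refine le_trans (ENNReal.rpow_le_rpow ?_ hp0.le)
      (lintegral_mul_rpow_le hp hκ.aemeasurable hm.aemeasurable)
    rw [mollify_eq_integral hr]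
    refine (enorm_integral_le_lintegral_enorm _).trans (le_of_eq ?_)
    simp only [enorm_mul]
  have hswap : ∫⁻ x, ‖mollify r κ f x‖ₑ ^ p ≤ A ^ p * ∫⁻ x, ‖f x‖ₑ ^ p := by
    calc ∫⁻ x, ‖mollify r κ f x‖ₑ ^ p
        ≤ ∫⁻ x, A ^ (p - 1) * ∫⁻ z, ‖κ z‖ₑ * ‖f (x - r • z)‖ₑ ^ p := lintegral_mono hpt
      _ = A ^ (p - 1) * ∫⁻ x, ∫⁻ z, ‖κ z‖ₑ * ‖f (x - r • z)‖ₑ ^ p :=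
          lintegral_const_mul' _ _ (ENNReal.rpow_ne_top_of_nonneg (by linarith)
            h.lintegral_lt_top.ne)
      _ = A ^ (p - 1) * ∫⁻ z, ∫⁻ x, ‖κ z‖ₑ * ‖f (x - r • z)‖ₑ ^ p := by
          rw [lintegral_lintegral_swap]
          refine Measurable.aemeasurable ?_
          refine (hκ.comp measurable_snd).mul (Measurable.pow_const ?_ _)
          exact (hfm.measurable.comp (measurable_fst.sub (measurable_snd.const_smul r))).enorm
      _ = A ^ (p - 1) * ∫⁻ z, ‖κ z‖ₑ * ∫⁻ x, ‖f x‖ₑ ^ p := by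
          congr 1
          refine lintegral_congr fun z => ?_
          rw [lintegral_const_mul' _ _ enorm_ne_top,
            lintegral_sub_right_eq_self (fun x => ‖f x‖ₑ ^ p) (r • z)]
      _ = A ^ (p - 1) * (A * ∫⁻ x, ‖f x‖ₑ ^ p) := by
          rw [lintegral_mul_const _ hκ]
      _ = A ^ p * ∫⁻ x, ‖f x‖ₑ ^ p := by
          rw [← mul_assoc]
          congr 1
          nth_rewrite 2 [← ENNReal.rpow_one A]
          rw [← ENNReal.rpow_add_of_nonneg _ _ (by linarith) zero_le_one, sub_add_cancel]
  refine (ENNReal.rpow_le_rpow hswap (by positivity)).trans (le_of_eq ?_)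
  rw [ENNReal.mul_rpow_of_nonneg _ _ (by positivity), ← ENNReal.rpow_mul,
    mul_one_div_cancel hp0.ne', ENNReal.rpow_one]

/-- A derivative on the kernel moves onto a weakly differentiable function. -/
theorem IsKernel.mollify_fderiv_eq (h : IsKernel κ) (hr : 0 < r) {U : Set (Tan d)}
    (hU : MeasurableSet U) {a : Tan d} {u w : Tan d → ℝ} (hw : HasWeakDeriv U a u w) {x : Tan d}
    (hx : Metric.closedBall x r ⊆ U) :
    mollify r (fun z => fderiv ℝ κ z a) (U.indicator u) x = r * mollify r κ (U.indicator w) x := by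
  have hs := h.contDiff_scaleKer r
  set φ : Tan d → ℝ := fun y => scaleKer r κ (x - y) with hφ
  have hφs : ContDiff ℝ ∞ φ := hs.comp (contDiff_const.sub contDiff_id)
  have hsupp : Function.support φ ⊆ Metric.closedBall x r := by
    intro y hy
    by_contra hc
    refine hy (h.scaleKer_eq_zero hr ?_)
    simpa [dist_eq_norm, norm_sub_rev] using hc
  have hts : tsupport φ ⊆ Metric.closedBall x r :=
    closure_minimal hsupp Metric.isClosed_closedBall
  have hφc : HasCompactSupport φ :=
    (isCompact_closedBall x r).of_isClosed_subset (isClosed_tsupport _) hts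
  have h1 := hw.2.2 φ hφs hφc (hts.trans hx)
  have h2 : ∀ y, fderiv ℝ φ y a = -(r⁻¹ * scaleKer r (fun z => fderiv ℝ κ z a) (x - y)) := by
    intro y
    have e1 : HasFDerivAt (fun y : Tan d => x - y) (-ContinuousLinearMap.id ℝ (Tan d)) y :=
      (hasFDerivAt_id y).const_sub x
    have e2 := (((hs.differentiable (by simp)) (x - y)).hasFDerivAt.comp y e1).fderiv
    have e3 : φ = scaleKer r κ ∘ fun y => x - y := rfl
    rw [e3, e2]
    simp [h.fderiv_scaleKer]
  have e : ∀ (k v : Tan d → ℝ), mollify r k (U.indicator v) x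
      = ∫ y in U, scaleKer r k (x - y) * v y := by
    intro k v
    rw [mollify_def, ← integral_indicator hU]
    congr 1; ext y; by_cases hy : y ∈ U <;> simp [hy]
  rw [e, e]
  simp only [h2] at h1
  have h3 : ∫ y in U, u y * -(r⁻¹ * scaleKer r (fun z => fderiv ℝ κ z a) (x - y))
      = -r⁻¹ * ∫ y in U, scaleKer r (fun z => fderiv ℝ κ z a) (x - y) * u y := by
    rw [← integral_const_mul]; congr 1; ext y; ring
  have h4 : ∫ y in U, w y * φ y = ∫ y in U, scaleKer r κ (x - y) * w y := by
    congr 1; ext y; rw [mul_comm]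
  rw [h3, h4] at h1
  field_simp at h1
  linarith

theorem IsKernel.abs_mollify_sub_le_of_forall (h : IsKernel κ) (hr : 0 < r) (hf : Continuous f)
    {x : Tan d} {c : ℝ} (hc : ∀ z, ‖z‖ ≤ r → |f (x - z) - f x| ≤ c) :
    |mollify r κ f x - (∫ z, κ z) * f x| ≤ (∫ z, |κ z|) * c := by
  have hcont : Continuous fun z => κ z * f (x - r • z) :=
    h.contDiff.continuous.mul (hf.comp (by fun_prop))
  have hint : Integrable fun z => κ z * f (x - r • z) :=
    hcont.integrable_of_hasCompactSupport h.hasCompactSupport.mul_right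
  rw [mollify_eq_integral hr, ← integral_mul_const, ← integral_sub hint (h.integrable.mul_const _),
    ← integral_mul_const]
  refine (norm_integral_le_integral_norm _).trans (integral_mono_of_nonneg
    (Eventually.of_forall fun z => norm_nonneg (κ z * f (x - r • z) - κ z * f x))
    (h.integrable.abs.mul_const _) (Eventually.of_forall fun z => ?_))
  simp only [Real.norm_eq_abs, ← mul_sub, abs_mul]
  rcases le_or_gt ‖z‖ 1 with hz | hz
  · refine mul_le_mul_of_nonneg_left (hc _ ?_) (abs_nonneg _)
    rw [norm_smul, Real.norm_eq_abs, abs_of_pos hr]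
    nlinarith
  · simp [h.eq_zero z hz]

/-- Convolution with a kernel of integral `c` moves a Lipschitz function, at scale `r`, by `O(r)`
away from its multiple by `c`. -/
theorem IsKernel.abs_mollify_sub_le (h : IsKernel κ) (hr : 0 < r) {L : ℝ≥0}
    (hf : LipschitzWith L f) (x : Tan d) :
    |mollify r κ f x - (∫ z, κ z) * f x| ≤ (∫ z, |κ z|) * (L * r) := by
  refine h.abs_mollify_sub_le_of_forall hr hf.continuous fun z hz => ?_
  have := hf.dist_le_mul (x - z) x
  rw [Real.dist_eq, dist_eq_norm, sub_sub_cancel_left, norm_neg] at this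
  exact this.trans (mul_le_mul_of_nonneg_left hz L.2)

theorem IsKernel.integral_fderiv_eq_zero (h : IsKernel κ) (a : Tan d) :
    ∫ z, fderiv ℝ κ z a = 0 := by
  have := integral_mul_fderiv_eq_neg_fderiv_mul_of_integrable (μ := (volume : Measure (Tan d)))
    (f := fun _ => (1 : ℝ)) (g := κ) (v := a)
    (by simp) (by simpa using (h.fderiv_apply a).integrable) (by simpa using h.integrable)
    (fun x _ => differentiableAt_const _) (fun x _ => h.contDiff.differentiable (by simp) x)
  simpa using this

end mollify

/-! ### Mollification, `L_p`-convergence and Peetre's functional -/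

section peetre

variable {d : ℕ} {κ f : Tan d → ℝ} {r : ℝ}

theorem locallyIntegrable_indicator {U : Set (Tan d)} (hU : MeasurableSet U) {p : ℝ} (hp : 1 < p)
    (hf : MemLp f (ENNReal.ofReal p) (volume.restrict U)) :
    LocallyIntegrable (U.indicator f) :=
  ((memLp_indicator_iff_restrict hU).2 hf).locallyIntegrable (by
    rw [← ENNReal.ofReal_one]; exact ENNReal.ofReal_le_ofReal hp.le)

/-- Mollification converges in `L_p`. -/
theorem IsKernel.tendsto_eLpNorm_mollify_sub (h : IsKernel κ) (h1 : ∫ z, κ z = 1) {p : ℝ}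
    (hp : 1 < p) (hf : MemLp f (ENNReal.ofReal p)) {ρ : ℕ → ℝ} (hρ : ∀ m, 0 < ρ m)
    (hρ0 : Tendsto ρ atTop (𝓝 0)) (R : ℝ) :
    Tendsto (fun m => eLpNorm (mollify (ρ m) κ f - f) (ENNReal.ofReal p)
      (volume.restrict (Metric.ball 0 R))) atTop (𝓝 0) := by
  have hp1 : 1 ≤ ENNReal.ofReal p := by
    rw [← ENNReal.ofReal_one]; exact ENNReal.ofReal_le_ofReal hp.le
  set P := ENNReal.ofReal p with hP
  set A := ∫⁻ z, ‖κ z‖ₑ with hA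
  have hAt : A ≠ ⊤ := h.lintegral_lt_top.ne
  set μ := (volume : Measure (Tan d)).restrict (Metric.ball 0 R) with hμ
  rw [ENNReal.tendsto_atTop_zero]
  intro ε hε
  have hε2 : ε / 2 ≠ 0 := by simpa using hε.ne'
  -- approximate by a continuous function `φ` of compact support, which is uniformly continuous
  obtain ⟨φ, hφc, hφ, hφcont, hφp⟩ := hf.exists_hasCompactSupport_eLpNorm_sub_le
    ENNReal.ofReal_ne_top (ε := ε / 2 / (A + 1))
    (ENNReal.div_ne_zero.2 ⟨hε2, by finiteness⟩)
  set V := μ univ ^ (P.toReal)⁻¹ with hV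
  have hVt : V ≠ ⊤ := by
    refine ENNReal.rpow_ne_top_of_nonneg (by positivity) ?_
    rw [hμ, Measure.restrict_apply_univ]
    exact measure_ball_lt_top.ne
  have hlim : Tendsto (fun c : ℝ => V * ENNReal.ofReal ((∫ z, |κ z|) * c)) (𝓝[>] 0) (𝓝 0) := by
    have e1 : Tendsto (fun c : ℝ => (∫ z, |κ z|) * c) (𝓝[>] 0) (𝓝 ((∫ z, |κ z|) * 0)) :=
      ((continuous_const.mul continuous_id).tendsto 0).mono_left nhdsWithin_le_nhds
    have e2 := ENNReal.Tendsto.const_mul (a := V) (ENNReal.tendsto_ofReal e1) (Or.inr hVt)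
    simpa using e2
  obtain ⟨c, hcε, hc0⟩ := ((hlim.eventually (gt_mem_nhds (pos_iff_ne_zero.2 hε2))).and
    self_mem_nhdsWithin).exists
  have hc0 : 0 < c := hc0
  obtain ⟨s, hs, hsφ⟩ := Metric.uniformContinuous_iff.1
    (hφc.uniformContinuous_of_continuous hφcont) c hc0
  obtain ⟨N, hN⟩ := eventually_atTop.1 (hρ0.eventually (gt_mem_nhds hs))
  refine ⟨N, fun m hm => ?_⟩
  have hφl := hφp.locallyIntegrable hp1
  have hfφ := hf.sub hφp
  have hdec : mollify (ρ m) κ f - f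
      = (mollify (ρ m) κ (f - φ) - (f - φ)) + (mollify (ρ m) κ φ - φ) := by
    have := h.mollify_add (hρ m) (hfφ.locallyIntegrable hp1) hφl
    rw [sub_add_cancel] at this
    rw [this]; abel
  have hm1 : AEStronglyMeasurable (mollify (ρ m) κ (f - φ)) volume :=
    (h.contDiff_mollify (hρ m) (hfφ.locallyIntegrable hp1)).continuous.aestronglyMeasurable
  have hm2 : AEStronglyMeasurable (mollify (ρ m) κ φ) volume :=
    (h.contDiff_mollify (hρ m) hφl).continuous.aestronglyMeasurable
  rw [hdec]
  refine (eLpNorm_add_le (hm1.sub hfφ.1).restrict (hm2.sub hφp.1).restrict hp1).trans ?_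
  rw [← ENNReal.add_halves ε]
  refine add_le_add ?_ ?_
  · refine (eLpNorm_mono_measure _ Measure.restrict_le_self).trans ?_
    refine (eLpNorm_sub_le hm1 hfφ.1 hp1).trans ?_
    calc _ ≤ A * eLpNorm (f - φ) P volume + eLpNorm (f - φ) P volume := by
          gcongr; exact h.eLpNorm_mollify_le (hρ m) hp hfφ.1
      _ = (A + 1) * eLpNorm (f - φ) P volume := by ring
      _ ≤ (A + 1) * (ε / 2 / (A + 1)) := by gcongr
      _ ≤ ε / 2 := ENNReal.mul_div_le
  · refine le_trans ?_ hcε.le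
    refine eLpNorm_le_of_ae_bound (Eventually.of_forall fun x => ?_)
    have := h.abs_mollify_sub_le_of_forall (hρ m) hφcont (x := x) (c := c) fun z hz => ?_
    · rwa [h1, one_mul] at this
    · have := hsφ (a := x - z) (b := x) ?_
      · rw [Real.dist_eq] at this; exact this.le
      rw [dist_eq_norm, sub_sub_cancel_left, norm_neg]
      exact hz.trans_lt (hN m hm)

theorem le_peetreK {E : Type*} [NormedAddCommGroup E] [NormedSpace ℝ E] [MeasureSpace E]
    {ι : Type*} [Fintype ι] {U : Set E} {μ : Measure E} {e : ι → E} {p t : ℝ} (ht : 0 < t)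
    {u : E → ℝ} {c : ℝ≥0∞}
    (h : ∀ (u₁ : E → ℝ) (D : ι → E → ℝ), (∀ i, HasWeakDeriv U (e i) u₁ (D i)) →
      c ≤ eLpNorm (u - u₁) (ENNReal.ofReal p) μ + ENNReal.ofReal t *
        (eLpNorm u₁ (ENNReal.ofReal p) μ + ∑ i, eLpNorm (D i) (ENNReal.ofReal p) μ)) :
    c ≤ peetreK U μ e p t u := by
  have ht0 : ENNReal.ofReal t ≠ 0 := by simpa using ht
  refine le_iInf fun u₁ => ?_
  rw [sobolevNorm1, ENNReal.mul_iInf_of_ne ht0 ENNReal.ofReal_ne_top, ENNReal.add_iInf]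
  refine le_iInf fun D => ?_
  rw [ENNReal.mul_iInf_of_ne ht0 ENNReal.ofReal_ne_top, ENNReal.add_iInf]
  exact le_iInf fun hD => h u₁ D hD

theorem peetreK_mono {E : Type*} [NormedAddCommGroup E] [NormedSpace ℝ E] [MeasureSpace E]
    {ι : Type*} [Fintype ι] {U : Set E} {μ : Measure E} {e : ι → E} {p s t : ℝ} (hst : s ≤ t)
    {u : E → ℝ} : peetreK U μ e p s u ≤ peetreK U μ e p t u := by
  unfold peetreK
  gcongr

/-- Convolution at the scale `r` with a kernel that is a divergence `∑ᵢ ∂ᵢ Fᵢ` is controlled by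
Peetre's functional: `f₀` is treated by Young's inequality, and in `f₁` a derivative moves from the
kernel onto the function, which gains a factor `r`. -/
theorem IsKernel.eLpNorm_mollify_le_peetreK (hd : 2 ≤ d) (h : IsKernel κ)
    {F : Fin (d - 1) → Tan d → ℝ} (hF : ∀ i, IsKernel (F i))
    (hκ : ∀ x, κ x = ∑ i, fderiv ℝ (F i) x (tanDir d i)) {p : ℝ} (hp : 1 < p) {R : ℝ} (hr : 0 < r)
    (hrR : r ≤ R) {μ : Measure (Tan d)} (hμ : volume.restrict (Metric.ball 0 (3 * R)) ≤ μ)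
    (hf : MemLp f (ENNReal.ofReal p) (volume.restrict (Metric.ball 0 (3 * R)))) :
    eLpNorm (mollify r κ ((Metric.ball 0 (3 * R)).indicator f)) (ENNReal.ofReal p)
        (volume.restrict (Metric.ball 0 R))
      ≤ (1 + (∫⁻ z, ‖κ z‖ₑ) + ∑ i, ∫⁻ z, ‖F i z‖ₑ)
        * peetreK (Metric.ball 0 (3 * R)) μ (tanDir d) p r f := by
  have hp1 : 1 ≤ ENNReal.ofReal p := by
    rw [← ENNReal.ofReal_one]; exact ENNReal.ofReal_le_ofReal hp.le
  set P := ENNReal.ofReal p with hP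
  set U := Metric.ball (0 : Tan d) (3 * R) with hU
  have hUm : MeasurableSet U := measurableSet_ball
  set C := 1 + (∫⁻ z, ‖κ z‖ₑ) + ∑ i, ∫⁻ z, ‖F i z‖ₑ with hC
  have hC0 : C ≠ 0 := by
    refine (lt_of_lt_of_le zero_lt_one ?_).ne'
    rw [hC, add_assoc]; exact le_self_add
  have hCt : C ≠ ⊤ := by
    have h1 := h.lintegral_lt_top.ne
    have h2 : ∑ i, ∫⁻ z, ‖F i z‖ₑ ≠ ⊤ :=
      ENNReal.sum_ne_top.2 fun i _ => (hF i).lintegral_lt_top.ne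
    finiteness
  have hCκ : (∫⁻ z, ‖κ z‖ₑ) ≤ C := by
    rw [hC, add_assoc, add_left_comm]; exact le_self_add
  have hCF : ∀ i, (∫⁻ z, ‖F i z‖ₑ) ≤ C := fun i =>
    (Finset.single_le_sum (f := fun i => ∫⁻ z, ‖F i z‖ₑ) (fun _ _ => zero_le)
      (Finset.mem_univ i)).trans le_add_self
  rw [mul_comm, ← ENNReal.div_le_iff hC0 hCt]
  refine le_peetreK hr fun u D hD => ?_
  rw [ENNReal.div_le_iff hC0 hCt]
  -- an infinite norm aside, `u` is in `L_p(U)`, and its extension by zero is locally integrable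
  by_cases hfu : eLpNorm (f - u) P μ = ⊤
  · rw [hfu, top_add, ENNReal.top_mul hC0]; exact le_top
  have hum : AEStronglyMeasurable u (volume.restrict U) :=
    (hD ⟨0, by omega⟩).1.aestronglyMeasurable
  have hsub : MemLp (f - u) P (volume.restrict U) :=
    ⟨hf.1.sub hum, lt_of_le_of_lt (eLpNorm_mono_measure _ hμ) (lt_top_iff_ne_top.2 hfu)⟩
  have hu : MemLp u P (volume.restrict U) := by
    have := hf.sub hsub
    rwa [sub_sub_cancel] at this
  have hil := locallyIntegrable_indicator hUm hp hsub
  have hul := locallyIntegrable_indicator hUm hp hu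
  have hdec : mollify r κ (U.indicator f)
      = mollify r κ (U.indicator (f - u)) + mollify r κ (U.indicator u) := by
    rw [← h.mollify_add hr hil hul, ← indicator_add', sub_add_cancel]
  have hind : ∀ v : Tan d → ℝ, eLpNorm (U.indicator v) P volume = eLpNorm v P (volume.restrict U) :=
    fun v => eLpNorm_indicator_eq_eLpNorm_restrict hUm
  have hm1 := (h.contDiff_mollify hr hil).continuous.aestronglyMeasurable
    (μ := volume.restrict (Metric.ball 0 R))
  have hm2 := (h.contDiff_mollify hr hul).continuous.aestronglyMeasurable
    (μ := volume.restrict (Metric.ball 0 R))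
  have hDm : ∀ i, AEStronglyMeasurable (D i) (volume.restrict U) := fun i =>
    (hD i).2.1.aestronglyMeasurable
  rw [hdec]
  refine (eLpNorm_add_le hm1 hm2 hp1).trans ?_
  have hA : eLpNorm (mollify r κ (U.indicator (f - u))) P (volume.restrict (Metric.ball 0 R))
      ≤ C * eLpNorm (f - u) P μ := by
    refine (eLpNorm_mono_measure _ Measure.restrict_le_self).trans ?_
    refine (h.eLpNorm_mollify_le hr hp
      ((aestronglyMeasurable_indicator_iff hUm).2 hsub.1)).trans ?_
    rw [hind]
    gcongr
  have hB : eLpNorm (mollify r κ (U.indicator u)) P (volume.restrict (Metric.ball 0 R))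
      ≤ ENNReal.ofReal r * ∑ i, C * eLpNorm (D i) P μ := by
    -- for `‖x‖ < R`, the kernel centered at `x` is supported in `U`, as `r ≤ R`
    have hcongr : mollify r κ (U.indicator u) =ᵐ[volume.restrict (Metric.ball 0 R)]
        r • ∑ i, mollify r (F i) (U.indicator (D i)) := by
      filter_upwards [ae_restrict_mem measurableSet_ball] with x hx
      have hxr : Metric.closedBall x r ⊆ U := by
        refine Metric.closedBall_subset_ball' ?_
        have := Metric.mem_ball.1 hx
        linarith
      have hκ' : κ = fun z => ∑ i, fderiv ℝ (F i) z (tanDir d i) := funext hκ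
      rw [hκ', mollify_sum (fun i => (hF i).fderiv_apply _) hr hul]
      simp only [Pi.smul_apply, Finset.sum_apply, smul_eq_mul, Finset.mul_sum]
      exact Finset.sum_congr rfl fun i _ => (hF i).mollify_fderiv_eq hr hUm (hD i) hxr
    rw [eLpNorm_congr_ae hcongr, eLpNorm_const_smul]
    have hre : ‖r‖ₑ = ENNReal.ofReal r := by
      rw [Real.enorm_eq_ofReal hr.le]
    rw [hre]
    by_cases hDt : ∃ i, eLpNorm (D i) P μ = ⊤
    · obtain ⟨i, hi⟩ := hDt
      have : ∑ i, C * eLpNorm (D i) P μ = ⊤ :=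
        ENNReal.sum_eq_top.2 ⟨i, Finset.mem_univ i, by rw [hi, ENNReal.mul_top hC0]⟩
      rw [this, ENNReal.mul_top (by simpa using hr)]
      exact le_top
    push Not at hDt
    have hDp : ∀ i, MemLp (D i) P (volume.restrict U) := fun i =>
      ⟨hDm i, lt_of_le_of_lt (eLpNorm_mono_measure _ hμ) (lt_top_iff_ne_top.2 (hDt i))⟩
    gcongr
    refine (eLpNorm_sum_le (fun i _ => ((hF i).contDiff_mollify hr
      (locallyIntegrable_indicator hUm hp (hDp i))).continuous.aestronglyMeasurable) hp1).trans ?_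
    refine Finset.sum_le_sum fun i _ => ?_
    refine (eLpNorm_mono_measure _ Measure.restrict_le_self).trans ?_
    refine ((hF i).eLpNorm_mollify_le hr hp
      ((aestronglyMeasurable_indicator_iff hUm).2 (hDm i))).trans ?_
    rw [hind]
    exact mul_le_mul' (hCF i) (eLpNorm_mono_measure _ hμ)
  calc _ ≤ C * eLpNorm (f - u) P μ + ENNReal.ofReal r * ∑ i, C * eLpNorm (D i) P μ :=
        add_le_add hA hB
    _ = (eLpNorm (f - u) P μ + ENNReal.ofReal r * (0 + ∑ i, eLpNorm (D i) P μ)) * C := by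
        rw [← Finset.mul_sum]; ring
    _ ≤ _ := by gcongr; exact zero_le

end peetre

/-! ### Dyadic scales, Hardy's inequality and the interpolation norm -/

/-- The dyadic scale `ρ 2^{-k}`. -/
noncomputable def dyadic (ρ : ℝ) (k : ℕ) : ℝ := ρ / 2 ^ k

section dyadic

variable {ρ : ℝ}

theorem dyadic_pos (hρ : 0 < ρ) (k : ℕ) : 0 < dyadic ρ k := by unfold dyadic; positivity

theorem dyadic_zero (ρ : ℝ) : dyadic ρ 0 = ρ := by simp [dyadic]

theorem dyadic_succ (ρ : ℝ) (k : ℕ) : dyadic ρ (k + 1) = dyadic ρ k / 2 := by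
  simp only [dyadic, pow_succ]; field_simp

theorem dyadic_antitone (hρ : 0 < ρ) : Antitone (dyadic ρ) :=
  antitone_nat_of_succ_le fun k => by
    rw [dyadic_succ]; linarith [dyadic_pos hρ k]

theorem dyadic_le (hρ : 0 < ρ) (k : ℕ) : dyadic ρ k ≤ ρ := by
  simpa [dyadic_zero] using dyadic_antitone hρ (Nat.zero_le k)

theorem tendsto_dyadic (ρ : ℝ) : Tendsto (dyadic ρ) atTop (𝓝 0) := by
  have h := (tendsto_pow_atTop_nhds_zero_of_lt_one (r := (1 / 2 : ℝ)) (by norm_num)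
    (by norm_num)).const_mul ρ
  rw [mul_zero] at h
  refine h.congr fun k => ?_
  rw [dyadic, one_div, inv_pow]; rfl

/-- A geometric sum is controlled by its last term. -/
theorem sum_dyadic_rpow_le (hρ : 0 < ρ) {β : ℝ} (hβ : 0 < β) (m : ℕ) :
    ∑ k ∈ Finset.range (m + 1), dyadic ρ k ^ (-β)
      ≤ (2 ^ β / (2 ^ β - 1)) * dyadic ρ m ^ (-β) := by
  have hq : 1 < (2 : ℝ) ^ β := Real.one_lt_rpow (by norm_num) hβ
  have hq1 : 0 < (2 : ℝ) ^ β - 1 := by linarith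
  induction m with
  | zero =>
    have := Real.rpow_pos_of_pos (dyadic_pos hρ 0) (-β)
    simp only [zero_add, Finset.sum_range_one]
    refine le_mul_of_one_le_left this.le ?_
    rw [one_le_div hq1]; linarith
  | succ m ih =>
    rw [Finset.sum_range_succ]
    have h1 : dyadic ρ (m + 1) ^ (-β) = 2 ^ β * dyadic ρ m ^ (-β) := by
      rw [dyadic_succ, Real.div_rpow (dyadic_pos hρ m).le (by norm_num),
        Real.rpow_neg (by norm_num : (0 : ℝ) ≤ 2)]
      field_simp
    refine (add_le_add ih le_rfl).trans (le_of_eq ?_)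
    rw [h1]; field_simp; ring

/-- The weights of the scales above `t` sum up to a multiple of `t^{-β}`. -/
theorem tsum_indicator_dyadic_le (hρ : 0 < ρ) {β : ℝ} (hβ : 0 < β) {t : ℝ} (ht : 0 < t) :
    ∑' k, (Iio (2 * dyadic ρ k)).indicator (fun _ => ENNReal.ofReal (dyadic ρ k ^ (-β))) t
      ≤ ENNReal.ofReal (2 ^ β * (2 ^ β / (2 ^ β - 1)) * t ^ (-β)) := by
  have hq : 1 < (2 : ℝ) ^ β := Real.one_lt_rpow (by norm_num) hβ
  have hq1 : 0 < (2 : ℝ) ^ β - 1 := by linarith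
  rw [ENNReal.tsum_eq_iSup_nat]
  refine iSup_le fun n => ?_
  induction n with
  | zero => simp
  | succ m ih =>
    rcases lt_or_ge t (2 * dyadic ρ m) with h | h
    · have hall : ∀ k ∈ Finset.range (m + 1),
          (Iio (2 * dyadic ρ k)).indicator (fun _ => ENNReal.ofReal (dyadic ρ k ^ (-β))) t
            = ENNReal.ofReal (dyadic ρ k ^ (-β)) := by
        intro k hk
        refine indicator_of_mem (mem_Iio.2 (h.trans_le ?_)) _
        have := dyadic_antitone hρ (Nat.lt_succ_iff.1 (Finset.mem_range.1 hk))
        linarith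
      rw [Finset.sum_congr rfl hall, ← ENNReal.ofReal_sum_of_nonneg
        fun k _ => Real.rpow_nonneg (dyadic_pos hρ k).le _]
      refine ENNReal.ofReal_le_ofReal ((sum_dyadic_rpow_le hρ hβ m).trans ?_)
      have h2 : dyadic ρ m ^ (-β) ≤ (t / 2) ^ (-β) :=
        Real.rpow_le_rpow_of_nonpos (by positivity) (by linarith) (by linarith)
      rw [Real.div_rpow ht.le (by norm_num), Real.rpow_neg (by norm_num : (0 : ℝ) ≤ 2)] at h2
      have h3 : t ^ (-β) / (2 ^ β)⁻¹ = 2 ^ β * t ^ (-β) := by field_simp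
      rw [h3] at h2
      calc _ ≤ (2 ^ β / (2 ^ β - 1)) * (2 ^ β * t ^ (-β)) := by gcongr
        _ = _ := by ring
    · rw [Finset.sum_range_succ, indicator_of_notMem (by simpa using h), add_zero]
      exact ih

theorem lintegral_rpow_neg_half {a : ℝ} (ha : 0 < a) :
    ∫⁻ t in Ioo 0 a, ENNReal.ofReal (t ^ (-(1 / 2) : ℝ)) = ENNReal.ofReal (2 * a ^ (1 / 2 : ℝ)) := by
  have h1 : IntervalIntegrable (fun t : ℝ => t ^ (-(1 / 2) : ℝ)) volume 0 a :=
    intervalIntegral.intervalIntegrable_rpow' (by norm_num)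
  have h2 : IntegrableOn (fun t : ℝ => t ^ (-(1 / 2) : ℝ)) (Ioo 0 a) := by
    rw [← integrableOn_Ioc_iff_integrableOn_Ioo]
    exact (intervalIntegrable_iff_integrableOn_Ioc_of_le ha.le).1 h1
  rw [← ofReal_integral_eq_lintegral_ofReal h2 ?_, ← integral_Ioc_eq_integral_Ioo,
    ← intervalIntegral.integral_of_le ha.le, integral_rpow (Or.inl (by norm_num))]
  · congr 1
    norm_num
    ring
  · filter_upwards [ae_restrict_mem measurableSet_Ioo] with t ht
    exact Real.rpow_nonneg ht.1.le _

/-- The constant in Hardy's inequality over dyadic layers, for the weights `ρ_k^{-β}` with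
`β = 1 / (2 (p - 1))`, a choice that leaves the integrable power `t^{-1/2}`. -/
noncomputable def hardyConst (p : ℝ) : ℝ≥0∞ :=
  ENNReal.ofReal (2 ^ (1 / (2 * (p - 1))) * (2 ^ (1 / (2 * (p - 1)))
    / (2 ^ (1 / (2 * (p - 1))) - 1))) ^ (p - 1) * ENNReal.ofReal (2 * 2 ^ (1 / 2 : ℝ))

theorem hardyConst_ne_top {p : ℝ} (hp : 1 < p) : hardyConst p ≠ ⊤ :=
  ENNReal.mul_ne_top (ENNReal.rpow_ne_top_of_nonneg (by linarith) ENNReal.ofReal_ne_top)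
    ENNReal.ofReal_ne_top

/-- Hardy's inequality over the dyadic layers `0 < t < 2 ρ 2^{-k}`. -/
theorem lintegral_tsum_dyadic_rpow_le (hρ : 0 < ρ) {p : ℝ} (hp : 1 < p) (c : ℕ → ℝ≥0∞) :
    ∫⁻ t in Ioi (0 : ℝ), (∑' k, (Iio (2 * dyadic ρ k)).indicator (fun _ => c k) t) ^ p
      ≤ hardyConst p * ∑' k, ENNReal.ofReal (dyadic ρ k) * c k ^ p := by
  set β := 1 / (2 * (p - 1)) with hβ
  have hp1 : 0 < p - 1 := by linarith
  have hβ0 : 0 < β := by positivity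
  have hβp : β * (p - 1) = 1 / 2 := by rw [hβ]; field_simp
  set B : ℝ := 2 ^ β * (2 ^ β / (2 ^ β - 1)) with hB
  have hq : 1 < (2 : ℝ) ^ β := Real.one_lt_rpow (by norm_num) hβ0
  have hq1 : 0 < (2 : ℝ) ^ β - 1 := by linarith
  have hB0 : 0 ≤ B := by positivity
  have hd0 := fun k => dyadic_pos hρ k
  -- Hölder's inequality for sums, with the weights `ρ_k^{-β}` on the layers that contain `t`
  have hpt : ∀ t ∈ Ioi (0 : ℝ),
      (∑' k, (Iio (2 * dyadic ρ k)).indicator (fun _ => c k) t) ^ p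
        ≤ ENNReal.ofReal B ^ (p - 1) * ∑' k, (Ioo 0 (2 * dyadic ρ k)).indicator
          (fun t => ENNReal.ofReal (t ^ (-(1 / 2) : ℝ))
            * (ENNReal.ofReal (dyadic ρ k ^ (1 / 2 : ℝ)) * c k ^ p)) t := by
    intro t ht
    have ht0 : 0 < t := ht
    have h := lintegral_mul_rpow_le (μ := Measure.count) hp
      (k := fun k : ℕ => (Iio (2 * dyadic ρ k)).indicator
        (fun _ => ENNReal.ofReal (dyadic ρ k ^ (-β))) t)
      (u := fun k => ENNReal.ofReal (dyadic ρ k ^ β) * c k)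
      (measurable_of_countable _).aemeasurable (measurable_of_countable _).aemeasurable
    rw [lintegral_count, lintegral_count, lintegral_count] at h
    have e1 : ∀ k, (Iio (2 * dyadic ρ k)).indicator
        (fun _ => ENNReal.ofReal (dyadic ρ k ^ (-β))) t * (ENNReal.ofReal (dyadic ρ k ^ β) * c k)
        = (Iio (2 * dyadic ρ k)).indicator (fun _ => c k) t := by
      intro k
      by_cases hk : t ∈ Iio (2 * dyadic ρ k)
      · rw [indicator_of_mem hk, indicator_of_mem hk, ← mul_assoc, ← ENNReal.ofReal_mul
          (Real.rpow_nonneg (hd0 k).le _), ← Real.rpow_add (hd0 k)]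
        simp
      · rw [indicator_of_notMem hk, indicator_of_notMem hk, zero_mul]
    have e2 : ∀ k, (Iio (2 * dyadic ρ k)).indicator
        (fun _ => ENNReal.ofReal (dyadic ρ k ^ (-β))) t
          * (ENNReal.ofReal (dyadic ρ k ^ β) * c k) ^ p
        = (Iio (2 * dyadic ρ k)).indicator
          (fun _ => ENNReal.ofReal (dyadic ρ k ^ (1 / 2 : ℝ)) * c k ^ p) t := by
      intro k
      by_cases hk : t ∈ Iio (2 * dyadic ρ k)
      · rw [indicator_of_mem hk, indicator_of_mem hk,
          ENNReal.mul_rpow_of_nonneg _ _ (by linarith), ← mul_assoc,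
          ENNReal.ofReal_rpow_of_nonneg (Real.rpow_nonneg (hd0 k).le _) (by linarith),
          ← ENNReal.ofReal_mul (Real.rpow_nonneg (hd0 k).le _), ← Real.rpow_mul (hd0 k).le,
          ← Real.rpow_add (hd0 k)]
        congr 3
        linarith
      · rw [indicator_of_notMem hk, indicator_of_notMem hk, zero_mul]
    simp only [e1, e2] at h
    refine h.trans ?_
    have e3 : ENNReal.ofReal (B * t ^ (-β)) ^ (p - 1)
        = ENNReal.ofReal B ^ (p - 1) * ENNReal.ofReal (t ^ (-(1 / 2) : ℝ)) := by
      rw [ENNReal.ofReal_mul hB0, ENNReal.mul_rpow_of_nonneg _ _ hp1.le,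
        ENNReal.ofReal_rpow_of_nonneg (Real.rpow_nonneg ht0.le _) hp1.le, ← Real.rpow_mul ht0.le,
        neg_mul, hβp]
    refine (mul_le_mul_left (ENNReal.rpow_le_rpow (tsum_indicator_dyadic_le hρ hβ0 ht0)
      hp1.le) _).trans (le_of_eq ?_)
    rw [e3, mul_assoc, ← ENNReal.tsum_mul_left]
    congr 2
    ext k
    by_cases hk : t ∈ Iio (2 * dyadic ρ k)
    · rw [indicator_of_mem hk, indicator_of_mem (show t ∈ Ioo 0 (2 * dyadic ρ k) from ⟨ht0, hk⟩)]
    · rw [indicator_of_notMem hk, indicator_of_notMem (fun h => hk h.2), mul_zero]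
  refine (setLIntegral_mono' measurableSet_Ioi hpt).trans ?_
  rw [lintegral_const_mul' _ _ (ENNReal.rpow_ne_top_of_nonneg hp1.le ENNReal.ofReal_ne_top),
    hardyConst, mul_assoc]
  gcongr
  have hmeas : Measurable fun t : ℝ => ENNReal.ofReal (t ^ (-(1 / 2) : ℝ)) := by fun_prop
  rw [lintegral_tsum fun k => ((hmeas.mul_const _).indicator measurableSet_Ioo).aemeasurable,
    ← ENNReal.tsum_mul_left]
  refine ENNReal.tsum_le_tsum fun k => ?_
  refine (setLIntegral_le_lintegral _ _).trans ?_
  rw [lintegral_indicator measurableSet_Ioo, lintegral_mul_const _ hmeas,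
    lintegral_rpow_neg_half (by linarith [hd0 k]), ← mul_assoc, ← mul_assoc]
  refine le_of_eq ?_
  congr 1
  have hdk := hd0 k
  rw [← ENNReal.ofReal_mul (by positivity), ← ENNReal.ofReal_mul (by positivity)]
  congr 1
  rw [Real.mul_rpow (by norm_num) (hd0 k).le]
  have : dyadic ρ k ^ (1 / 2 : ℝ) * dyadic ρ k ^ (1 / 2 : ℝ) = dyadic ρ k := by
    rw [← Real.rpow_add (hd0 k)]; norm_num
  linear_combination (2 * 2 ^ (1 / 2 : ℝ)) * this

/-- The norm of the interpolation space, with the exponent `s = 1 - 1/p`, controls the sum of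
Peetre's functional over the dyadic scales. -/
theorem tsum_dyadic_peetreK_le {E : Type*} [NormedAddCommGroup E] [NormedSpace ℝ E]
    [MeasureSpace E] {ι : Type*} [Fintype ι] {U : Set E} {μ : Measure E} {e : ι → E} {p : ℝ}
    (hp : 1 < p) {u : E → ℝ} (hρ : 0 < ρ) :
    ∑' k, ENNReal.ofReal (dyadic ρ k)
        * (ENNReal.ofReal (dyadic ρ k)⁻¹ * peetreK U μ e p (dyadic ρ k) u) ^ p
      ≤ 2 ^ p * fracSobolevNorm U μ e (1 - 1 / p) p u ^ p := by
  have hp0 : 0 < p := by linarith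
  have hd0 := fun k => dyadic_pos hρ k
  rw [fracSobolevNorm, ← ENNReal.rpow_mul, one_div_mul_cancel hp0.ne', ENNReal.rpow_one]
  set φ : ℝ → ℝ≥0∞ := fun t =>
    (ENNReal.ofReal (t ^ (-(1 - 1 / p))) * peetreK U μ e p t u) ^ p * ENNReal.ofReal t⁻¹ with hφ
  have hsub : (⋃ k, Ioc (dyadic ρ k) (2 * dyadic ρ k)) ⊆ Ioi (0 : ℝ) :=
    iUnion_subset fun k t ht => (hd0 k).trans ht.1
  have hdisj : Pairwise (Function.onFun Disjoint fun k => Ioc (dyadic ρ k) (2 * dyadic ρ k)) := by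
    refine (pairwise_disjoint_on _).2 fun i j hij => ?_
    have h1 : 2 * dyadic ρ j ≤ dyadic ρ i := by
      have := dyadic_antitone hρ (Nat.succ_le_of_lt hij)
      have h2 := dyadic_succ ρ i
      simp only [Nat.succ_eq_add_one] at this
      linarith
    rw [Set.disjoint_left]
    intro t ht ht'
    exact absurd (ht'.2.trans h1) (not_le.2 ht.1)
  have h := lintegral_mono_set (μ := volume) (f := φ) hsub
  rw [lintegral_iUnion (fun k => measurableSet_Ioc) hdisj] at h
  refine le_trans ?_ (mul_le_mul_right h _)
  rw [← ENNReal.tsum_mul_left]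
  refine ENNReal.tsum_le_tsum fun k => ?_
  set a := dyadic ρ k with ha
  have ha0 : 0 < a := hd0 k
  set K := peetreK U μ e p a u with hK
  have hlow : ∀ t ∈ Ioc a (2 * a), ENNReal.ofReal ((2 * a) ^ (-p)) * K ^ p ≤ φ t := by
    intro t ht
    have ht0 : 0 < t := ha0.trans ht.1
    have e1 : φ t = ENNReal.ofReal (t ^ (-p)) * peetreK U μ e p t u ^ p := by
      simp only [hφ]
      rw [ENNReal.mul_rpow_of_nonneg _ _ hp0.le,
        ENNReal.ofReal_rpow_of_nonneg (Real.rpow_nonneg ht0.le _) hp0.le, mul_right_comm,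
        ← ENNReal.ofReal_mul (by positivity), ← Real.rpow_mul ht0.le]
      congr 2
      rw [← Real.rpow_neg_one t, ← Real.rpow_add ht0]
      congr 1
      field_simp
      ring
    rw [e1]
    refine mul_le_mul' (ENNReal.ofReal_le_ofReal ?_)
      (ENNReal.rpow_le_rpow (peetreK_mono ht.1.le) hp0.le)
    exact Real.rpow_le_rpow_of_nonpos ht0 ht.2 (by linarith)
  have h2 := setLIntegral_mono' (μ := volume) measurableSet_Ioc hlow
  rw [setLIntegral_const, Real.volume_Ioc] at h2
  refine le_trans (le_of_eq ?_) (mul_le_mul_right h2 _)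
  rw [ENNReal.mul_rpow_of_nonneg _ _ hp0.le, ENNReal.ofReal_rpow_of_nonneg (by positivity) hp0.le]
  have e3 : (2 : ℝ≥0∞) ^ p = ENNReal.ofReal (2 ^ p) := by
    rw [← ENNReal.ofReal_rpow_of_nonneg (by norm_num) hp0.le]; norm_num
  have e4 : a⁻¹ ^ p = 2 ^ p * (2 * a) ^ (-p) := by
    rw [Real.rpow_neg (by positivity), Real.mul_rpow (by norm_num) ha0.le, Real.inv_rpow ha0.le]
    field_simp
  rw [e4, e3, ENNReal.ofReal_mul (by positivity), show 2 * a - a = a by ring]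
  ring

/-- The norm of the interpolation space controls the norm of `L_p`. -/
theorem eLpNorm_le_fracSobolevNorm {E : Type*} [NormedAddCommGroup E] [NormedSpace ℝ E]
    [MeasureSpace E] [OpensMeasurableSpace E] [SecondCountableTopology E]
    {ι : Type*} [Fintype ι] [Nonempty ι] {U : Set E} {μ : Measure E} {e : ι → E} {p : ℝ}
    (hp : 1 < p) {u : E → ℝ} (hμ : μ ≪ volume.restrict U)
    (hu : AEStronglyMeasurable u μ) :
    eLpNorm u (ENNReal.ofReal p) μ ≤ fracSobolevNorm U μ e (1 - 1 / p) p u := by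
  have hp0 : 0 < p := by linarith
  have hp1 : 1 ≤ ENNReal.ofReal p := by
    rw [← ENNReal.ofReal_one]; exact ENNReal.ofReal_le_ofReal hp.le
  set G := eLpNorm u (ENNReal.ofReal p) μ with hG
  have hK : ∀ t, 0 < t → t ≤ 1 → ENNReal.ofReal t * G ≤ peetreK U μ e p t u := by
    intro t ht ht1
    refine le_peetreK ht fun v D hD => ?_
    have hv : AEStronglyMeasurable v μ :=
      (hD (Classical.arbitrary ι)).1.aestronglyMeasurable.mono_ac hμ
    have h1 : G ≤ eLpNorm (u - v) (ENNReal.ofReal p) μ + eLpNorm v (ENNReal.ofReal p) μ := by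
      have := eLpNorm_add_le (hu.sub hv) hv hp1
      rwa [sub_add_cancel] at this
    calc ENNReal.ofReal t * G ≤ ENNReal.ofReal t * eLpNorm (u - v) (ENNReal.ofReal p) μ
          + ENNReal.ofReal t * eLpNorm v (ENNReal.ofReal p) μ := by rw [← mul_add]; gcongr
      _ ≤ 1 * eLpNorm (u - v) (ENNReal.ofReal p) μ
          + ENNReal.ofReal t * (eLpNorm v (ENNReal.ofReal p) μ
            + ∑ i, eLpNorm (D i) (ENNReal.ofReal p) μ) := by
          gcongr
          · rw [← ENNReal.ofReal_one]; exact ENNReal.ofReal_le_ofReal ht1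
          · exact le_self_add
      _ = _ := by rw [one_mul]
  rw [fracSobolevNorm]
  have h0 : G = (∫⁻ t in Ioc (0 : ℝ) 1, G ^ p) ^ (1 / p) := by
    rw [setLIntegral_const, Real.volume_Ioc]
    simp [← ENNReal.rpow_mul, mul_inv_cancel₀ hp0.ne']
  nth_rewrite 1 [h0]
  refine ENNReal.rpow_le_rpow ?_ (by positivity)
  refine le_trans (setLIntegral_mono' measurableSet_Ioc fun t ht => ?_)
    (lintegral_mono_set (μ := volume) Ioc_subset_Ioi_self)
  have ht0 : 0 < t := ht.1
  have e1 : G ^ p = (ENNReal.ofReal (t ^ (-(1 - 1 / p))) * (ENNReal.ofReal t * G)) ^ p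
      * ENNReal.ofReal t⁻¹ := by
    rw [← mul_assoc, ← ENNReal.ofReal_mul (by positivity), ENNReal.mul_rpow_of_nonneg _ _ hp0.le,
      ENNReal.ofReal_rpow_of_nonneg (by positivity) hp0.le, mul_right_comm,
      ← ENNReal.ofReal_mul (by positivity)]
    have : (t ^ (-(1 - 1 / p)) * t) ^ p * t⁻¹ = 1 := by
      nth_rewrite 2 [← Real.rpow_one t]
      rw [← Real.rpow_add ht0, ← Real.rpow_mul ht0.le, ← Real.rpow_neg_one t, ← Real.rpow_add ht0]
      have : (-(1 - 1 / p) + 1) * p + -1 = 0 := by field_simp; ring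
      rw [this, Real.rpow_zero]
    rw [this, ENNReal.ofReal_one, one_mul]
  rw [e1]
  gcongr
  exact hK t ht0 ht.2

end dyadic

/-! ### Functions in a layer below a graph -/

/-- A smooth compactly supported function of one variable which equals `-t` near the origin. -/
theorem exists_layerProfile : ∃ (Φ : ℝ → ℝ) (M : ℝ), ContDiff ℝ ∞ Φ ∧ 0 ≤ M ∧
    (∀ t, 1 < t → Φ t = 0) ∧ (∀ t, |t| < 1 / 2 → deriv Φ t = -1) ∧
    (∀ t, |Φ t| ≤ M) ∧ (∀ t, |deriv Φ t| ≤ M) ∧ (∀ t, |deriv (deriv Φ) t| ≤ M) := by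
  let χ : ContDiffBump (0 : ℝ) := ⟨1 / 2, 1, by norm_num, by norm_num⟩
  set Φ : ℝ → ℝ := fun t => -(t * χ t) with hΦ
  have hs : ContDiff ℝ ∞ Φ := (contDiff_id.mul χ.contDiff).neg
  have hs1 : ContDiff ℝ ∞ (deriv Φ) := (contDiff_infty_iff_deriv.1 hs).2
  have hs2 : ContDiff ℝ ∞ (deriv (deriv Φ)) := (contDiff_infty_iff_deriv.1 hs1).2
  have hc : HasCompactSupport Φ := (χ.hasCompactSupport.mul_left (f := fun t : ℝ => t)).neg
  obtain ⟨M0, h0⟩ := hc.exists_bound_of_continuous hs.continuous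
  obtain ⟨M1, h1⟩ := hc.deriv.exists_bound_of_continuous hs1.continuous
  obtain ⟨M2, h2⟩ := hc.deriv.deriv.exists_bound_of_continuous hs2.continuous
  refine ⟨Φ, max M0 (max M1 M2), hs, ?_, ?_, ?_, fun t => ?_, fun t => ?_, fun t => ?_⟩
  · exact ((norm_nonneg _).trans (h0 0)).trans (le_max_left _ _)
  · intro t ht
    have : χ t = 0 := χ.zero_of_le_dist (by
      rw [Real.dist_0_eq_abs, abs_of_pos (by linarith)]; exact ht.le)
    simp [hΦ, this]
  · intro t ht
    have : Φ =ᶠ[𝓝 t] fun s => -s := by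
      filter_upwards [(isOpen_lt continuous_abs continuous_const).mem_nhds ht] with s hs
      have : χ s = 1 := χ.one_of_mem_closedBall (by
        rw [Metric.mem_closedBall, Real.dist_0_eq_abs]; exact le_of_lt hs)
      simp [hΦ, this]
    rw [this.deriv_eq]; simp
  · exact (h0 t).trans (le_max_left _ _)
  · exact (h1 t).trans ((le_max_left _ _).trans (le_max_right _ _))
  · exact (h2 t).trans ((le_max_right _ _).trans (le_max_right _ _))

section layerTerm

variable {d : ℕ}

/-- The function `r h(y') Φ((σ(y') - y^d) / r)`, which lives in a layer of thickness `r` below the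
graph of `σ`. -/
noncomputable def layerTerm (r : ℝ) (h σ : Tan d → ℝ) (Φ : ℝ → ℝ) : Pt d → ℝ :=
  fun y => r * h y.1 * Φ ((σ y.1 - y.2) / r)

variable {r : ℝ} {h σ : Tan d → ℝ} {Φ : ℝ → ℝ}

theorem contDiff_fderiv_apply {E : Type*} [NormedAddCommGroup E] [NormedSpace ℝ E] {f : E → ℝ}
    (hf : ContDiff ℝ ∞ f) (a : E) : ContDiff ℝ ∞ fun x => fderiv ℝ f x a :=
  (hf.fderiv_right (m := ∞) (by simp)).clm_apply contDiff_const

theorem contDiff_layerTerm (r : ℝ) (hh : ContDiff ℝ ∞ h) (hσ : ContDiff ℝ ∞ σ)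
    (hΦ : ContDiff ℝ ∞ Φ) : ContDiff ℝ ∞ (layerTerm r h σ Φ) :=
  (contDiff_const.mul (hh.comp contDiff_fst)).mul
    (hΦ.comp (((hσ.comp contDiff_fst).sub contDiff_snd).div_const r))

theorem fderiv_layerTerm (hr : r ≠ 0) (hh : ContDiff ℝ ∞ h) (hσ : ContDiff ℝ ∞ σ)
    (hΦ : ContDiff ℝ ∞ Φ) (y a : Pt d) :
    fderiv ℝ (layerTerm r h σ Φ) y a
      = layerTerm r (fun x => fderiv ℝ h x a.1) σ Φ y
        + r⁻¹ * layerTerm r (fun x => h x * (fderiv ℝ σ x a.1 - a.2)) σ (deriv Φ) y := by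
  have e1 : HasFDerivAt (fun y : Pt d => h y.1)
      ((fderiv ℝ h y.1).comp (ContinuousLinearMap.fst ℝ (Tan d) ℝ)) y :=
    (hh.differentiable (by simp) y.1).hasFDerivAt.comp y hasFDerivAt_fst
  have e2 : HasFDerivAt (fun y : Pt d => σ y.1)
      ((fderiv ℝ σ y.1).comp (ContinuousLinearMap.fst ℝ (Tan d) ℝ)) y :=
    (hσ.differentiable (by simp) y.1).hasFDerivAt.comp y hasFDerivAt_fst
  have e3 : HasFDerivAt (fun y : Pt d => (σ y.1 - y.2) * r⁻¹) _ y :=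
    (e2.sub hasFDerivAt_snd).mul_const r⁻¹
  have e4 := (hΦ.differentiable (by simp) ((σ y.1 - y.2) * r⁻¹)).hasDerivAt.comp_hasFDerivAt y e3
  have e5 := ((e1.const_mul r).mul e4).fderiv
  have e6 : layerTerm r h σ Φ
      = (fun y => r * h y.1) * (Φ ∘ fun y : Pt d => (σ y.1 - y.2) * r⁻¹) := by
    ext y; simp [layerTerm, div_eq_mul_inv]
  rw [e6, e5]
  simp [layerTerm, div_eq_mul_inv]
  field_simp
  ring

/-- The size `|h| + r |Dh| + r² |D²h|` of a function and its derivatives at the scale `r`. -/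
noncomputable def scaledSize (r : ℝ) (h : Tan d → ℝ) (x : Tan d) : ℝ :=
  |h x| + r * ∑ i, |fderiv ℝ h x (tanDir d i)|
    + r ^ 2 * ∑ i, ∑ j, |fderiv ℝ (fun z => fderiv ℝ h z (tanDir d i)) x (tanDir d j)|

theorem scaledSize_nonneg (hr : 0 ≤ r) (x : Tan d) : 0 ≤ scaledSize r h x := by
  unfold scaledSize
  have h1 : 0 ≤ ∑ i, |fderiv ℝ h x (tanDir d i)| := Finset.sum_nonneg fun i _ => abs_nonneg _
  have h2 : 0 ≤ ∑ i, ∑ j, |fderiv ℝ (fun z => fderiv ℝ h z (tanDir d i)) x (tanDir d j)| :=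
    Finset.sum_nonneg fun i _ => Finset.sum_nonneg fun j _ => abs_nonneg _
  positivity

theorem scaledSize_mono {r' : ℝ} (hr : 0 ≤ r) (hrr : r ≤ r') (x : Tan d) :
    scaledSize r h x ≤ scaledSize r' h x := by
  unfold scaledSize
  have h1 : 0 ≤ ∑ i, |fderiv ℝ h x (tanDir d i)| := Finset.sum_nonneg fun i _ => abs_nonneg _
  have h2 : 0 ≤ ∑ i, ∑ j, |fderiv ℝ (fun z => fderiv ℝ h z (tanDir d i)) x (tanDir d j)| :=
    Finset.sum_nonneg fun i _ => Finset.sum_nonneg fun j _ => abs_nonneg _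
  gcongr

theorem continuous_scaledSize (r : ℝ) (hh : ContDiff ℝ ∞ h) : Continuous (scaledSize r h) := by
  unfold scaledSize
  refine ((hh.continuous.abs).add (continuous_const.mul (continuous_finsetSum _ fun i _ =>
    (contDiff_fderiv_apply hh _).continuous.abs))).add (continuous_const.mul
      (continuous_finsetSum _ fun i _ => continuous_finsetSum _ fun j _ =>
        (contDiff_fderiv_apply (contDiff_fderiv_apply hh _) _).continuous.abs))

theorem abs_fderiv_ptDir_le {B : ℝ} (hB : 0 ≤ B) {x : Tan d}
    (hb : ∀ i, |fderiv ℝ h x (tanDir d i)| ≤ B) (a : Option (Fin (d - 1))) :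
    |fderiv ℝ h x (ptDir d a).1| ≤ B := by
  cases a with
  | none => simpa [ptDir] using hB
  | some i => exact hb i

theorem abs_snd_ptDir_le (a : Option (Fin (d - 1))) : |(ptDir d a).2| ≤ 1 := by
  cases a <;> simp [ptDir]

theorem abs_fderiv_fderiv_ptDir_le {B : ℝ} (hB : 0 ≤ B) {x : Tan d}
    (hb : ∀ i j, |fderiv ℝ (fun z => fderiv ℝ h z (tanDir d i)) x (tanDir d j)| ≤ B)
    (a b : Option (Fin (d - 1))) :
    |fderiv ℝ (fun z => fderiv ℝ h z (ptDir d a).1) x (ptDir d b).1| ≤ B := by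
  cases a with
  | none => simpa [ptDir] using hB
  | some i => exact abs_fderiv_ptDir_le hB (hb i) b

/-- The arithmetic behind the bounds for the derivatives of orders zero, one and two of a function in
a layer; `A`, `H₁` and `H₂` stand for the sizes of `h`, `Dh` and `D²h`. -/
theorem layer_bounds {r B M A H₁ H₂ : ℝ} (hr : 0 < r) (hr1 : r ≤ 1) (hB : 0 ≤ B) (hM : 0 ≤ M)
    (hA : 0 ≤ A) (h1 : 0 ≤ H₁) (h2 : 0 ≤ H₂) :
    r * A * M ≤ 2 * M * (B + 1) ^ 2 * (r⁻¹ * (A + r * H₁ + r ^ 2 * H₂)) ∧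
    r * H₁ * M + r⁻¹ * (r * (A * (B + 1)) * M)
      ≤ 2 * M * (B + 1) ^ 2 * (r⁻¹ * (A + r * H₁ + r ^ 2 * H₂)) ∧
    (r * H₂ * M + r⁻¹ * (r * (H₁ * (B + 1)) * M))
        + r⁻¹ * (r * (A * (B / r) + (B + 1) * H₁) * M
          + r⁻¹ * (r * (A * (B + 1) * (B + 1)) * M))
      ≤ 2 * M * (B + 1) ^ 2 * (r⁻¹ * (A + r * H₁ + r ^ 2 * H₂)) := by
  have hri := inv_pos.2 hr
  have q1 : (B + 1) ^ 2 + B ≤ 2 * (B + 1) ^ 2 := by nlinarith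
  have q2 : 2 * (B + 1) ≤ 2 * (B + 1) ^ 2 := by nlinarith
  have q3 : 1 ≤ 2 * (B + 1) ^ 2 := by nlinarith
  have q4 : B + 1 ≤ 2 * (B + 1) ^ 2 := by linarith
  have key : ∀ {a b c t : ℝ}, a ≤ 2 * (B + 1) ^ 2 → b ≤ 2 * (B + 1) ^ 2 → c ≤ 2 * (B + 1) ^ 2 →
      t ≤ r⁻¹ → 0 ≤ t → M * (t * (a * A + b * (r * H₁) + c * (r ^ 2 * H₂)))
        ≤ 2 * M * (B + 1) ^ 2 * (r⁻¹ * (A + r * H₁ + r ^ 2 * H₂)) := by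
    intro a b c t ha hb hc ht ht0
    have h3 : a * A + b * (r * H₁) + c * (r ^ 2 * H₂)
        ≤ 2 * (B + 1) ^ 2 * (A + r * H₁ + r ^ 2 * H₂) := by
      rw [mul_add, mul_add]
      exact add_le_add (add_le_add (mul_le_mul_of_nonneg_right ha hA)
        (mul_le_mul_of_nonneg_right hb (by positivity)))
        (mul_le_mul_of_nonneg_right hc (by positivity))
    calc _ ≤ M * (t * (2 * (B + 1) ^ 2 * (A + r * H₁ + r ^ 2 * H₂))) := by gcongr
      _ ≤ M * (r⁻¹ * (2 * (B + 1) ^ 2 * (A + r * H₁ + r ^ 2 * H₂))) := by gcongr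
      _ = _ := by ring
  have hrinv : 1 ≤ r⁻¹ := (one_le_inv₀ hr).2 hr1
  have z : (0 : ℝ) ≤ 2 * (B + 1) ^ 2 := by positivity
  refine ⟨?_, ?_, ?_⟩
  · refine le_trans (le_of_eq ?_) (key q3 z z (hr1.trans hrinv) hr.le)
    ring
  · refine le_trans (le_of_eq ?_) (key q4 q3 z hrinv zero_le_one)
    field_simp; ring
  · refine le_trans (le_of_eq ?_) (key q1 q2 q3 le_rfl hri.le)
    field_simp; ring

/-- All derivatives of order at most two of a function in a layer of thickness `r` are controlled
by `r⁻¹` times the scaled size of its factor `h`. -/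
theorem abs_layerTerm_le (hr : 0 < r) (hr1 : r ≤ 1) (hh : ContDiff ℝ ∞ h) (hσ : ContDiff ℝ ∞ σ)
    (hΦ : ContDiff ℝ ∞ Φ) {M B : ℝ} (hM : 0 ≤ M) (hB : 0 ≤ B) (h0 : ∀ t, |Φ t| ≤ M)
    (h1 : ∀ t, |deriv Φ t| ≤ M) (h2 : ∀ t, |deriv (deriv Φ) t| ≤ M)
    (hσ1 : ∀ i x, |fderiv ℝ σ x (tanDir d i)| ≤ B)
    (hσ2 : ∀ i j x, |fderiv ℝ (fun z => fderiv ℝ σ z (tanDir d i)) x (tanDir d j)| ≤ B / r)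
    (y : Pt d) :
    |layerTerm r h σ Φ y| ≤ 2 * M * (B + 1) ^ 2 * (r⁻¹ * scaledSize r h y.1) ∧
    (∀ a, |fderiv ℝ (layerTerm r h σ Φ) y (ptDir d a)|
      ≤ 2 * M * (B + 1) ^ 2 * (r⁻¹ * scaledSize r h y.1)) ∧
    (∀ a b, |fderiv ℝ (fun z => fderiv ℝ (layerTerm r h σ Φ) z (ptDir d a)) y (ptDir d b)|
      ≤ 2 * M * (B + 1) ^ 2 * (r⁻¹ * scaledSize r h y.1)) := by
  set x := y.1 with hx
  set H1 := ∑ i, |fderiv ℝ h x (tanDir d i)| with hH1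
  set H2 := ∑ i, ∑ j, |fderiv ℝ (fun z => fderiv ℝ h z (tanDir d i)) x (tanDir d j)| with hH2
  have hH1n : 0 ≤ H1 := Finset.sum_nonneg fun i _ => abs_nonneg _
  have hH2n : 0 ≤ H2 := Finset.sum_nonneg fun i _ => Finset.sum_nonneg fun j _ => abs_nonneg _
  have hsize : scaledSize r h x = |h x| + r * H1 + r ^ 2 * H2 := rfl
  have hd1 : ∀ a, |fderiv ℝ h x (ptDir d a).1| ≤ H1 := fun a =>
    abs_fderiv_ptDir_le hH1n (fun i => Finset.single_le_sum
      (f := fun i => |fderiv ℝ h x (tanDir d i)|) (fun _ _ => abs_nonneg _) (Finset.mem_univ i)) a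
  have hd2 : ∀ a b, |fderiv ℝ (fun z => fderiv ℝ h z (ptDir d a).1) x (ptDir d b).1| ≤ H2 :=
    abs_fderiv_fderiv_ptDir_le hH2n fun i j =>
      (Finset.single_le_sum
        (f := fun j => |fderiv ℝ (fun z => fderiv ℝ h z (tanDir d i)) x (tanDir d j)|)
        (fun _ _ => abs_nonneg _) (Finset.mem_univ j)).trans
      (Finset.single_le_sum
        (f := fun i => ∑ j, |fderiv ℝ (fun z => fderiv ℝ h z (tanDir d i)) x (tanDir d j)|)
        (fun _ _ => Finset.sum_nonneg fun _ _ => abs_nonneg _) (Finset.mem_univ i))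
  have hs1 : ∀ a, |fderiv ℝ σ x (ptDir d a).1 - (ptDir d a).2| ≤ B + 1 := fun a =>
    (abs_sub _ _).trans (add_le_add (abs_fderiv_ptDir_le hB (fun i => hσ1 i x) a)
      (abs_snd_ptDir_le a))
  have hs2 : ∀ a b, |fderiv ℝ (fun z => fderiv ℝ σ z (ptDir d a).1) x (ptDir d b).1| ≤ B / r :=
    abs_fderiv_fderiv_ptDir_le (by positivity) fun i j => hσ2 i j x
  have hΦ' : ContDiff ℝ ∞ (deriv Φ) := (contDiff_infty_iff_deriv.1 hΦ).2
  have hhn := abs_nonneg (h x)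
  have hB1 : 0 ≤ B + 1 := by linarith
  rw [hsize]
  have habs : ∀ (g : Tan d → ℝ) (Ψ : ℝ → ℝ), (∀ t, |Ψ t| ≤ M) →
      |layerTerm r g σ Ψ y| ≤ r * |g x| * M := by
    intro g Ψ hΨ
    rw [layerTerm, abs_mul, abs_mul, abs_of_pos hr]
    gcongr
    exact hΨ _
  refine ⟨?_, fun a => ?_, fun a b => ?_⟩
  · refine (habs h Φ h0).trans ?_
    exact (layer_bounds hr hr1 hB hM hhn hH1n hH2n).1
  · rw [fderiv_layerTerm hr.ne' hh hσ hΦ]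
    refine (abs_add_le _ _).trans ?_
    rw [abs_mul, abs_of_pos (inv_pos.2 hr)]
    have t1 := habs (fun x => fderiv ℝ h x (ptDir d a).1) Φ h0
    have t2 := habs (fun x => h x * (fderiv ℝ σ x (ptDir d a).1 - (ptDir d a).2)) (deriv Φ) h1
    calc _ ≤ r * |fderiv ℝ h x (ptDir d a).1| * M
          + r⁻¹ * (r * |h x * (fderiv ℝ σ x (ptDir d a).1 - (ptDir d a).2)| * M) := by gcongr
      _ ≤ r * H1 * M + r⁻¹ * (r * (|h x| * (B + 1)) * M) := by
          rw [abs_mul]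
          gcongr
          · exact hd1 a
          · exact hs1 a
      _ ≤ _ := (layer_bounds hr hr1 hB hM hhn hH1n hH2n).2.1
  · have hh1 : ContDiff ℝ ∞ fun x => fderiv ℝ h x (ptDir d a).1 := contDiff_fderiv_apply hh _
    have hS : ContDiff ℝ ∞ fun x => fderiv ℝ σ x (ptDir d a).1 := contDiff_fderiv_apply hσ _
    have hh2 : ContDiff ℝ ∞ fun x => h x * (fderiv ℝ σ x (ptDir d a).1 - (ptDir d a).2) :=
      hh.mul (hS.sub contDiff_const)
    have e0 : (fun z => fderiv ℝ (layerTerm r h σ Φ) z (ptDir d a))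
        = fun z => layerTerm r (fun x => fderiv ℝ h x (ptDir d a).1) σ Φ z
          + r⁻¹ * layerTerm r (fun x => h x * (fderiv ℝ σ x (ptDir d a).1 - (ptDir d a).2)) σ
            (deriv Φ) z := funext fun z => fderiv_layerTerm hr.ne' hh hσ hΦ z _
    -- the first derivative is a sum of two functions in the same layer, to which the formula for
    -- the derivative applies again
    have e1 := ((contDiff_layerTerm r hh1 hσ hΦ).differentiable (by simp) y).hasFDerivAt
    have e2 := ((contDiff_layerTerm r hh2 hσ hΦ').differentiable (by simp) y).hasFDerivAt
    have e3 := (e1.add (e2.const_mul r⁻¹)).fderiv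
    have e4 : fderiv ℝ (fun z => fderiv ℝ (layerTerm r h σ Φ) z (ptDir d a)) y (ptDir d b)
        = fderiv ℝ (layerTerm r (fun x => fderiv ℝ h x (ptDir d a).1) σ Φ) y (ptDir d b)
        + r⁻¹ * fderiv ℝ (layerTerm r
          (fun x => h x * (fderiv ℝ σ x (ptDir d a).1 - (ptDir d a).2)) σ (deriv Φ)) y
            (ptDir d b) := by
      rw [e0]
      refine (congrArg (fun L => L (ptDir d b)) e3).trans ?_
      simp
    have e5 : fderiv ℝ (fun x => h x * (fderiv ℝ σ x (ptDir d a).1 - (ptDir d a).2)) x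
          (ptDir d b).1
        = h x * fderiv ℝ (fun z => fderiv ℝ σ z (ptDir d a).1) x (ptDir d b).1
          + (fderiv ℝ σ x (ptDir d a).1 - (ptDir d a).2) * fderiv ℝ h x (ptDir d b).1 := by
      have f1 := (hh.differentiable (by simp) x).hasFDerivAt
      have f2 := ((hS.differentiable (by simp) x).hasFDerivAt).sub_const (ptDir d a).2
      refine (congrArg (fun L => L (ptDir d b).1) (f1.mul f2).fderiv).trans ?_
      simp
    rw [e4, fderiv_layerTerm hr.ne' hh1 hσ hΦ, fderiv_layerTerm hr.ne' hh2 hσ hΦ']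
    set Sa := fderiv ℝ σ x (ptDir d a).1 - (ptDir d a).2 with hSa
    set Sb := fderiv ℝ σ x (ptDir d b).1 - (ptDir d b).2 with hSb
    have t1 := habs (fun x => fderiv ℝ (fun x => fderiv ℝ h x (ptDir d a).1) x (ptDir d b).1) Φ h0
    have t2 := habs (fun x => fderiv ℝ h x (ptDir d a).1
      * (fderiv ℝ σ x (ptDir d b).1 - (ptDir d b).2)) (deriv Φ) h1
    have t3 := habs (fun x => fderiv ℝ (fun x => h x * (fderiv ℝ σ x (ptDir d a).1
      - (ptDir d a).2)) x (ptDir d b).1) (deriv Φ) h1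
    have t4 := habs (fun x => h x * (fderiv ℝ σ x (ptDir d a).1 - (ptDir d a).2)
      * (fderiv ℝ σ x (ptDir d b).1 - (ptDir d b).2)) (deriv (deriv Φ)) h2
    have u1 : |fderiv ℝ (fun x => fderiv ℝ h x (ptDir d a).1) x (ptDir d b).1| ≤ H2 := hd2 a b
    have u2 : |fderiv ℝ h x (ptDir d a).1 * Sb| ≤ H1 * (B + 1) := by
      rw [abs_mul]; exact mul_le_mul (hd1 a) (hs1 b) (abs_nonneg _) hH1n
    have u3 : |fderiv ℝ (fun x => h x * (fderiv ℝ σ x (ptDir d a).1 - (ptDir d a).2)) x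
        (ptDir d b).1| ≤ |h x| * (B / r) + (B + 1) * H1 := by
      rw [e5]
      refine (abs_add_le _ _).trans ?_
      rw [abs_mul, abs_mul]
      exact add_le_add (mul_le_mul_of_nonneg_left (hs2 a b) hhn)
        (mul_le_mul (hs1 a) (hd1 b) (abs_nonneg _) (by linarith))
    have u4 : |h x * Sa * Sb| ≤ |h x| * (B + 1) * (B + 1) := by
      rw [abs_mul, abs_mul]
      exact mul_le_mul (mul_le_mul_of_nonneg_left (hs1 a) hhn) (hs1 b) (abs_nonneg _)
        (by positivity)
    have hri := inv_pos.2 hr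
    calc _ ≤ (r * H2 * M + r⁻¹ * (r * (H1 * (B + 1)) * M))
          + r⁻¹ * (r * (|h x| * (B / r) + (B + 1) * H1) * M
            + r⁻¹ * (r * (|h x| * (B + 1) * (B + 1)) * M)) := by
          refine (abs_add_le _ _).trans (add_le_add ((abs_add_le _ _).trans (add_le_add ?_ ?_)) ?_)
          · exact t1.trans (by gcongr)
          · rw [abs_mul, abs_of_pos hri]
            refine mul_le_mul_of_nonneg_left (t2.trans ?_) hri.le
            gcongr
          · rw [abs_mul, abs_of_pos hri]
            refine mul_le_mul_of_nonneg_left ((abs_add_le _ _).trans (add_le_add ?_ ?_)) hri.le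
            · exact t3.trans (by gcongr)
            · rw [abs_mul, abs_of_pos hri]
              refine mul_le_mul_of_nonneg_left (t4.trans ?_) hri.le
              gcongr
      _ ≤ _ := (layer_bounds hr hr1 hB hM hhn hH1n hH2n).2.2

/-- The function in the layer and its derivatives vanish below the layer. -/
theorem layerTerm_eq_zero (hr : 0 < r) (hΦ : ∀ t, 1 < t → Φ t = 0) {y : Pt d}
    (hy : r < σ y.1 - y.2) : layerTerm r h σ Φ y = 0 := by
  rw [layerTerm, hΦ _ ((one_lt_div hr).2 hy), mul_zero]

/-- On a graph that is close to the one of `σ`, the normal derivative equals `h`. -/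
theorem fderiv_layerTerm_none (hr : 0 < r) (hh : ContDiff ℝ ∞ h) (hσ : ContDiff ℝ ∞ σ)
    (hΦ : ContDiff ℝ ∞ Φ) (h1 : ∀ t, |t| < 1 / 2 → deriv Φ t = -1) {y : Pt d}
    (hy : |σ y.1 - y.2| ≤ r / 4) :
    fderiv ℝ (layerTerm r h σ Φ) y (ptDir d none) = h y.1 := by
  rw [fderiv_layerTerm hr.ne' hh hσ hΦ]
  have : |(σ y.1 - y.2) / r| < 1 / 2 := by
    rw [abs_div, abs_of_pos hr, div_lt_iff₀ hr]; linarith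
  simp only [layerTerm, h1 _ this, ptDir]
  simp
  field_simp

/-- Smooth approximation of Lipschitz functions at the scale `r`, with the natural bounds. -/
theorem exists_smooth_approx (hd : 2 ≤ d) (L : ℝ≥0) :
    ∃ B : ℝ, 0 ≤ B ∧ ∀ ψ : Tan d → ℝ, LipschitzWith L ψ → ∀ r : ℝ, 0 < r →
      ∃ σ : Tan d → ℝ, ContDiff ℝ ∞ σ ∧ (∀ x, |σ x - ψ x| ≤ r / 4) ∧
        (∀ i x, |fderiv ℝ σ x (tanDir d i)| ≤ B) ∧
        (∀ i j x, |fderiv ℝ (fun z => fderiv ℝ σ z (tanDir d i)) x (tanDir d j)| ≤ B / r) := by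
  obtain ⟨η, -, hη, hη1, -, -⟩ := exists_mollifier hd
  set I := ∫ z, |η z| with hI
  have hI0 : 0 ≤ I := integral_nonneg fun z => abs_nonneg _
  set c : ℝ := (4 * (L * I + 1))⁻¹ with hc
  have hL : (0 : ℝ) ≤ L := L.2
  have hc0 : 0 < c := by positivity
  set B1 := ∑ i, ∫ z, |fderiv ℝ η z (tanDir d i)| with hB1
  set B2 := ∑ i, ∑ j, ∫ z, |fderiv ℝ (fun z => fderiv ℝ η z (tanDir d i)) z (tanDir d j)| with hB2
  have hB1n : 0 ≤ B1 := Finset.sum_nonneg fun i _ => integral_nonneg fun z => abs_nonneg _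
  have hB2n : 0 ≤ B2 := Finset.sum_nonneg fun i _ => Finset.sum_nonneg fun j _ =>
    integral_nonneg fun z => abs_nonneg _
  refine ⟨L * B1 + L * B2 / c, by positivity, fun ψ hψ r hr => ?_⟩
  have hcr : 0 < c * r := by positivity
  have hl : LocallyIntegrable ψ := hψ.continuous.locallyIntegrable
  have hfd : ∀ a : Tan d, (fun z => fderiv ℝ (mollify (c * r) η ψ) z a)
      = fun z => (c * r)⁻¹ * mollify (c * r) (fun z => fderiv ℝ η z a) ψ z :=
    fun a => funext fun z => hη.fderiv_mollify hcr hl z a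
  refine ⟨mollify (c * r) η ψ, hη.contDiff_mollify hcr hl, fun x => ?_, fun i x => ?_,
    fun i j x => ?_⟩
  · have h := hη.abs_mollify_sub_le hcr hψ x
    rw [hη1, one_mul] at h
    refine h.trans ?_
    have h2 : I * (L * (c * r)) = (L * I) * c * r := by ring
    have h3 : L * I * c ≤ 1 / 4 := by
      rw [hc, ← div_eq_mul_inv, div_le_iff₀ (by positivity)]; linarith
    rw [h2]; nlinarith
  · have h := (hη.fderiv_apply (tanDir d i)).abs_mollify_sub_le hcr hψ x
    rw [hη.integral_fderiv_eq_zero, zero_mul, sub_zero] at h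
    have e := congrFun (hfd (tanDir d i)) x
    rw [e, abs_mul, abs_of_pos (inv_pos.2 hcr)]
    have h4 : ∫ z, |fderiv ℝ η z (tanDir d i)| ≤ B1 :=
      Finset.single_le_sum (f := fun i => ∫ z, |fderiv ℝ η z (tanDir d i)|)
        (fun i _ => integral_nonneg fun z => abs_nonneg _) (Finset.mem_univ i)
    calc _ ≤ (c * r)⁻¹ * (B1 * (L * (c * r))) := by
          gcongr; exact h.trans (by gcongr)
      _ = L * B1 := by field_simp
      _ ≤ _ := by have : 0 ≤ L * B2 / c := by positivity
                  linarith
  · have h := ((hη.fderiv_apply (tanDir d i)).fderiv_apply (tanDir d j)).abs_mollify_sub_le hcr hψ x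
    rw [(hη.fderiv_apply (tanDir d i)).integral_fderiv_eq_zero, zero_mul, sub_zero] at h
    rw [hfd (tanDir d i)]
    have hm := (hη.fderiv_apply (tanDir d i))
    have e : fderiv ℝ (fun z => (c * r)⁻¹ * mollify (c * r) (fun z => fderiv ℝ η z (tanDir d i))
        ψ z) x (tanDir d j) = (c * r)⁻¹ * ((c * r)⁻¹ * mollify (c * r)
          (fun z => fderiv ℝ (fun z => fderiv ℝ η z (tanDir d i)) z (tanDir d j)) ψ x) := by
      rw [← hm.fderiv_mollify hcr hl]
      have := ((hm.contDiff_mollify hcr hl).differentiable (by simp) x).hasFDerivAt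
      refine (congrArg (fun L => L (tanDir d j)) (this.const_mul (c * r)⁻¹).fderiv).trans ?_
      simp
    rw [e, abs_mul, abs_mul, abs_of_pos (inv_pos.2 hcr)]
    have h4 : ∫ z, |fderiv ℝ (fun z => fderiv ℝ η z (tanDir d i)) z (tanDir d j)| ≤ B2 :=
      (Finset.single_le_sum
        (f := fun j => ∫ z, |fderiv ℝ (fun z => fderiv ℝ η z (tanDir d i)) z (tanDir d j)|)
        (fun i _ => integral_nonneg fun z => abs_nonneg _) (Finset.mem_univ j)).trans
      (Finset.single_le_sum
        (f := fun i => ∑ j, ∫ z, |fderiv ℝ (fun z => fderiv ℝ η z (tanDir d i)) z (tanDir d j)|)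
        (fun i _ => Finset.sum_nonneg fun j _ => integral_nonneg fun z => abs_nonneg _)
        (Finset.mem_univ i))
    calc _ ≤ (c * r)⁻¹ * ((c * r)⁻¹ * (B2 * (L * (c * r)))) := by
          gcongr; exact h.trans (by gcongr)
      _ = L * B2 / c / r := by field_simp
      _ ≤ _ := by gcongr; have : 0 ≤ L * B1 := by positivity
                  linarith

end layerTerm

/-! ### Locally finite sums and sums over layers -/

section LocallyFiniteSum

variable {E : Type*} [NormedAddCommGroup E]

/-- `v` is, locally in `U`, the sum of finitely many of the functions `f k`: every point of `U` has
a neighborhood in which all sufficiently long partial sums equal `v`. -/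
def IsLocSum (U : Set E) (f : ℕ → E → ℝ) (v : E → ℝ) : Prop :=
  ∀ x ∈ U, ∃ m, ∀ᶠ y in 𝓝 x, ∀ M ≥ m, v y = ∑ k ∈ Finset.range M, f k y

variable {U : Set E} {f : ℕ → E → ℝ} {v : E → ℝ}

theorem isLocSum_tsum (h : ∀ x ∈ U, ∃ m, ∀ᶠ y in 𝓝 x, ∀ k ≥ m, f k y = 0) :
    IsLocSum U f fun y => ∑' k, f k y := by
  intro x hx
  obtain ⟨m, hm⟩ := h x hx
  refine ⟨m, hm.mono fun y hy M hM => ?_⟩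
  refine tsum_eq_sum fun k hk => hy k ?_
  rw [Finset.mem_range, not_lt] at hk
  exact hM.trans hk

theorem IsLocSum.eventuallyEq (h : IsLocSum U f v) {x : E} (hx : x ∈ U) :
    ∃ M, v =ᶠ[𝓝 x] fun y => ∑ k ∈ Finset.range M, f k y := by
  obtain ⟨m, hm⟩ := h x hx
  exact ⟨m, hm.mono fun y hy => hy m le_rfl⟩

/-- The difference of a partial sum and the full sum is again a locally finite sum. -/
theorem IsLocSum.sum_range_sub (h : IsLocSum U f v) (m : ℕ) :
    IsLocSum U (fun k y => (if k < m then 0 else -1) * f k y)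
      fun y => (∑ k ∈ Finset.range m, f k y) - v y := by
  intro x hx
  obtain ⟨m₀, hm⟩ := h x hx
  refine ⟨max m₀ m, hm.mono fun y hy M hM => ?_⟩
  have hM1 : m₀ ≤ M := (le_max_left _ _).trans hM
  have hM2 : m ≤ M := (le_max_right _ _).trans hM
  simp only
  rw [hy M hM1, ← Finset.sum_range_add_sum_Ico _ hM2, ← Finset.sum_range_add_sum_Ico _ hM2]
  have h1 : ∑ k ∈ Finset.range m, (if k < m then (0 : ℝ) else -1) * f k y = 0 :=
    Finset.sum_eq_zero fun k hk => by rw [if_pos (Finset.mem_range.1 hk), zero_mul]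
  have h2 : ∑ k ∈ Finset.Ico m M, (if k < m then (0 : ℝ) else -1) * f k y
      = -∑ k ∈ Finset.Ico m M, f k y := by
    rw [← Finset.sum_neg_distrib]
    refine Finset.sum_congr rfl fun k hk => ?_
    rw [if_neg (not_lt.2 (Finset.mem_Ico.1 hk).1)]; ring
  rw [h1, h2]; ring

theorem isLocSum_sum_range (U : Set E) (f : ℕ → E → ℝ) (m : ℕ) :
    IsLocSum U (fun k y => (if k < m then 1 else 0) * f k y)
      fun y => ∑ k ∈ Finset.range m, f k y := by
  intro x _
  refine ⟨m, Eventually.of_forall fun y M hM => ?_⟩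
  simp only
  rw [← Finset.sum_range_add_sum_Ico _ hM]
  have h1 : ∑ k ∈ Finset.range m, (if k < m then (1 : ℝ) else 0) * f k y
      = ∑ k ∈ Finset.range m, f k y :=
    Finset.sum_congr rfl fun k hk => by rw [if_pos (Finset.mem_range.1 hk), one_mul]
  have h2 : ∑ k ∈ Finset.Ico m M, (if k < m then (1 : ℝ) else 0) * f k y = 0 :=
    Finset.sum_eq_zero fun k hk => by
      rw [if_neg (not_lt.2 (Finset.mem_Ico.1 hk).1), zero_mul]
  rw [h1, h2, add_zero]

theorem IsLocSum.enorm_le (h : IsLocSum U f v) {x : E} (hx : x ∈ U) :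
    ‖v x‖ₑ ≤ ∑' k, ‖f k x‖ₑ := by
  obtain ⟨M, hM⟩ := h.eventuallyEq hx
  rw [hM.eq_of_nhds]
  exact (enorm_sum_le _ _).trans (ENNReal.sum_le_tsum _)

variable [NormedSpace ℝ E]

theorem IsLocSum.contDiffAt (h : IsLocSum U f v) (hf : ∀ k, ContDiff ℝ ∞ (f k)) {x : E}
    (hx : x ∈ U) : ContDiffAt ℝ ∞ v x := by
  obtain ⟨M, hM⟩ := h.eventuallyEq hx
  exact (ContDiff.sum fun k _ => hf k).contDiffAt.congr_of_eventuallyEq hM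

theorem fderiv_finset_sum_apply (hf : ∀ k, ContDiff ℝ ∞ (f k)) (s : Finset ℕ) (x a : E) :
    fderiv ℝ (fun y => ∑ k ∈ s, f k y) x a = ∑ k ∈ s, fderiv ℝ (f k) x a := by
  rw [fderiv_fun_sum fun k _ => (hf k).differentiable (by simp) x]
  simp

theorem IsLocSum.fderiv_apply (h : IsLocSum U f v) (hf : ∀ k, ContDiff ℝ ∞ (f k)) (a : E) :
    IsLocSum U (fun k y => fderiv ℝ (f k) y a) fun y => fderiv ℝ v y a := by
  intro x hx
  obtain ⟨m, hm⟩ := h x hx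
  refine ⟨m, hm.eventually_nhds.mono fun y hy M hM => ?_⟩
  have : v =ᶠ[𝓝 y] fun z => ∑ k ∈ Finset.range M, f k z := hy.mono fun z hz => hz M hM
  simp only
  rw [this.fderiv_eq, fderiv_finset_sum_apply hf]

/-- Classical derivatives in an open set are weak derivatives. -/
theorem hasWeakDeriv_of_contDiffAt [FiniteDimensional ℝ E] [MeasureSpace E] [BorelSpace E]
    [(volume : Measure E).IsAddHaarMeasure] (hU : IsOpen U)
    (hv : ∀ x ∈ U, ContDiffAt ℝ ∞ v x) (a : E) : HasWeakDeriv U a v fun y => fderiv ℝ v y a := by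
  have hloc : ∀ u : E → ℝ, ContinuousOn u U → LocallyIntegrableOn u U volume := fun u hu =>
    hu.locallyIntegrableOn hU.measurableSet
  have hvc : ContinuousOn v U := fun x hx => (hv x hx).continuousAt.continuousWithinAt
  have hdc : ContinuousOn (fun y => fderiv ℝ v y a) U := fun x hx =>
    ((((hv x hx).fderiv_right (m := ∞) (by simp)).continuousAt).clm_apply
      continuousAt_const).continuousWithinAt
  refine ⟨hloc v hvc, hloc _ hdc, fun φ hφ hφc hφU => ?_⟩
  have hint : ∀ u ψ : E → ℝ, ContinuousOn u U → Continuous ψ → tsupport ψ ⊆ tsupport φ →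
      Integrable fun x => u x * ψ x := by
    intro u ψ hu hψ hsupp
    have hψc : HasCompactSupport ψ := hφc.of_isClosed_subset (isClosed_tsupport _) hsupp
    refine Continuous.integrable_of_hasCompactSupport ?_ hψc.mul_left
    refine continuous_of_tsupport fun x hx => ?_
    have hxU : x ∈ U := hφU (hsupp (tsupport_mul_subset_right hx))
    exact (hu.continuousAt (hU.mem_nhds hxU)).mul hψ.continuousAt
  have hφ' : Continuous fun x => fderiv ℝ φ x a := (contDiff_fderiv_apply hφ a).continuous
  have hs' : tsupport (fun x => fderiv ℝ φ x a) ⊆ tsupport φ := tsupport_fderiv_apply_subset ℝ a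
  have h := integral_mul_fderiv_eq_neg_fderiv_mul_of_integrable (μ := (volume : Measure E))
    (hint _ φ hdc hφ.continuous subset_rfl) (hint v _ hvc hφ' hs')
    (hint v φ hvc hφ.continuous subset_rfl)
    (fun x hx => (hv x (hφU hx)).differentiableAt (by simp))
    (fun x _ => hφ.differentiable (by simp) x)
  have hz : ∀ u ψ : E → ℝ, tsupport ψ ⊆ tsupport φ →
      ∫ x in U, u x * ψ x = ∫ x, u x * ψ x := by
    intro u ψ hsupp
    refine setIntegral_eq_integral_of_forall_compl_eq_zero fun x hx => ?_
    rw [image_eq_zero_of_notMem_tsupport fun hc => hx (hφU (hsupp hc)), mul_zero]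
  rw [hz v _ hs', hz _ φ subset_rfl, h]

end LocallyFiniteSum

section cylinder

instance isAddHaarMeasure_volume_pt (d : ℕ) : (volume : Measure (Pt d)).IsAddHaarMeasure :=
  inferInstanceAs ((volume : Measure (Tan d)).prod (volume : Measure ℝ)).IsAddHaarMeasure

variable {d : ℕ} {ψ : Tan d → ℝ} {R ρ p : ℝ}

theorem isOpen_cylNhd (hψ : Continuous ψ) (R : ℝ) : IsOpen (cylNhd ψ R) := by
  have h1 : IsOpen {y : Pt d | ‖y.1‖ < R} := isOpen_lt (by fun_prop) continuous_const
  have h2 : IsOpen {y : Pt d | 0 < y.2} := isOpen_lt continuous_const (by fun_prop)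
  have h3 : IsOpen {y : Pt d | y.2 < ψ y.1} := isOpen_lt (by fun_prop) (by fun_prop)
  exact h1.inter (h2.inter h3)

/-- The function `c (y')`, restricted to the points below the graph within the (vertical) distance
`2 ρ 2^{-k}`. -/
noncomputable def layerInd (ψ : Tan d → ℝ) (ρ : ℝ) (k : ℕ) (c : Tan d → ℝ≥0∞) (y : Pt d) : ℝ≥0∞ :=
  (Iio (2 * dyadic ρ k)).indicator (fun _ => c y.1) (ψ y.1 - y.2)

/-- Hardy's inequality in the direction normal to the graph bounds a sum over layers. -/
theorem lintegral_tsum_layerInd_rpow_le (hψ : Continuous ψ) (hρ : 0 < ρ) (hp : 1 < p)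
    {c : ℕ → Tan d → ℝ≥0∞} (hc : ∀ k, Measurable (c k)) :
    ∫⁻ y in cylNhd ψ R, (∑' k, layerInd ψ ρ k (c k) y) ^ p
      ≤ hardyConst p * ∑' k, ENNReal.ofReal (dyadic ρ k)
          * ∫⁻ x in Metric.ball 0 R, c k x ^ p := by
  set G : Tan d → ℝ → ℝ≥0∞ := fun x t => (Ioi (0 : ℝ)).indicator
    (fun t => (∑' k, (Iio (2 * dyadic ρ k)).indicator (fun _ => c k x) t) ^ p) t with hG
  have hGm : Measurable fun z : Tan d × ℝ => G z.1 z.2 := by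
    have h1 : Measurable fun z : Tan d × ℝ =>
        (∑' k, (Iio (2 * dyadic ρ k)).indicator (fun _ => c k z.1) z.2) ^ p := by
      refine Measurable.pow_const (Measurable.tsum fun k => ?_) p
      exact (((hc k).comp measurable_fst).indicator
        (measurable_snd measurableSet_Iio))
    exact h1.indicator (measurable_snd measurableSet_Ioi)
  set F : Pt d → ℝ≥0∞ := fun y => (Metric.ball (0 : Tan d) R).indicator
    (fun x => G x (ψ x - y.2)) y.1 with hF
  have hFm : Measurable F := by
    have h1 : Measurable fun y : Pt d => G y.1 (ψ y.1 - y.2) :=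
      hGm.comp (measurable_fst.prodMk ((hψ.measurable.comp measurable_fst).sub measurable_snd))
    exact h1.indicator (measurable_fst measurableSet_ball)
  calc ∫⁻ y in cylNhd ψ R, (∑' k, layerInd ψ ρ k (c k) y) ^ p
      ≤ ∫⁻ y in cylNhd ψ R, F y := by
        refine setLIntegral_mono' (isOpen_cylNhd hψ R).measurableSet fun y hy => le_of_eq ?_
        simp only [hF, hG]
        rw [indicator_of_mem (by simpa using hy.1),
          indicator_of_mem (show ψ y.1 - y.2 ∈ Ioi (0 : ℝ) from sub_pos.2 hy.2.2)]
        rfl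
    _ ≤ ∫⁻ y, F y := setLIntegral_le_lintegral _ _
    _ = ∫⁻ x, ∫⁻ s, F (x, s) := lintegral_prod _ hFm.aemeasurable
    _ = ∫⁻ x in Metric.ball 0 R, ∫⁻ t in Ioi (0 : ℝ),
          (∑' k, (Iio (2 * dyadic ρ k)).indicator (fun _ => c k x) t) ^ p := by
        rw [← lintegral_indicator measurableSet_ball]
        refine lintegral_congr fun x => ?_
        by_cases hx : x ∈ Metric.ball (0 : Tan d) R
        · simp only [hF, indicator_of_mem hx]
          rw [lintegral_sub_left_eq_self (fun t => G x t) (ψ x),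
            ← lintegral_indicator measurableSet_Ioi]
        · simp only [hF, indicator_of_notMem hx, lintegral_zero]
    _ ≤ ∫⁻ x in Metric.ball 0 R, hardyConst p
          * ∑' k, ENNReal.ofReal (dyadic ρ k) * c k x ^ p :=
        lintegral_mono fun x => lintegral_tsum_dyadic_rpow_le hρ hp fun k => c k x
    _ = _ := by
        rw [lintegral_const_mul' _ _ (hardyConst_ne_top hp), lintegral_tsum fun k =>
          (((hc k).pow_const p).const_mul _).aemeasurable]
        congr 2
        ext k
        rw [lintegral_const_mul' _ _ ENNReal.ofReal_ne_top]

/-- The bound on the `L_p`-norm of a sum over layers that Hardy's inequality provides. -/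
noncomputable def layerBound (ρ R p : ℝ) (c : ℕ → Tan d → ℝ≥0∞) : ℝ≥0∞ :=
  (hardyConst p * ∑' k, ENNReal.ofReal (dyadic ρ k)
    * ∫⁻ x in Metric.ball 0 R, c k x ^ p) ^ (1 / p)

theorem eLpNorm_le_layerBound (hψ : Continuous ψ) (hρ : 0 < ρ) (hp : 1 < p)
    {c : ℕ → Tan d → ℝ≥0∞} (hc : ∀ k, Measurable (c k)) {f : ℕ → Pt d → ℝ} {v : Pt d → ℝ}
    (hv : IsLocSum (cylNhd ψ R) f v)
    (hf : ∀ k, ∀ y ∈ cylNhd ψ R, ‖f k y‖ₑ ≤ layerInd ψ ρ k (c k) y) :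
    eLpNorm v (ENNReal.ofReal p) (volume.restrict (cylNhd ψ R)) ≤ layerBound ρ R p c := by
  have hp0 : 0 < p := by linarith
  rw [eLpNorm_eq_lintegral_rpow_enorm_toReal (by simpa using hp0) ENNReal.ofReal_ne_top,
    ENNReal.toReal_ofReal hp0.le]
  refine ENNReal.rpow_le_rpow ?_ (by positivity)
  refine le_trans (setLIntegral_mono' (isOpen_cylNhd hψ R).measurableSet fun y hy => ?_)
    (lintegral_tsum_layerInd_rpow_le hψ hρ hp hc)
  exact ENNReal.rpow_le_rpow ((hv.enorm_le hy).trans (ENNReal.tsum_le_tsum fun k => hf k y hy))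
    hp0.le

theorem cylNorm1_le_layerBound (hψ : Continuous ψ) (hρ : 0 < ρ) (hp : 1 < p)
    {c : ℕ → Tan d → ℝ≥0∞} (hc : ∀ k, Measurable (c k)) {f : ℕ → Pt d → ℝ} {v : Pt d → ℝ}
    (hfs : ∀ k, ContDiff ℝ ∞ (f k)) (hv : IsLocSum (cylNhd ψ R) f v)
    (h0 : ∀ k, ∀ y ∈ cylNhd ψ R, ‖f k y‖ₑ ≤ layerInd ψ ρ k (c k) y)
    (h1 : ∀ k a, ∀ y ∈ cylNhd ψ R,
      ‖fderiv ℝ (f k) y (ptDir d a)‖ₑ ≤ layerInd ψ ρ k (c k) y) :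
    cylNorm1 ψ R p v
      ≤ (1 + Fintype.card (Option (Fin (d - 1))) : ℕ) * layerBound ρ R p c := by
  refine (iInf₂_le (fun a y => fderiv ℝ v y (ptDir d a)) fun a =>
    hasWeakDeriv_of_contDiffAt (isOpen_cylNhd hψ R) (fun x hx => hv.contDiffAt hfs hx) _).trans ?_
  push_cast
  rw [add_mul, one_mul]
  refine add_le_add (eLpNorm_le_layerBound hψ hρ hp hc hv h0) ?_
  refine (Finset.sum_le_card_nsmul _ _ _ fun a _ => eLpNorm_le_layerBound hψ hρ hp hc
    (hv.fderiv_apply hfs (ptDir d a)) fun k => h1 k a).trans (le_of_eq ?_)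
  rw [nsmul_eq_mul]; rfl

theorem cylNorm2_le_layerBound (hψ : Continuous ψ) (hρ : 0 < ρ) (hp : 1 < p)
    {c : ℕ → Tan d → ℝ≥0∞} (hc : ∀ k, Measurable (c k)) {f : ℕ → Pt d → ℝ} {v : Pt d → ℝ}
    (hfs : ∀ k, ContDiff ℝ ∞ (f k)) (hv : IsLocSum (cylNhd ψ R) f v)
    (h0 : ∀ k, ∀ y ∈ cylNhd ψ R, ‖f k y‖ₑ ≤ layerInd ψ ρ k (c k) y)
    (h1 : ∀ k a, ∀ y ∈ cylNhd ψ R,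
      ‖fderiv ℝ (f k) y (ptDir d a)‖ₑ ≤ layerInd ψ ρ k (c k) y)
    (h2 : ∀ k a b, ∀ y ∈ cylNhd ψ R,
      ‖fderiv ℝ (fun z => fderiv ℝ (f k) z (ptDir d a)) y (ptDir d b)‖ₑ
        ≤ layerInd ψ ρ k (c k) y) :
    cylNorm2 ψ R p v
      ≤ (1 + Fintype.card (Option (Fin (d - 1)))
        + Fintype.card (Option (Fin (d - 1))) * Fintype.card (Option (Fin (d - 1))) : ℕ)
          * layerBound ρ R p c := by
  have hU := isOpen_cylNhd hψ R
  have hfs1 : ∀ a k, ContDiff ℝ ∞ fun y => fderiv ℝ (f k) y (ptDir d a) := fun a k =>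
    contDiff_fderiv_apply (hfs k) _
  have hv1 := fun a => hv.fderiv_apply hfs (ptDir d a)
  refine (iInf₂_le (fun a y => fderiv ℝ v y (ptDir d a))
    fun a b y => fderiv ℝ (fun z => fderiv ℝ v z (ptDir d a)) y (ptDir d b)).trans ?_
  refine (iInf₂_le (fun a => hasWeakDeriv_of_contDiffAt hU (fun x hx => hv.contDiffAt hfs hx) _)
    fun a b => hasWeakDeriv_of_contDiffAt hU
      (fun x hx => (hv1 a).contDiffAt (hfs1 a) hx) _).trans ?_
  push_cast
  rw [add_mul, add_mul, one_mul]
  refine add_le_add (add_le_add (eLpNorm_le_layerBound hψ hρ hp hc hv h0) ?_) ?_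
  · refine (Finset.sum_le_card_nsmul _ _ _ fun a _ => eLpNorm_le_layerBound hψ hρ hp hc
      (hv1 a) fun k => h1 k a).trans (le_of_eq ?_)
    rw [nsmul_eq_mul]; rfl
  · refine (Finset.sum_le_card_nsmul _ _ (Fintype.card (Option (Fin (d - 1)))
      * layerBound ρ R p c) fun a _ => ?_).trans (le_of_eq ?_)
    · refine (Finset.sum_le_card_nsmul _ _ _ fun b _ => eLpNorm_le_layerBound hψ hρ hp hc
        ((hv1 a).fderiv_apply (hfs1 a) (ptDir d b)) fun k => h2 k a b).trans (le_of_eq ?_)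
      rw [nsmul_eq_mul]; rfl
    · rw [nsmul_eq_mul, mul_assoc]; rfl

end cylinder

/-! ### Multi-scale bounds -/

section scaledSizeBounds

variable {d : ℕ} {κ f : Tan d → ℝ} {r : ℝ}

theorem IsKernel.scaledSize_mollify (h : IsKernel κ) (hr : 0 < r) (hf : LocallyIntegrable f)
    (x : Tan d) :
    scaledSize r (mollify r κ f) x = |mollify r κ f x|
      + ∑ i, |mollify r (fun z => fderiv ℝ κ z (tanDir d i)) f x|
      + ∑ i, ∑ j, |mollify r (fun z => fderiv ℝ (fun z => fderiv ℝ κ z (tanDir d i)) z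
          (tanDir d j)) f x| := by
  have e1 : ∀ i, (fun z => fderiv ℝ (mollify r κ f) z (tanDir d i))
      = fun z => r⁻¹ * mollify r (fun z => fderiv ℝ κ z (tanDir d i)) f z :=
    fun i => funext fun z => h.fderiv_mollify hr hf z _
  have e2 : ∀ i j, fderiv ℝ (fun z => fderiv ℝ (mollify r κ f) z (tanDir d i)) x (tanDir d j)
      = r⁻¹ * (r⁻¹ * mollify r (fun z => fderiv ℝ (fun z => fderiv ℝ κ z (tanDir d i)) z
          (tanDir d j)) f x) := by
    intro i j
    have hi := h.fderiv_apply (tanDir d i)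
    rw [e1, ← hi.fderiv_mollify hr hf]
    have := ((hi.contDiff_mollify hr hf).differentiable (by simp) x).hasFDerivAt
    refine (congrArg (fun L => L (tanDir d j)) (this.const_mul r⁻¹).fderiv).trans ?_
    simp
  unfold scaledSize
  simp only [e2, fun i => congrFun (e1 i) x, abs_mul, abs_of_pos (inv_pos.2 hr), Finset.mul_sum]
  congr 1
  · congr 1
    exact Finset.sum_congr rfl fun i _ => by field_simp
  · exact Finset.sum_congr rfl fun i _ => Finset.sum_congr rfl fun j _ => by field_simp

/-- An `L_p`-bound for the convolutions with a kernel and its derivatives of order at most two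
bounds the scaled size. -/
theorem IsKernel.eLpNorm_scaledSize_mollify_le (h : IsKernel κ) (hr : 0 < r)
    (hf : LocallyIntegrable f) {P : ℝ≥0∞} (hP : 1 ≤ P) {ν : Measure (Tan d)} {A K : ℝ≥0∞}
    (h0 : eLpNorm (mollify r κ f) P ν ≤ A * K)
    (h1 : ∀ i, eLpNorm (mollify r (fun z => fderiv ℝ κ z (tanDir d i)) f) P ν ≤ A * K)
    (h2 : ∀ i j, eLpNorm (mollify r (fun z => fderiv ℝ (fun z => fderiv ℝ κ z (tanDir d i)) z
      (tanDir d j)) f) P ν ≤ A * K) :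
    eLpNorm (scaledSize r (mollify r κ f)) P ν
      ≤ (1 + (d - 1 : ℕ) + (d - 1 : ℕ) * (d - 1 : ℕ)) * A * K := by
  have m0 : AEStronglyMeasurable (fun x => |mollify r κ f x|) ν :=
    (h.contDiff_mollify hr hf).continuous.abs.aestronglyMeasurable
  have m1 : ∀ i, AEStronglyMeasurable
      (fun x => |mollify r (fun z => fderiv ℝ κ z (tanDir d i)) f x|) ν := fun i =>
    ((h.fderiv_apply _).contDiff_mollify hr hf).continuous.abs.aestronglyMeasurable
  have m2 : ∀ i j, AEStronglyMeasurable (fun x => |mollify r (fun z => fderiv ℝ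
      (fun z => fderiv ℝ κ z (tanDir d i)) z (tanDir d j)) f x|) ν := fun i j =>
    (((h.fderiv_apply _).fderiv_apply _).contDiff_mollify hr
      hf).continuous.abs.aestronglyMeasurable
  have habs : ∀ u : Tan d → ℝ, eLpNorm (fun x => |u x|) P ν = eLpNorm u P ν := fun u =>
    eLpNorm_norm u
  have e : scaledSize r (mollify r κ f) = (fun x => |mollify r κ f x|)
      + (∑ i, fun x => |mollify r (fun z => fderiv ℝ κ z (tanDir d i)) f x|)
      + ∑ i, ∑ j, fun x => |mollify r (fun z => fderiv ℝ (fun z => fderiv ℝ κ z (tanDir d i)) z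
          (tanDir d j)) f x| := by
    ext x
    rw [h.scaledSize_mollify hr hf]
    simp
  rw [e]
  have s1 := Finset.aestronglyMeasurable_sum Finset.univ fun i _ => m1 i
  have s2 : ∀ i, AEStronglyMeasurable (∑ j, fun x => |mollify r (fun z => fderiv ℝ
      (fun z => fderiv ℝ κ z (tanDir d i)) z (tanDir d j)) f x|) ν := fun i =>
    Finset.aestronglyMeasurable_sum Finset.univ fun j _ => m2 i j
  refine (eLpNorm_add_le (m0.add s1) (Finset.aestronglyMeasurable_sum Finset.univ
    fun i _ => s2 i) hP).trans ?_
  rw [mul_assoc, add_mul, add_mul, one_mul]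
  refine add_le_add ((eLpNorm_add_le m0 s1 hP).trans (add_le_add ?_ ?_)) ?_
  · rw [habs]; exact h0
  · refine (eLpNorm_sum_le (fun i _ => m1 i) hP).trans ?_
    refine (Finset.sum_le_card_nsmul _ _ (A * K) fun i _ => ?_).trans (le_of_eq ?_)
    · rw [habs]; exact h1 i
    · rw [nsmul_eq_mul, Finset.card_univ, Fintype.card_fin]
  · refine (eLpNorm_sum_le (fun i _ => s2 i) hP).trans ?_
    refine (Finset.sum_le_card_nsmul _ _ ((d - 1 : ℕ) * (A * K)) fun i _ => ?_).trans (le_of_eq ?_)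
    · refine (eLpNorm_sum_le (fun j _ => m2 i j) hP).trans ?_
      refine (Finset.sum_le_card_nsmul _ _ (A * K) fun j _ => ?_).trans (le_of_eq ?_)
      · rw [habs]; exact h2 i j
      · rw [nsmul_eq_mul, Finset.card_univ, Fintype.card_fin]
    · rw [nsmul_eq_mul, Finset.card_univ, Fintype.card_fin, mul_assoc]

theorem IsKernel.exists_scaledSize_le (hκ : IsKernel κ) {p : ℝ} (hp : 1 < p) :
    ∃ A : ℝ≥0∞, A ≠ ⊤ ∧ ∀ (R r : ℝ), 0 < r → ∀ f : Tan d → ℝ,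
      MemLp f (ENNReal.ofReal p) (volume.restrict (Metric.ball 0 (3 * R))) →
      eLpNorm (scaledSize r (mollify r κ ((Metric.ball 0 (3 * R)).indicator f)))
        (ENNReal.ofReal p) (volume.restrict (Metric.ball 0 R))
        ≤ A * eLpNorm f (ENNReal.ofReal p) (volume.restrict (Metric.ball 0 (3 * R))) := by
  have hP : 1 ≤ ENNReal.ofReal p := by
    rw [← ENNReal.ofReal_one]; exact ENNReal.ofReal_le_ofReal hp.le
  set A1 := (∫⁻ z, ‖κ z‖ₑ) + (∑ i, ∫⁻ z, ‖fderiv ℝ κ z (tanDir d i)‖ₑ)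
    + ∑ i, ∑ j, ∫⁻ z, ‖fderiv ℝ (fun z => fderiv ℝ κ z (tanDir d i)) z (tanDir d j)‖ₑ with hA1
  have t1 : (∫⁻ z, ‖κ z‖ₑ) ≤ A1 := by rw [hA1, add_assoc]; exact le_self_add
  have t2 : ∀ i, (∫⁻ z, ‖fderiv ℝ κ z (tanDir d i)‖ₑ) ≤ A1 := fun i =>
    (Finset.single_le_sum (f := fun i => ∫⁻ z, ‖fderiv ℝ κ z (tanDir d i)‖ₑ)
      (fun _ _ => zero_le) (Finset.mem_univ i)).trans (le_add_self.trans le_self_add)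
  have t3 : ∀ i j, (∫⁻ z, ‖fderiv ℝ (fun z => fderiv ℝ κ z (tanDir d i)) z (tanDir d j)‖ₑ) ≤ A1 :=
    fun i j => ((Finset.single_le_sum (f := fun j => ∫⁻ z, ‖fderiv ℝ
        (fun z => fderiv ℝ κ z (tanDir d i)) z (tanDir d j)‖ₑ)
      (fun _ _ => zero_le) (Finset.mem_univ j)).trans (Finset.single_le_sum
        (f := fun i => ∑ j, ∫⁻ z, ‖fderiv ℝ (fun z => fderiv ℝ κ z (tanDir d i)) z
          (tanDir d j)‖ₑ) (fun _ _ => zero_le) (Finset.mem_univ i))).trans le_add_self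
  have hA1t : A1 ≠ ⊤ := ENNReal.add_ne_top.2 ⟨ENNReal.add_ne_top.2
    ⟨hκ.lintegral_lt_top.ne, ENNReal.sum_ne_top.2 fun i _ =>
      (hκ.fderiv_apply _).lintegral_lt_top.ne⟩, ENNReal.sum_ne_top.2 fun i _ =>
        ENNReal.sum_ne_top.2 fun j _ => ((hκ.fderiv_apply _).fderiv_apply _).lintegral_lt_top.ne⟩
  refine ⟨(1 + (d - 1 : ℕ) + (d - 1 : ℕ) * (d - 1 : ℕ)) * A1, by finiteness,
    fun R r hr f hf => ?_⟩
  have hU : MeasurableSet (Metric.ball (0 : Tan d) (3 * R)) := measurableSet_ball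
  have key : ∀ {k : Tan d → ℝ}, IsKernel k → (∫⁻ z, ‖k z‖ₑ) ≤ A1 →
      eLpNorm (mollify r k ((Metric.ball 0 (3 * R)).indicator f)) (ENNReal.ofReal p)
        (volume.restrict (Metric.ball 0 R))
        ≤ A1 * eLpNorm f (ENNReal.ofReal p) (volume.restrict (Metric.ball 0 (3 * R))) := by
    intro k hk hkA
    refine (eLpNorm_mono_measure _ Measure.restrict_le_self).trans ((hk.eLpNorm_mollify_le hr hp
      ((aestronglyMeasurable_indicator_iff hU).2 hf.1)).trans ?_)
    rw [eLpNorm_indicator_eq_eLpNorm_restrict hU]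
    gcongr
  exact hκ.eLpNorm_scaledSize_mollify_le hr (locallyIntegrable_indicator hU hp hf) hP
    (key hκ t1) (fun i => key (hκ.fderiv_apply _) (t2 i))
    fun i j => key ((hκ.fderiv_apply _).fderiv_apply _) (t3 i j)

theorem isKernel_single (h : IsKernel κ) (j i : Fin (d - 1)) :
    IsKernel (fun x => if i = j then κ x else 0) := by
  by_cases hij : i = j
  · simpa [hij] using h
  · simpa [hij] using (⟨contDiff_const, fun _ _ => rfl⟩ : IsKernel fun _ : Tan d => (0 : ℝ))

theorem fderiv_eq_sum_single (κ : Tan d → ℝ) (j : Fin (d - 1)) (x : Tan d) :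
    fderiv ℝ κ x (tanDir d j)
      = ∑ i, fderiv ℝ (fun x => if i = j then κ x else 0) x (tanDir d i) := by
  rw [Finset.sum_eq_single j]
  · simp
  · intro i _ hij; simp [hij]
  · simp

/-- The bound by Peetre's functional, for a divergence kernel and its derivatives of order at most
two, which are divergences, too. -/
theorem IsKernel.exists_scaledSize_le_peetreK (hd : 2 ≤ d) (hκ : IsKernel κ)
    {F : Fin (d - 1) → Tan d → ℝ} (hF : ∀ i, IsKernel (F i))
    (hκF : ∀ x, κ x = ∑ i, fderiv ℝ (F i) x (tanDir d i)) {p : ℝ} (hp : 1 < p) :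
    ∃ A : ℝ≥0∞, A ≠ ⊤ ∧ ∀ (R r : ℝ), 0 < r → r ≤ R → ∀ (f : Tan d → ℝ) (μ : Measure (Tan d)),
      volume.restrict (Metric.ball 0 (3 * R)) ≤ μ →
      MemLp f (ENNReal.ofReal p) (volume.restrict (Metric.ball 0 (3 * R))) →
      eLpNorm (scaledSize r (mollify r κ ((Metric.ball 0 (3 * R)).indicator f)))
        (ENNReal.ofReal p) (volume.restrict (Metric.ball 0 R))
        ≤ A * peetreK (Metric.ball 0 (3 * R)) μ (tanDir d) p r f := by
  have hP : 1 ≤ ENNReal.ofReal p := by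
    rw [← ENNReal.ofReal_one]; exact ENNReal.ofReal_le_ofReal hp.le
  set C : (Tan d → ℝ) → (Fin (d - 1) → Tan d → ℝ) → ℝ≥0∞ := fun k G =>
    1 + (∫⁻ z, ‖k z‖ₑ) + ∑ i, ∫⁻ z, ‖G i z‖ₑ with hC
  have hCt : ∀ {k G}, IsKernel k → (∀ i, IsKernel (G i)) → C k G ≠ ⊤ := fun hk hG =>
    ENNReal.add_ne_top.2 ⟨ENNReal.add_ne_top.2 ⟨ENNReal.one_ne_top, hk.lintegral_lt_top.ne⟩,
      ENNReal.sum_ne_top.2 fun i _ => (hG i).lintegral_lt_top.ne⟩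
  set κ₁ : Fin (d - 1) → Tan d → ℝ := fun i z => fderiv ℝ κ z (tanDir d i) with hκ1
  set κ₂ : Fin (d - 1) → Fin (d - 1) → Tan d → ℝ := fun i j z =>
    fderiv ℝ (κ₁ i) z (tanDir d j) with hκ2
  have k1 : ∀ i, IsKernel (κ₁ i) := fun i => hκ.fderiv_apply _
  have k2 : ∀ i j, IsKernel (κ₂ i j) := fun i j => (k1 i).fderiv_apply _
  set G₁ : Fin (d - 1) → Fin (d - 1) → Tan d → ℝ := fun j i x => if i = j then κ x else 0
  set G₂ : Fin (d - 1) → Fin (d - 1) → Fin (d - 1) → Tan d → ℝ := fun l j i x =>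
    if i = j then κ₁ l x else 0
  set A1 := C κ F + (∑ i, C (κ₁ i) (G₁ i)) + ∑ i, ∑ j, C (κ₂ i j) (G₂ i j) with hA1
  have t1 : C κ F ≤ A1 := by rw [hA1, add_assoc]; exact le_self_add
  have t2 : ∀ i, C (κ₁ i) (G₁ i) ≤ A1 := fun i =>
    (Finset.single_le_sum (f := fun i => C (κ₁ i) (G₁ i))
      (fun _ _ => zero_le) (Finset.mem_univ i)).trans (le_add_self.trans le_self_add)
  have t3 : ∀ i j, C (κ₂ i j) (G₂ i j) ≤ A1 :=
    fun i j => ((Finset.single_le_sum (f := fun j => C (κ₂ i j) (G₂ i j))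
      (fun _ _ => zero_le) (Finset.mem_univ j)).trans (Finset.single_le_sum
        (f := fun i => ∑ j, C (κ₂ i j) (G₂ i j)) (fun _ _ => zero_le)
          (Finset.mem_univ i))).trans le_add_self
  have hA1t : A1 ≠ ⊤ := ENNReal.add_ne_top.2 ⟨ENNReal.add_ne_top.2
    ⟨hCt hκ hF, ENNReal.sum_ne_top.2 fun i _ => hCt (k1 i) (isKernel_single hκ i)⟩,
      ENNReal.sum_ne_top.2 fun i _ => ENNReal.sum_ne_top.2 fun j _ =>
        hCt (k2 i j) (isKernel_single (k1 i) j)⟩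
  refine ⟨(1 + (d - 1 : ℕ) + (d - 1 : ℕ) * (d - 1 : ℕ)) * A1, by finiteness,
    fun R r hr hrR f μ hμ hf => ?_⟩
  have hU : MeasurableSet (Metric.ball (0 : Tan d) (3 * R)) := measurableSet_ball
  have key : ∀ {k : Tan d → ℝ} {G : Fin (d - 1) → Tan d → ℝ}, IsKernel k →
      (∀ i, IsKernel (G i)) → (∀ x, k x = ∑ i, fderiv ℝ (G i) x (tanDir d i)) → C k G ≤ A1 →
      eLpNorm (mollify r k ((Metric.ball 0 (3 * R)).indicator f)) (ENNReal.ofReal p)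
        (volume.restrict (Metric.ball 0 R))
        ≤ A1 * peetreK (Metric.ball 0 (3 * R)) μ (tanDir d) p r f := by
    intro k G hk hG hkG hkA
    refine (hk.eLpNorm_mollify_le_peetreK hd hG hkG hp hr hrR hμ hf).trans ?_
    gcongr
  exact hκ.eLpNorm_scaledSize_mollify_le hr (locallyIntegrable_indicator hU hp hf) hP
    (key hκ hF hκF t1)
    (fun i => key (k1 i) (isKernel_single hκ i) (fderiv_eq_sum_single κ i) (t2 i))
    fun i j => key (k2 i j) (isKernel_single (k1 i) j) (fderiv_eq_sum_single (κ₁ i) j) (t3 i j)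

end scaledSizeBounds

section layerSequence

variable {d : ℕ}

/-- The majorant of the terms in the `k`-th layer, without the restriction to the layer. -/
noncomputable def layerCoeff (C ρ : ℝ) (h : ℕ → Tan d → ℝ) (k : ℕ) (x : Tan d) : ℝ≥0∞ :=
  ENNReal.ofReal (C * ((dyadic ρ k)⁻¹ * scaledSize (dyadic ρ k) (h k) x))

theorem measurable_layerCoeff (C ρ : ℝ) {h : ℕ → Tan d → ℝ} (hh : ∀ k, ContDiff ℝ ∞ (h k))
    (k : ℕ) : Measurable (layerCoeff C ρ h k) :=
  (continuous_const.mul (continuous_const.mul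
    (continuous_scaledSize _ (hh k)))).measurable.ennreal_ofReal

theorem lintegral_layerCoeff_rpow {C ρ p : ℝ} (hC : 0 ≤ C) (hρ : 0 < ρ) (hp : 1 < p)
    (h : ℕ → Tan d → ℝ) (k : ℕ) (R : ℝ) :
    ∫⁻ x in Metric.ball 0 R, layerCoeff C ρ h k x ^ p
      = ENNReal.ofReal C ^ p * (ENNReal.ofReal (dyadic ρ k)⁻¹
        * eLpNorm (scaledSize (dyadic ρ k) (h k)) (ENNReal.ofReal p)
            (volume.restrict (Metric.ball 0 R))) ^ p := by
  have hp0 : 0 < p := by linarith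
  have hd0 := dyadic_pos hρ k
  rw [eLpNorm_eq_lintegral_rpow_enorm_toReal (by simpa using hp0) ENNReal.ofReal_ne_top,
    ENNReal.toReal_ofReal hp0.le, ENNReal.mul_rpow_of_nonneg _ _ hp0.le, ← ENNReal.rpow_mul,
    one_div_mul_cancel hp0.ne', ENNReal.rpow_one, ← mul_assoc,
    ← ENNReal.mul_rpow_of_nonneg _ _ hp0.le, ← lintegral_const_mul']
  · refine lintegral_congr fun x => ?_
    rw [layerCoeff, ENNReal.ofReal_mul hC, ENNReal.ofReal_mul (by positivity), ← mul_assoc,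
      ENNReal.mul_rpow_of_nonneg _ _ hp0.le,
      Real.enorm_of_nonneg (scaledSize_nonneg hd0.le x)]
  · exact ENNReal.rpow_ne_top_of_nonneg hp0.le (by finiteness)

/-- The terms in the layers and their derivatives vanish at the vertical distance `2 ρ 2^{-k}` from
the graph, and nearer to the graph they are bounded by `layerCoeff`. -/
theorem enorm_layerTerm_le {ρ : ℝ} (hρ : 0 < ρ) (hρ1 : ρ ≤ 1) {k : ℕ} {h : ℕ → Tan d → ℝ}
    {σ : Tan d → ℝ} {ψ : Tan d → ℝ} {Φ : ℝ → ℝ} (hh : ContDiff ℝ ∞ (h k))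
    (hσ : ContDiff ℝ ∞ σ)
    (hΦ : ContDiff ℝ ∞ Φ) {M B : ℝ} (hM : 0 ≤ M) (hB : 0 ≤ B) (hΦ0 : ∀ t, 1 < t → Φ t = 0)
    (h0 : ∀ t, |Φ t| ≤ M) (h1 : ∀ t, |deriv Φ t| ≤ M) (h2 : ∀ t, |deriv (deriv Φ) t| ≤ M)
    (hσψ : ∀ x, |σ x - ψ x| ≤ dyadic ρ k / 4)
    (hσ1 : ∀ i x, |fderiv ℝ σ x (tanDir d i)| ≤ B)
    (hσ2 : ∀ i j x, |fderiv ℝ (fun z => fderiv ℝ σ z (tanDir d i)) x (tanDir d j)|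
      ≤ B / dyadic ρ k) (y : Pt d) :
    (‖layerTerm (dyadic ρ k) (h k) σ Φ y‖ₑ
      ≤ layerInd ψ ρ k (layerCoeff (2 * M * (B + 1) ^ 2) ρ h k) y) ∧
    (∀ a, ‖fderiv ℝ (layerTerm (dyadic ρ k) (h k) σ Φ) y (ptDir d a)‖ₑ
      ≤ layerInd ψ ρ k (layerCoeff (2 * M * (B + 1) ^ 2) ρ h k) y) ∧
    (∀ a b, ‖fderiv ℝ (fun z => fderiv ℝ (layerTerm (dyadic ρ k) (h k) σ Φ) z (ptDir d a)) y
        (ptDir d b)‖ₑ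
      ≤ layerInd ψ ρ k (layerCoeff (2 * M * (B + 1) ^ 2) ρ h k) y) := by
  have hr := dyadic_pos hρ k
  have hr1 : dyadic ρ k ≤ 1 := (dyadic_le hρ k).trans hρ1
  set r := dyadic ρ k with hrdef
  rcases lt_or_ge (ψ y.1 - y.2) (2 * r) with hy | hy
  · obtain ⟨b0, b1, b2⟩ := abs_layerTerm_le hr hr1 hh hσ hΦ hM hB h0 h1 h2 hσ1 hσ2 y
    have e : layerInd ψ ρ k (layerCoeff (2 * M * (B + 1) ^ 2) ρ h k) y
        = ENNReal.ofReal (2 * M * (B + 1) ^ 2 * (r⁻¹ * scaledSize r (h k) y.1)) := by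
      rw [layerInd, indicator_of_mem (mem_Iio.2 hy)]; rfl
    have hle : ∀ {t : ℝ}, |t| ≤ 2 * M * (B + 1) ^ 2 * (r⁻¹ * scaledSize r (h k) y.1) →
        ‖t‖ₑ ≤ layerInd ψ ρ k (layerCoeff (2 * M * (B + 1) ^ 2) ρ h k) y := fun {t} ht => by
      rw [e, ← ofReal_norm]
      exact ENNReal.ofReal_le_ofReal ht
    exact ⟨hle b0, fun a => hle (b1 a), fun a b => hle (b2 a b)⟩
  · have hz : layerTerm r (h k) σ Φ =ᶠ[𝓝 y] fun _ => (0 : ℝ) := by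
      have hopen : IsOpen {z : Pt d | r < σ z.1 - z.2} :=
        isOpen_lt continuous_const ((hσ.continuous.comp continuous_fst).sub continuous_snd)
      have hmem : y ∈ {z : Pt d | r < σ z.1 - z.2} := by
        have := abs_le.1 (hσψ y.1)
        have h3 : r < σ y.1 - y.2 := by linarith [this.1]
        exact h3
      filter_upwards [hopen.mem_nhds hmem] with z hz
      exact layerTerm_eq_zero hr hΦ0 hz
    have hz1 : ∀ a, (fun z => fderiv ℝ (layerTerm r (h k) σ Φ) z (ptDir d a))
        =ᶠ[𝓝 y] fun _ => (0 : ℝ) := fun a => by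
      filter_upwards [hz.eventually_nhds] with z hz
      rw [EventuallyEq.fderiv_eq hz]; simp
    refine ⟨?_, fun a => ?_, fun a b => ?_⟩
    · rw [hz.eq_of_nhds]; simp
    · rw [(hz1 a).eq_of_nhds]; simp
    · rw [(hz1 a).fderiv_eq]; simp

/-- The terms in the layers form a locally finite sum below the graph. -/
theorem eventually_layerTerm_eq_zero {ρ : ℝ} (hρ : 0 < ρ) {h : ℕ → Tan d → ℝ}
    {σ : ℕ → Tan d → ℝ} {ψ : Tan d → ℝ} (hψ : Continuous ψ) {Φ : ℝ → ℝ}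
    (hΦ0 : ∀ t, 1 < t → Φ t = 0) (hσψ : ∀ k x, |σ k x - ψ x| ≤ dyadic ρ k / 4) (R : ℝ) :
    ∀ x ∈ cylNhd ψ R, ∃ m, ∀ᶠ y in 𝓝 x, ∀ k ≥ m,
      layerTerm (dyadic ρ k) (h k) (σ k) Φ y = 0 := by
  intro x hx
  have hx0 : 0 < ψ x.1 - x.2 := sub_pos.2 hx.2.2
  obtain ⟨m, hm⟩ := eventually_atTop.1 ((tendsto_dyadic ρ).eventually
    (gt_mem_nhds (show 0 < (ψ x.1 - x.2) / 4 by positivity)))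
  refine ⟨m, ?_⟩
  have hopen : IsOpen {z : Pt d | (ψ x.1 - x.2) / 2 < ψ z.1 - z.2} :=
    isOpen_lt continuous_const ((hψ.comp continuous_fst).sub continuous_snd)
  have hmem : x ∈ {z : Pt d | (ψ x.1 - x.2) / 2 < ψ z.1 - z.2} := by
    have : (ψ x.1 - x.2) / 2 < ψ x.1 - x.2 := by linarith
    exact this
  filter_upwards [hopen.mem_nhds hmem] with y hy k hk
  have hy' : (ψ x.1 - x.2) / 2 < ψ y.1 - y.2 := hy
  refine layerTerm_eq_zero (dyadic_pos hρ k) hΦ0 ?_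
  have h1 := abs_le.1 (hσψ k y.1)
  have h2 := hm k hk
  linarith [h1.1, dyadic_pos hρ k]

end layerSequence

/-! ### Surface measure and summation over the scales -/

section surface

variable {d : ℕ} {ψ : Tan d → ℝ}

theorem restrict_le_surfMeasure (ψ : Tan d → ℝ) (r : ℝ) :
    volume.restrict (Metric.ball 0 r) ≤ surfMeasure ψ r := by
  rw [surfMeasure, ← withDensity_one (μ := volume.restrict (Metric.ball (0 : Tan d) r))]
  nth_rewrite 2 [withDensity_one]
  refine withDensity_mono (Eventually.of_forall fun x => ?_)
  rw [Pi.one_apply, ENNReal.one_le_ofReal, Real.one_le_sqrt]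
  linarith [sq_nonneg ‖fderiv ℝ ψ x‖]

theorem surfMeasure_absolutelyContinuous (ψ : Tan d → ℝ) (r : ℝ) :
    surfMeasure ψ r ≪ volume.restrict (Metric.ball 0 r) :=
  withDensity_absolutelyContinuous _ _

theorem surfMeasure_le {K : ℝ≥0} {r s : ℝ} (hψ : LipschitzOnWith K ψ (Metric.ball 0 s))
    (hrs : r ≤ s) :
    surfMeasure ψ r ≤ ENNReal.ofReal (Real.sqrt (1 + (K : ℝ) ^ 2))
      • volume.restrict (Metric.ball 0 r) := by
  rw [← withDensity_const, surfMeasure]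
  refine withDensity_mono ?_
  filter_upwards [ae_restrict_mem measurableSet_ball] with x hx
  refine ENNReal.ofReal_le_ofReal (Real.sqrt_le_sqrt ?_)
  have : ‖fderiv ℝ ψ x‖ ≤ K := norm_fderiv_le_of_lipschitzOn ℝ
    (Metric.isOpen_ball.mem_nhds (Metric.ball_subset_ball hrs hx)) hψ
  gcongr

end surface

section layerSeries

variable {d : ℕ}

/-- The quantity `∑ₖ ρ_k ‖c_k‖_p^p` that controls a sum over layers. -/
noncomputable def layerSeries (ρ R p : ℝ) (c : ℕ → Tan d → ℝ≥0∞) : ℝ≥0∞ :=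
  ∑' k, ENNReal.ofReal (dyadic ρ k) * ∫⁻ x in Metric.ball 0 R, c k x ^ p

theorem layerBound_eq (ρ R p : ℝ) (c : ℕ → Tan d → ℝ≥0∞) :
    layerBound ρ R p c = (hardyConst p * layerSeries ρ R p c) ^ (1 / p) := rfl

theorem layerBound_mono {ρ R p : ℝ} (hp : 1 < p) {c c' : ℕ → Tan d → ℝ≥0∞}
    (h : ∀ k x, c k x ≤ c' k x) : layerBound ρ R p c ≤ layerBound ρ R p c' := by
  have hp0 : 0 < p := by linarith
  unfold layerBound
  gcongr with k x
  exact h k x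

theorem layerBound_lt_top {ρ R p : ℝ} (hp : 1 < p) {c : ℕ → Tan d → ℝ≥0∞}
    (h : layerSeries ρ R p c ≠ ⊤) : layerBound ρ R p c < ⊤ := by
  rw [layerBound_eq]
  exact ENNReal.rpow_lt_top_of_nonneg (by positivity)
    (ENNReal.mul_ne_top (hardyConst_ne_top hp) h)

theorem tendsto_layerBound_tail {ρ R p : ℝ} (hp : 1 < p) {c : ℕ → Tan d → ℝ≥0∞}
    (h : layerSeries ρ R p c ≠ ⊤) :
    Tendsto (fun m => layerBound ρ R p fun k x => if k < m then 0 else c k x) atTop (𝓝 0) := by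
  have hp0 : 0 < p := by linarith
  have h1 := ENNReal.tendsto_sum_nat_add _ h
  have h2 : ∀ m, layerSeries ρ R p (fun k x => if k < m then 0 else c k x)
      = ∑' k, ENNReal.ofReal (dyadic ρ (k + m)) * ∫⁻ x in Metric.ball 0 R, c (k + m) x ^ p := by
    intro m
    rw [layerSeries, ← ENNReal.summable.sum_add_tsum_nat_add' (k := m), Finset.sum_eq_zero, zero_add]
    · simp
    · intro k hk
      simp [Finset.mem_range.1 hk, ENNReal.zero_rpow_of_pos hp0]
  have h3 := ENNReal.Tendsto.const_mul h1 (Or.inr (hardyConst_ne_top hp))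
  have h4 := ((ENNReal.continuous_rpow_const (y := 1 / p)).tendsto _).comp h3
  rw [mul_zero, ENNReal.zero_rpow_of_pos (by positivity)] at h4
  refine h4.congr fun m => ?_
  rw [layerBound_eq, h2]; rfl

/-- The terms of a multi-scale decomposition sum up to the interpolation norm. -/
theorem layerSeries_layerCoeff_le {ρ R p C : ℝ} (hρ : 0 < ρ) (hp : 1 < p) (hC : 0 ≤ C)
    {h : ℕ → Tan d → ℝ} {A₀ A G W : ℝ≥0∞} {K : ℕ → ℝ≥0∞}
    (h0 : eLpNorm (scaledSize (dyadic ρ 0) (h 0)) (ENNReal.ofReal p)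
      (volume.restrict (Metric.ball 0 R)) ≤ A₀ * G)
    (h1 : ∀ k, eLpNorm (scaledSize (dyadic ρ (k + 1)) (h (k + 1))) (ENNReal.ofReal p)
      (volume.restrict (Metric.ball 0 R)) ≤ A * K k)
    (hK : ∑' k, ENNReal.ofReal (dyadic ρ k) * (ENNReal.ofReal (dyadic ρ k)⁻¹ * K k) ^ p
      ≤ 2 ^ p * W ^ p) :
    layerSeries ρ R p (layerCoeff C ρ h) ≤ ENNReal.ofReal C ^ p
      * ((ENNReal.ofReal (ρ ^ (-1 + 1 / p)) * (A₀ * G)) ^ p + (4 * A * W) ^ p) := by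
  have hp0 : 0 < p := by linarith
  have hd0 := fun k => dyadic_pos hρ k
  simp only [layerSeries, lintegral_layerCoeff_rpow hC hρ hp]
  have e0 : ∀ k, ENNReal.ofReal (dyadic ρ k) * (ENNReal.ofReal C ^ p
      * (ENNReal.ofReal (dyadic ρ k)⁻¹ * eLpNorm (scaledSize (dyadic ρ k) (h k)) (ENNReal.ofReal p)
        (volume.restrict (Metric.ball 0 R))) ^ p)
      = ENNReal.ofReal C ^ p * (ENNReal.ofReal (dyadic ρ k)
        * (ENNReal.ofReal (dyadic ρ k)⁻¹ * eLpNorm (scaledSize (dyadic ρ k) (h k))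
          (ENNReal.ofReal p) (volume.restrict (Metric.ball 0 R))) ^ p) := fun k => by ring
  simp only [e0]
  rw [ENNReal.tsum_mul_left]
  gcongr
  rw [tsum_eq_zero_add' ENNReal.summable]
  refine add_le_add ?_ ?_
  · have e1 : ENNReal.ofReal ρ = ENNReal.ofReal (ρ ^ (1 / p)) ^ p := by
      rw [ENNReal.ofReal_rpow_of_nonneg (by positivity) hp0.le, ← Real.rpow_mul hρ.le,
        one_div_mul_cancel hp0.ne', Real.rpow_one]
    rw [dyadic_zero] at h0 ⊢
    rw [e1, ← ENNReal.mul_rpow_of_nonneg _ _ hp0.le, ← mul_assoc,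
      ← ENNReal.ofReal_mul (by positivity)]
    have e2 : ρ ^ (1 / p) * ρ⁻¹ = ρ ^ (-1 + 1 / p) := by
      rw [Real.rpow_add hρ, Real.rpow_neg_one, mul_comm]
    rw [e2]
    gcongr
  · calc _ ≤ ∑' k, (2 * A) ^ p * (ENNReal.ofReal (dyadic ρ k)
          * (ENNReal.ofReal (dyadic ρ k)⁻¹ * K k) ^ p) := by
          refine ENNReal.tsum_le_tsum fun k => ?_
          have e1 : dyadic ρ (k + 1) ≤ dyadic ρ k := dyadic_antitone hρ (Nat.le_succ k)
          have e2 : ENNReal.ofReal (dyadic ρ (k + 1))⁻¹ = 2 * ENNReal.ofReal (dyadic ρ k)⁻¹ := by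
            rw [dyadic_succ, inv_div, div_eq_mul_inv, ENNReal.ofReal_mul (by norm_num)]
            norm_num
          calc _ ≤ ENNReal.ofReal (dyadic ρ k)
                * (2 * ENNReal.ofReal (dyadic ρ k)⁻¹ * (A * K k)) ^ p := by
                rw [e2]; gcongr; exact h1 k
            _ = ENNReal.ofReal (dyadic ρ k)
                * ((2 * A) * (ENNReal.ofReal (dyadic ρ k)⁻¹ * K k)) ^ p := by
                congr 2; ring
            _ = _ := by rw [ENNReal.mul_rpow_of_nonneg _ _ hp0.le]; ring
      _ ≤ (2 * A) ^ p * (2 ^ p * W ^ p) := by rw [ENNReal.tsum_mul_left]; gcongr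
      _ = (4 * A * W) ^ p := by
          rw [← ENNReal.mul_rpow_of_nonneg _ _ hp0.le, ← ENNReal.mul_rpow_of_nonneg _ _ hp0.le]
          congr 1; ring

theorem layerBound_layerCoeff_le {ρ R p C : ℝ} (hp : 1 < p) {c : ℕ → Tan d → ℝ≥0∞}
    {X Y : ℝ≥0∞} (h : layerSeries ρ R p c ≤ ENNReal.ofReal C ^ p * (X ^ p + Y ^ p)) :
    layerBound ρ R p c ≤ hardyConst p ^ (1 / p) * ENNReal.ofReal C * (X + Y) := by
  have hp0 : 0 < p := by linarith
  rw [layerBound_eq]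
  have e : ∀ Z : ℝ≥0∞, (Z ^ p) ^ (1 / p) = Z := fun Z => by
    rw [← ENNReal.rpow_mul, mul_one_div_cancel hp0.ne', ENNReal.rpow_one]
  calc _ ≤ (hardyConst p * (ENNReal.ofReal C ^ p * (X ^ p + Y ^ p))) ^ (1 / p) := by gcongr
    _ = hardyConst p ^ (1 / p) * (ENNReal.ofReal C * (X ^ p + Y ^ p) ^ (1 / p)) := by
        rw [ENNReal.mul_rpow_of_nonneg _ _ (by positivity),
          ENNReal.mul_rpow_of_nonneg _ _ (by positivity), e]
    _ ≤ hardyConst p ^ (1 / p) * (ENNReal.ofReal C * ((X ^ p) ^ (1 / p) + (Y ^ p) ^ (1 / p))) := by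
        gcongr
        exact ENNReal.rpow_add_le_add_rpow _ _ (by positivity)
          ((div_le_one hp0).2 hp.le)
    _ = _ := by rw [e, e, mul_assoc]

/-- The dyadic differences `η_ρ ⋆ f, η_{ρ/2} ⋆ f - η_ρ ⋆ f, …` of the mollifications of `f`, where
`P = η_{1/2} - η`. -/
noncomputable def mollSeq (ρ : ℝ) (η P f : Tan d → ℝ) : ℕ → Tan d → ℝ
  | 0 => mollify ρ η f
  | k + 1 => mollify (dyadic ρ k) P f

theorem sum_mollSeq {ρ : ℝ} (hρ : 0 < ρ) {η f : Tan d → ℝ} (hη : IsKernel η)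
    (hf : LocallyIntegrable f) (m : ℕ) (x : Tan d) :
    ∑ k ∈ Finset.range (m + 1),
        mollSeq ρ η (fun z => 2 ^ (d - 1) * η ((2 : ℝ) • z) - η z) f k x
      = mollify (dyadic ρ m) η f x := by
  induction m with
  | zero => simp [mollSeq, dyadic_zero]
  | succ m ih =>
    rw [Finset.sum_range_succ, ih, mollSeq, ← hη.mollify_half_sub (dyadic_pos hρ m) hf,
      dyadic_succ]
    ring

theorem IsKernel.dyadic_difference {η : Tan d → ℝ} (hη : IsKernel η) :
    IsKernel fun z => 2 ^ (d - 1) * η ((2 : ℝ) • z) - η z where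
  contDiff := (contDiff_const.mul (hη.contDiff.comp (contDiff_const_smul _))).sub hη.contDiff
  eq_zero x hx := by
    rw [hη.eq_zero x hx, hη.eq_zero _ (by rw [norm_smul]; norm_num; linarith)]
    simp

end layerSeries

/-! ### Traces and the extension -/

section trace

variable {d : ℕ} {ψ : Tan d → ℝ} {ρ R p : ℝ}

/-- A coefficient `ε = 0` removes the layer from the majorant. -/
theorem enorm_mul_le_layerInd {ε t : ℝ} (hε : |ε| ≤ 1) {k : ℕ} {c : Tan d → ℝ≥0∞} {y : Pt d}
    (ht : ‖t‖ₑ ≤ layerInd ψ ρ k c y) :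
    ‖ε * t‖ₑ ≤ layerInd ψ ρ k (fun x => if ε = 0 then 0 else c x) y := by
  by_cases h : ε = 0
  · simp [h]
  · simp only [h, if_false]
    refine le_trans ?_ ht
    rw [enorm_mul]
    refine mul_le_of_le_one_left' ?_
    rw [← ofReal_norm, Real.norm_eq_abs]
    exact ENNReal.ofReal_le_one.2 hε

/-- The bound in `W^1_p` for a sum over layers with modified coefficients. -/
theorem cylNorm1_mul_le_layerBound (hψ : Continuous ψ) (hρ : 0 < ρ) (hp : 1 < p)
    {c : ℕ → Tan d → ℝ≥0∞} (hc : ∀ k, Measurable (c k)) {f : ℕ → Pt d → ℝ} {v : Pt d → ℝ}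
    (hfs : ∀ k, ContDiff ℝ ∞ (f k)) {ε : ℕ → ℝ} (hε : ∀ k, |ε k| ≤ 1)
    (hv : IsLocSum (cylNhd ψ R) (fun k y => ε k * f k y) v)
    (h0 : ∀ k, ∀ y ∈ cylNhd ψ R, ‖f k y‖ₑ ≤ layerInd ψ ρ k (c k) y)
    (h1 : ∀ k a, ∀ y ∈ cylNhd ψ R,
      ‖fderiv ℝ (f k) y (ptDir d a)‖ₑ ≤ layerInd ψ ρ k (c k) y) :
    cylNorm1 ψ R p v ≤ (1 + Fintype.card (Option (Fin (d - 1))) : ℕ)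
      * layerBound ρ R p fun k x => if ε k = 0 then 0 else c k x := by
  refine cylNorm1_le_layerBound hψ hρ hp (fun k => ?_) (fun k => contDiff_const.mul (hfs k)) hv
    (fun k y hy => enorm_mul_le_layerInd (hε k) (h0 k y hy)) fun k a y hy => ?_
  · by_cases h : ε k = 0
    · simp only [h, if_true]; exact measurable_const
    · simp only [h, if_false]; exact hc k
  · have e : fderiv ℝ (fun y => ε k * f k y) y (ptDir d a)
        = ε k * fderiv ℝ (f k) y (ptDir d a) := by
      rw [fderiv_const_mul ((hfs k).differentiable (by simp) y)]; simp
    rw [e]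
    exact enorm_mul_le_layerInd (hε k) (h1 k a y hy)

/-- A locally finite sum of smooth functions in the layers has a trace, if the partial sums
converge on the graph. -/
theorem hasTraceOn_of_layers {ψ' : Tan d → ℝ} (hψ : Continuous ψ) (hρ : 0 < ρ) (hp : 1 < p)
    (hcyl : cylNhd ψ' R = cylNhd ψ R)
    {c : ℕ → Tan d → ℝ≥0∞} (hc : ∀ k, Measurable (c k)) (hS : layerSeries ρ R p c ≠ ⊤)
    {f : ℕ → Pt d → ℝ} {w g : Pt d → ℝ}
    (hfs : ∀ k, ContDiff ℝ ∞ (f k)) (hw : IsLocSum (cylNhd ψ R) f w)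
    (h0 : ∀ k, ∀ y ∈ cylNhd ψ R, ‖f k y‖ₑ ≤ layerInd ψ ρ k (c k) y)
    (h1 : ∀ k a, ∀ y ∈ cylNhd ψ R,
      ‖fderiv ℝ (f k) y (ptDir d a)‖ₑ ≤ layerInd ψ ρ k (c k) y)
    (hg : Tendsto (fun m => bdryLpNorm ψ' R p
      ((fun y => ∑ k ∈ Finset.range (m + 1), f k y) - g)) atTop (𝓝 0)) :
    HasTraceOn ψ' R p w g := by
  have hcn : ∀ u, cylNorm1 ψ' R p u = cylNorm1 ψ R p u := fun u => by
    simp only [cylNorm1, hcyl]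
  have htop := layerBound_lt_top hp hS
  refine ⟨?_, fun m y => ∑ k ∈ Finset.range (m + 1), f k y, fun m => ⟨?_, ?_⟩, ?_, hg⟩
  · rw [hcn]
    exact (cylNorm1_le_layerBound hψ hρ hp hc hfs hw h0 h1).trans_lt
      (ENNReal.mul_lt_top (ENNReal.natCast_lt_top _) htop)
  · exact (continuous_finsetSum _ fun k _ => (hfs k).continuous).continuousOn
  · rw [hcn]
    refine (cylNorm1_mul_le_layerBound hψ hρ hp hc hfs
      (ε := fun k => if k < m + 1 then 1 else 0) (fun k => ?_)
      (isLocSum_sum_range _ f (m + 1)) h0 h1).trans_lt (ENNReal.mul_lt_top (ENNReal.natCast_lt_top _)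
        ((layerBound_mono hp fun k x => ?_).trans_lt htop))
    · split_ifs <;> simp
    · split_ifs <;> simp
  · have ht := (ENNReal.Tendsto.const_mul
      ((tendsto_layerBound_tail hp hS).comp (tendsto_add_atTop_nat 1))
      (Or.inr (ENNReal.natCast_ne_top (1 + Fintype.card (Option (Fin (d - 1)))))))
    rw [mul_zero] at ht
    refine tendsto_of_tendsto_of_tendsto_of_le_of_le tendsto_const_nhds ht
      (fun m => zero_le) fun m => ?_
    rw [hcn]
    refine (cylNorm1_mul_le_layerBound hψ hρ hp hc hfs
      (ε := fun k => if k < m + 1 then 0 else -1) (fun k => ?_)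
      (hw.sum_range_sub (m + 1)) h0 h1).trans ?_
    · split_ifs <;> simp
    · simp only [Function.comp_apply]
      gcongr
      refine layerBound_mono hp fun k x => ?_
      split_ifs <;> simp_all

end trace

theorem theorem4p4 (d : ℕ) (hd : 2 ≤ d) (p : ℝ) (hp : 1 < p) (δ : ℝ) (hδ : 0 < δ) (hδ1 : δ ≤ 1) :
    ∃ N : ℝ, 0 < N ∧
      ∀ (Ω : Set (Pt d)) (ε₀ R₀ R : ℝ) (ψ : Tan d → ℝ),
        0 < ε₀ → 0 < R → R < δ * R₀ / 8 → IsGraphNear Ω δ ε₀ R₀ R ψ →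
        ∀ g : Pt d → ℝ, MemBdryFrac ψ (3 * R) (1 - 1 / p) p g →
          ∃ v w : Pt d → ℝ,
            cylNorm2 ψ R p v < ⊤ ∧
            HasWeakDeriv (cylNhd ψ R) (ptDir d none) v w ∧
            HasTraceOn ψ R p w g ∧
            cylNorm2 ψ R p v ≤ ENNReal.ofReal N *
              (bdryFracNorm ψ (3 * R) (1 - 1 / p) p g
                + ENNReal.ofReal (R ^ (-1 + 1 / p)) * bdryLpNorm ψ (3 * R) p g) := by
  have hp0 : 0 < p := by linarith
  obtain ⟨η, F, hη, hη1, hF, hηF⟩ := exists_mollifier hd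
  obtain ⟨Φ, M, hΦ, hM, hΦ0, hΦ1, hΦM0, hΦM1, hΦM2⟩ := exists_layerProfile
  obtain ⟨B, hB, hσ⟩ := exists_smooth_approx hd (Real.toNNReal (2 / δ))
  set P : Tan d → ℝ := fun z => 2 ^ (d - 1) * η ((2 : ℝ) • z) - η z with hP
  have hPk : IsKernel P := hη.dyadic_difference
  obtain ⟨A₀, hA0, hA0'⟩ := hη.exists_scaledSize_le hp
  obtain ⟨A, hA, hA'⟩ := hPk.exists_scaledSize_le_peetreK hd hF hηF hp
  set C := 2 * M * (B + 1) ^ 2 with hC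
  have hC0 : 0 ≤ C := by positivity
  set n : ℕ := 1 + Fintype.card (Option (Fin (d - 1)))
    + Fintype.card (Option (Fin (d - 1))) * Fintype.card (Option (Fin (d - 1))) with hn
  set N := (n : ℝ≥0∞) * (hardyConst p ^ (1 / p) * ENNReal.ofReal C * (A₀ + 4 * A)) with hN
  have hNt : N ≠ ⊤ := by
    have h1 : hardyConst p ^ (1 / p) ≠ ⊤ :=
      ENNReal.rpow_ne_top_of_nonneg (by positivity) (hardyConst_ne_top hp)
    finiteness
  refine ⟨N.toReal + 1, by positivity, fun Ω ε₀ R₀ R ψ hε hR hRR hΩ g hg => ?_⟩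
  have hNle : N ≤ ENNReal.ofReal (N.toReal + 1) := by
    rw [ENNReal.le_ofReal_iff_toReal_le hNt (by positivity)]; linarith
  -- `ψ` is replaced by a function that is Lipschitz on the whole space
  obtain ⟨ψ', hψ', hψψ'⟩ := hΩ.lipschitz.extend_real
  have hψc := hψ'.continuous
  have hRδ : R ≤ δ * R₀ := by linarith
  have heq : ∀ x ∈ Metric.ball (0 : Tan d) R, ψ x = ψ' x := fun x hx =>
    hψψ' (Metric.ball_subset_ball hRδ hx)
  have hcyl : cylNhd ψ R = cylNhd ψ' R := by
    ext y
    refine ⟨fun h => ⟨h.1, h.2.1, ?_⟩, fun h => ⟨h.1, h.2.1, ?_⟩⟩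
    · rw [← heq y.1 (by simpa using h.1)]; exact h.2.2
    · rw [heq y.1 (by simpa using h.1)]; exact h.2.2
  -- scales above one are of no use, as the norms are inhomogeneous
  set ρ := min R 1 with hρdef
  have hρ : 0 < ρ := lt_min hR one_pos
  have hρ1 : ρ ≤ 1 := min_le_right _ _
  have hρR : ρ ≤ R := min_le_left _ _
  set U := Metric.ball (0 : Tan d) (3 * R) with hU
  have hUm : MeasurableSet U := measurableSet_ball
  set f := onGraph ψ g with hf
  set μ := surfMeasure ψ (3 * R) with hμ
  have hμU : volume.restrict U ≤ μ := restrict_le_surfMeasure ψ (3 * R)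
  have hfU : MemLp f (ENNReal.ofReal p) (volume.restrict U) := hg.1.mono_measure hμU
  have hfl := locallyIntegrable_indicator hUm hp hfU
  set h := mollSeq ρ η P (U.indicator f) with hh
  have hhs : ∀ k, ContDiff ℝ ∞ (h k) := by
    intro k
    cases k with
    | zero => exact hη.contDiff_mollify hρ hfl
    | succ k => exact hPk.contDiff_mollify (dyadic_pos hρ k) hfl
  choose σ hσs hσψ hσ1 hσ2 using fun k => hσ ψ' hψ' (dyadic ρ k) (dyadic_pos hρ k)
  set V : ℕ → Pt d → ℝ := fun k => layerTerm (dyadic ρ k) (h k) (σ k) Φ with hV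
  have hVs : ∀ k, ContDiff ℝ ∞ (V k) := fun k => contDiff_layerTerm _ (hhs k) (hσs k) hΦ
  set c := layerCoeff C ρ h with hc
  have hcm : ∀ k, Measurable (c k) := measurable_layerCoeff C ρ hhs
  have hbound := fun k => enorm_layerTerm_le hρ hρ1 (k := k) (h := h) (hhs k) (hσs k) hΦ hM hB
    hΦ0 hΦM0 hΦM1 hΦM2 (hσψ k) (hσ1 k) (hσ2 k)
  set v : Pt d → ℝ := fun y => ∑' k, V k y with hv
  have hvsum : IsLocSum (cylNhd ψ' R) V v :=
    isLocSum_tsum (eventually_layerTerm_eq_zero hρ hψc hΦ0 hσψ R)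
  set G := eLpNorm f (ENNReal.ofReal p) (volume.restrict U) with hG
  set W := bdryFracNorm ψ (3 * R) (1 - 1 / p) p g with hW
  set Λ := bdryLpNorm ψ (3 * R) p g with hΛ
  have hGΛ : G ≤ Λ := eLpNorm_mono_measure _ hμU
  have hΛW : Λ ≤ W := by
    have : Nonempty (Fin (d - 1)) := ⟨⟨0, by omega⟩⟩
    exact eLpNorm_le_fracSobolevNorm hp (surfMeasure_absolutelyContinuous ψ (3 * R)) hg.1.1
  have hWt : W ≠ ⊤ := hg.2.ne
  have hΛt : Λ ≠ ⊤ := hg.1.2.ne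
  have hser : layerSeries ρ R p c ≤ ENNReal.ofReal C ^ p
      * ((ENNReal.ofReal (ρ ^ (-1 + 1 / p)) * (A₀ * G)) ^ p + (4 * A * W) ^ p) := by
    refine layerSeries_layerCoeff_le hρ hp hC0
      (K := fun k => peetreK U μ (tanDir d) p (dyadic ρ k) f) ?_ (fun k => ?_)
      (tsum_dyadic_peetreK_le hp hρ)
    · rw [dyadic_zero]
      exact hA0' R ρ hρ f hfU
    · refine le_trans (eLpNorm_mono_real fun x => ?_) (hA' R (dyadic ρ k) (dyadic_pos hρ k)
        ((dyadic_le hρ k).trans hρR) f μ hμU hfU)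
      rw [Real.norm_of_nonneg (scaledSize_nonneg (dyadic_pos hρ _).le x)]
      exact scaledSize_mono (dyadic_pos hρ _).le (dyadic_antitone hρ (Nat.le_succ k)) x
  have hserT : layerSeries ρ R p c ≠ ⊤ := by
    refine ne_top_of_le_ne_top ?_ hser
    have hGt : G ≠ ⊤ := ne_top_of_le_ne_top hΛt hGΛ
    refine ENNReal.mul_ne_top (ENNReal.rpow_ne_top_of_nonneg hp0.le ENNReal.ofReal_ne_top)
      (ENNReal.add_ne_top.2 ⟨ENNReal.rpow_ne_top_of_nonneg hp0.le ?_,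
        ENNReal.rpow_ne_top_of_nonneg hp0.le ?_⟩) <;> finiteness
  have hfinal : cylNorm2 ψ R p v ≤ ENNReal.ofReal (N.toReal + 1)
      * (W + ENNReal.ofReal (R ^ (-1 + 1 / p)) * Λ) := by
    have e1 : cylNorm2 ψ R p v = cylNorm2 ψ' R p v := by simp only [cylNorm2, hcyl]
    rw [e1]
    have e2 : ENNReal.ofReal (ρ ^ (-1 + 1 / p)) * G
        ≤ W + ENNReal.ofReal (R ^ (-1 + 1 / p)) * Λ := by
      rcases min_choice R 1 with hm | hm
      · rw [hρdef, hm]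
        exact le_add_left (by gcongr)
      · rw [hρdef, hm, Real.one_rpow, ENNReal.ofReal_one, one_mul]
        exact le_add_right (hGΛ.trans hΛW)
    calc cylNorm2 ψ' R p v ≤ n * layerBound ρ R p c :=
          cylNorm2_le_layerBound hψc hρ hp hcm hVs hvsum (fun k y _ => (hbound k y).1)
            (fun k a y _ => (hbound k y).2.1 a) fun k a b y _ => (hbound k y).2.2 a b
      _ ≤ n * (hardyConst p ^ (1 / p) * ENNReal.ofReal C
            * (ENNReal.ofReal (ρ ^ (-1 + 1 / p)) * (A₀ * G) + 4 * A * W)) := by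
          gcongr; exact layerBound_layerCoeff_le hp hser
      _ = n * (hardyConst p ^ (1 / p) * ENNReal.ofReal C
            * (A₀ * (ENNReal.ofReal (ρ ^ (-1 + 1 / p)) * G) + 4 * A * W)) := by ring
      _ ≤ n * (hardyConst p ^ (1 / p) * ENNReal.ofReal C
            * (A₀ * (W + ENNReal.ofReal (R ^ (-1 + 1 / p)) * Λ)
              + 4 * A * (W + ENNReal.ofReal (R ^ (-1 + 1 / p)) * Λ))) := by
          gcongr; exact le_self_add
      _ = N * (W + ENNReal.ofReal (R ^ (-1 + 1 / p)) * Λ) := by rw [hN]; ring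
      _ ≤ _ := by gcongr
  refine ⟨v, fun y => fderiv ℝ v y (ptDir d none), hfinal.trans_lt ?_, ?_, ?_, hfinal⟩
  · refine ENNReal.mul_lt_top ENNReal.ofReal_lt_top ?_
    exact ENNReal.add_lt_top.2 ⟨hg.2, ENNReal.mul_lt_top ENNReal.ofReal_lt_top hg.1.2⟩
  · rw [hcyl]
    exact hasWeakDeriv_of_contDiffAt (isOpen_cylNhd hψc R)
      (fun x hx => hvsum.contDiffAt hVs hx) _
  refine hasTraceOn_of_layers hψc hρ hp hcyl hcm hserT
    (f := fun k y => fderiv ℝ (V k) y (ptDir d none))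
    (fun k => contDiff_fderiv_apply (hVs k) _) (hvsum.fderiv_apply hVs _)
    (fun k y _ => (hbound k y).2.1 none) (fun k a y _ => (hbound k y).2.2 none a) ?_
  -- on the graph, the partial sums are mollifications of `g`
  set Cs := ENNReal.ofReal (Real.sqrt (1 + (Real.toNNReal (2 / δ) : ℝ) ^ 2)) with hCs
  have hlim := hη.tendsto_eLpNorm_mollify_sub hη1 hp ((memLp_indicator_iff_restrict hUm).2 hfU)
    (dyadic_pos hρ) (tendsto_dyadic ρ) R
  have hlim2 := ENNReal.Tendsto.const_mul (a := Cs ^ (1 / (ENNReal.ofReal p)).toReal) hlim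
    (Or.inr (ENNReal.rpow_ne_top_of_nonneg ENNReal.toReal_nonneg ENNReal.ofReal_ne_top))
  rw [mul_zero] at hlim2
  refine tendsto_of_tendsto_of_tendsto_of_le_of_le tendsto_const_nhds hlim2
    (fun m => zero_le) fun m => ?_
  have hae : onGraph ψ ((fun y => ∑ k ∈ Finset.range (m + 1),
      fderiv ℝ (V k) y (ptDir d none)) - g) =ᵐ[volume.restrict (Metric.ball 0 R)]
      mollify (dyadic ρ m) η (U.indicator f) - U.indicator f := by
    filter_upwards [ae_restrict_mem measurableSet_ball] with x hx
    have hxU : x ∈ U := Metric.ball_subset_ball (by linarith) hx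
    simp only [onGraph, Pi.sub_apply]
    rw [indicator_of_mem hxU, ← sum_mollSeq hρ hη hfl]
    congr 1
    refine Finset.sum_congr rfl fun k _ => ?_
    refine fderiv_layerTerm_none (dyadic_pos hρ k) (hhs k) (hσs k) hΦ hΦ1 ?_
    simp only [heq x hx]
    exact hσψ k x
  rw [bdryLpNorm, eLpNorm_congr_ae (surfMeasure_absolutelyContinuous ψ R |>.ae_le hae)]
  refine (eLpNorm_mono_measure _ (surfMeasure_le hΩ.lipschitz hRδ)).trans (le_of_eq ?_)
  rw [eLpNorm_smul_measure_of_ne_top ENNReal.ofReal_ne_top, smul_eq_mul]
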